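/- **Setting.** Let $(M,g)$ be a closed (compact, without boundary) smooth Riemannian manifold, let $\tau:E\to M$ be a smooth principal bundle with structure group $S^1=\{e^{it}\mid t\in\mathbb R\}\subset\mathbb C$, let $Z(q)=\frac{d}{dt}\big|_{t=0}e^{it}q$ be the fundamental vector field of the action on $E$, and let $\theta$ be a connection $1$-form on $E$, i.e. a smooth $S^1$-invariant $1$-form with $\theta(Z)=1$. Let $\sigma$ be the curvature of $\theta$, i.e. the smooth (automatically closed) $2$-form on $M$ with $d\theta=\tau^*\sigma$. (Every closed $2$-form $\sigma$ in the Euler class of $\tau$ arises in this way.) Equip $E$ with the metric $g^\theta=\tau^*g+\theta\otimes\theta$, with norm $|\cdot|$. Let $H^1(\mathbb R/\mathbb Z,E)$ be the Hilbert manifold of absolutely continuous loops in $E$ with square-integrable derivative. For $k\in\mathbb R$ define on the Hilbert manifold $\mathcal M=H^1(\mathbb R/\mathbb Z,E)\times(0,\infty)\times\mathbb R$ the functional $$\mathbb S_k(\gamma,T,\varphi)=\frac1{2T}\int_0^1|\dot\gamma(t)+\varphi Z(\gamma(t))|^2\,dt-\varphi+kT .$$ A *critical point* of $\mathbb S_k$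 is a point of $\mathcal M$ such that, along every $C^1$ curve in $\mathcal M$ through it, $\mathbb S_k$ is differentiable at that point with derivative $0$. The Lorentz force $Y:TM\to TM$ is the bundle map determined by $g_x(u,Y_x(v))=\sigma_x(u,v)$ for all $x\in M$ and $u,v\in T_xM$. For $T>0$, a *$T$-periodic closed magnetic geodesic of energy $e$* is a $T$-periodic $C^2$ (hence smooth) curve $\mu:\mathbb R\to M$ with $\nabla_t\dot\mu=Y_\mu(\dot\mu)$, where $\nabla$ is the Levi-Civita connection of $g$, and $\frac12|\dot\mu|_g^2= e$ at all times. **Proposition.** Let $k\in\mathbb R$ and $\bar k=k-\frac12$. 1. If $(\gamma,T,\varphi)\in\mathcal M$ is a critical point of $\mathbb S_k$, then $\mu(t)=\tau(\gamma(t/T))$ is a $T$-periodic closed magnetic geodesic of energy $\bar k$. 2. Conversely, for every $T>0$ and every $T$-periodic closed magnetic geodesic $\mu$ of energy $\bar k$ there exist $\gamma\in H^1(\mathbb R/\mathbb Z,E)$ and $\varphi\in\mathbb R$ such that $\mu(t)=\tau(\gamma(t/T))$ for all $t$ and $(\gamma,T,\varphi)$ is a critical point of $\mathbb S_k$. -/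

import Mathlib

open Set Filter Topology MeasureTheory Bundle
open scoped Manifold ContDiff ENNReal

namespace Magnetic

noncomputable section

/-! ## Riemannian metrics, one-forms and two-forms -/

/-- A smooth Riemannian metric on an `n`-dimensional manifold. -/
abbrev Metric (n : ℕ) (M : Type*) [TopologicalSpace M] [ChartedSpace (EuclideanSpace ℝ (Fin n)) M]
    [IsManifold (𝓡 n) ∞ M] : Type _ :=
  ContMDiffRiemannianMetric (𝓡 n) ∞ (EuclideanSpace ℝ (Fin n))
    (fun x : M => TangentSpace (𝓡 n) x)

/-- A smooth differential one-form. -/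
structure OneForm (n : ℕ) (M : Type*) [TopologicalSpace M]
    [ChartedSpace (EuclideanSpace ℝ (Fin n)) M] [IsManifold (𝓡 n) ∞ M] where
  form : ∀ x : M, TangentSpace (𝓡 n) x →L[ℝ] ℝ
  smooth : ContMDiff (𝓡 n) ((𝓡 n).prod 𝓘(ℝ, EuclideanSpace ℝ (Fin n) →L[ℝ] ℝ)) ∞
    (fun x => TotalSpace.mk' (EuclideanSpace ℝ (Fin n) →L[ℝ] ℝ)
      (E := fun x : M => TangentSpace (𝓡 n) x →L[ℝ] ℝ) x (form x))

/-- A smooth differential two-form, that is, a smooth alternating bilinear form on the tangent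
spaces. -/
structure TwoForm (n : ℕ) (M : Type*) [TopologicalSpace M]
    [ChartedSpace (EuclideanSpace ℝ (Fin n)) M] [IsManifold (𝓡 n) ∞ M] where
  form : ∀ x : M, TangentSpace (𝓡 n) x →L[ℝ] TangentSpace (𝓡 n) x →L[ℝ] ℝ
  alternating : ∀ (x : M) (v : TangentSpace (𝓡 n) x), form x v v = 0
  smooth : ContMDiff (𝓡 n)
    ((𝓡 n).prod 𝓘(ℝ, EuclideanSpace ℝ (Fin n) →L[ℝ] EuclideanSpace ℝ (Fin n) →L[ℝ] ℝ)) ∞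
    (fun x => TotalSpace.mk' (EuclideanSpace ℝ (Fin n) →L[ℝ] EuclideanSpace ℝ (Fin n) →L[ℝ] ℝ)
      (E := fun x : M => TangentSpace (𝓡 n) x →L[ℝ] TangentSpace (𝓡 n) x →L[ℝ] ℝ) x (form x))

/-- The covector `u ↦ (D_v(w, u) + D_w(v, u) - D_u(v, w)) / 2` of a family `D` of bilinear forms
depending linearly on a vector. -/
def firstKind {V : Type*} [NormedAddCommGroup V] [NormedSpace ℝ V]
    (D : V →L[ℝ] V →L[ℝ] V →L[ℝ] ℝ) (v w : V) : V →ₗ[ℝ] ℝ where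
  toFun u := (1 / 2 : ℝ) * (D v w u + D w v u - D u v w)
  map_add' u u' := by
    rw [(D v w).map_add, (D w v).map_add, D.map_add, add_apply, add_apply]
    ring
  map_smul' c u := by
    rw [(D v w).map_smul, (D w v).map_smul, D.map_smul, smul_apply, smul_apply]
    simp only [smul_eq_mul, RingHom.id_apply]
    ring

section Base

variable {n : ℕ} {M : Type*} [TopologicalSpace M] [ChartedSpace (EuclideanSpace ℝ (Fin n)) M]
  [IsManifold (𝓡 n) ∞ M]

/-- The derivative at `y` of the inverse of the preferred chart at `x`. -/
def chartInvDeriv (x : M) (y : EuclideanSpace ℝ (Fin n)) :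
    EuclideanSpace ℝ (Fin n) →L[ℝ] TangentSpace (𝓡 n) ((extChartAt (𝓡 n) x).symm y) :=
  mfderiv 𝓘(ℝ, EuclideanSpace ℝ (Fin n)) (𝓡 n) (extChartAt (𝓡 n) x).symm y

/-- The coordinate expression of a one-form in the preferred chart at `x`. -/
def OneForm.local (θ : OneForm n M) (x : M) (y : EuclideanSpace ℝ (Fin n)) :
    EuclideanSpace ℝ (Fin n) →L[ℝ] ℝ :=
  (θ.form ((extChartAt (𝓡 n) x).symm y)).comp (chartInvDeriv x y)

/-- The exterior derivative `(dθ)_x(u, v) = ∂_u (θ v) - ∂_v (θ u)` (`u`, `v` extended as constant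
vector fields in the preferred chart at `x`; the tangent space at `x` is, by definition, the model
space seen through that chart). -/
def OneForm.d (θ : OneForm n M) (x : M) (u v : TangentSpace (𝓡 n) x) : ℝ :=
  fderiv ℝ (θ.local x) (extChartAt (𝓡 n) x x) u v - fderiv ℝ (θ.local x) (extChartAt (𝓡 n) x x) v u

/-- The coordinate expression of a metric in the preferred chart at `x`:
`(v, w) ↦ g(Dψ v, Dψ w)` at `y`, with `ψ` the inverse of the chart. -/
def localMetric (g : Metric n M) (x : M) (y : EuclideanSpace ℝ (Fin n)) :
    EuclideanSpace ℝ (Fin n) →L[ℝ] EuclideanSpace ℝ (Fin n) →L[ℝ] ℝ :=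
  let G : EuclideanSpace ℝ (Fin n) →L[ℝ] EuclideanSpace ℝ (Fin n) →L[ℝ] ℝ :=
    g.inner ((extChartAt (𝓡 n) x).symm y)
  let A : EuclideanSpace ℝ (Fin n) →L[ℝ] EuclideanSpace ℝ (Fin n) := chartInvDeriv x y
  G.bilinearComp A A

/-- The map `v ↦ g(v, ·)` from the tangent space at `x` to its dual. -/
def flat (g : Metric n M) (x : M) : TangentSpace (𝓡 n) x →ₗ[ℝ] (TangentSpace (𝓡 n) x →ₗ[ℝ] ℝ) where
  toFun v := (g.inner x v : TangentSpace (𝓡 n) x →ₗ[ℝ] ℝ)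
  map_add' v w := by ext u; simp
  map_smul' c v := by ext u; simp

theorem flat_bijective (g : Metric n M) (x : M) : Function.Bijective (flat g x) := by
  have hinj : Function.Injective (flat g x) := by
    rw [injective_iff_map_eq_zero]
    intro v hv
    by_contra hne
    have hpos := g.pos x v hne
    have h0 : g.inner x v v = 0 := congrArg (fun L => L v) hv
    linarith
  have : FiniteDimensional ℝ (TangentSpace (𝓡 n) x) :=
    inferInstanceAs (FiniteDimensional ℝ (EuclideanSpace ℝ (Fin n)))
  exact ⟨hinj, (LinearMap.injective_iff_surjective_of_finrank_eq_finrank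
    (Subspace.dual_finrank_eq (K := ℝ) (V := TangentSpace (𝓡 n) x)).symm).1 hinj⟩

/-- The tangent vector dual to a covector, with respect to the metric. -/
def sharp (g : Metric n M) (x : M) (a : TangentSpace (𝓡 n) x →ₗ[ℝ] ℝ) : TangentSpace (𝓡 n) x :=
  (LinearEquiv.ofBijective (flat g x) (flat_bijective g x)).symm a

theorem inner_sharp (g : Metric n M) (x : M) (a : TangentSpace (𝓡 n) x →ₗ[ℝ] ℝ)
    (u : TangentSpace (𝓡 n) x) : g.inner x u (sharp g x a) = a u := by
  rw [g.symm]
  exact congrArg (fun L => L u)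
    ((LinearEquiv.ofBijective (flat g x) (flat_bijective g x)).apply_symm_apply a)

/-- The Christoffel symbols of the first kind at `x`, in the preferred chart at `x`, as a covector:
`u ↦ (∂_v g(w, u) + ∂_w g(v, u) - ∂_u g(v, w)) / 2`. -/
def christoffelFirst (g : Metric n M) (x : M) (v w : EuclideanSpace ℝ (Fin n)) :
    EuclideanSpace ℝ (Fin n) →ₗ[ℝ] ℝ :=
  firstKind (V := EuclideanSpace ℝ (Fin n))
    (fderiv ℝ (E := EuclideanSpace ℝ (Fin n))
      (F := EuclideanSpace ℝ (Fin n) →L[ℝ] EuclideanSpace ℝ (Fin n) →L[ℝ] ℝ)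
      (localMetric g x) (extChartAt (𝓡 n) x x)) v w

/-- The Christoffel symbols of the Levi-Civita connection at `x`, in the preferred chart at `x`. -/
def christoffel (g : Metric n M) (x : M) (v w : TangentSpace (𝓡 n) x) : TangentSpace (𝓡 n) x :=
  sharp g x (christoffelFirst g x v w)

/-- The velocity of a curve. -/
def velocity (c : ℝ → M) (t : ℝ) : TangentSpace (𝓡 n) (c t) :=
  mfderiv 𝓘(ℝ, ℝ) (𝓡 n) c t (1 : ℝ)

/-- The covariant derivative `∇_t μ'` of the velocity along a curve, for the Levi-Civita connection:
the second derivative in the preferred chart at `μ t`, plus the Christoffel term. -/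
def covariantAcceleration (g : Metric n M) (μ : ℝ → M) (t : ℝ) : TangentSpace (𝓡 n) (μ t) :=
  let a : TangentSpace (𝓡 n) (μ t) := deriv (deriv (fun s => extChartAt (𝓡 n) (μ t) (μ s))) t
  a + christoffel g (μ t) (velocity μ t) (velocity μ t)

/-- The Lorentz force `Y`, characterised by `g(u, Y v) = σ(u, v)`. -/
def lorentzForce (g : Metric n M) (σ : TwoForm n M) (x : M) (v : TangentSpace (𝓡 n) x) :
    TangentSpace (𝓡 n) x :=
  sharp g x
    { toFun := fun u => σ.form x u v
      map_add' := fun u u' => by simp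
      map_smul' := fun c u => by simp }

theorem inner_lorentzForce (g : Metric n M) (σ : TwoForm n M) (x : M)
    (u v : TangentSpace (𝓡 n) x) : g.inner x u (lorentzForce g σ x v) = σ.form x u v :=
  inner_sharp g x _ u

/-- `μ` is a `T`-periodic closed magnetic geodesic of the pair `(g, σ)` with energy `e`. -/
structure IsClosedMagneticGeodesic (g : Metric n M) (σ : TwoForm n M) (T e : ℝ) (μ : ℝ → M) :
    Prop where
  contMDiff : ContMDiff 𝓘(ℝ, ℝ) (𝓡 n) 2 μ
  periodic : Function.Periodic μ T
  equation : ∀ t, covariantAcceleration g μ t = lorentzForce g σ (μ t) (velocity μ t)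
  energy : ∀ t, (1 / 2 : ℝ) * g.inner (μ t) (velocity μ t) (velocity μ t) = e

end Base

/-! ## Principal circle bundles and connection forms -/

section BundleSection

variable {n : ℕ} {M E : Type*} [TopologicalSpace M] [ChartedSpace (EuclideanSpace ℝ (Fin n)) M]
  [IsManifold (𝓡 n) ∞ M]
  [TopologicalSpace E] [ChartedSpace (EuclideanSpace ℝ (Fin (n + 1))) E]
  [IsManifold (𝓡 (n + 1)) ∞ E] [MulAction Circle E]

/-- `τ : E → M` is a smooth principal bundle with structure group the circle: the action is smooth
and near every point of `M` there is a smooth equivariant local trivialization. -/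
structure IsPrincipalCircleBundle (n : ℕ) {M E : Type*} [TopologicalSpace M]
    [ChartedSpace (EuclideanSpace ℝ (Fin n)) M] [TopologicalSpace E]
    [ChartedSpace (EuclideanSpace ℝ (Fin (n + 1))) E] [MulAction Circle E] (τ : E → M) : Prop where
  contMDiff_proj : ContMDiff (𝓡 (n + 1)) (𝓡 n) ∞ τ
  contMDiff_smul : ContMDiff ((𝓡 1).prod (𝓡 (n + 1))) (𝓡 (n + 1)) ∞
    (fun p : Circle × E => p.1 • p.2)
  proj_smul : ∀ (z : Circle) (q : E), τ (z • q) = τ q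
  exists_trivialization : ∀ x : M, ∃ e : Trivialization Circle τ, x ∈ e.baseSet ∧
    ContMDiffOn (𝓡 (n + 1)) ((𝓡 n).prod (𝓡 1)) ∞ e e.source ∧
    ContMDiffOn ((𝓡 n).prod (𝓡 1)) (𝓡 (n + 1)) ∞ e.toOpenPartialHomeomorph.symm e.target ∧
    ∀ (z : Circle), ∀ q ∈ e.source, e (z • q) = (τ q, z * (e q).2)

/-- The fundamental vector field of the circle action: the velocity at time `0` of
`t ↦ e^{it} • q`. -/
def fundamentalField (n : ℕ) {E : Type*} [TopologicalSpace E]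
    [ChartedSpace (EuclideanSpace ℝ (Fin (n + 1))) E] [MulAction Circle E] (q : E) :
    TangentSpace (𝓡 (n + 1)) q :=
  (mfderiv 𝓘(ℝ, ℝ) (𝓡 (n + 1)) (fun t : ℝ => Circle.exp t • q) 0 (1 : ℝ) :
    EuclideanSpace ℝ (Fin (n + 1)))

/-- `θ` is a connection one-form: it is invariant under the circle action and takes the value `1`
on the fundamental vector field. -/
structure IsConnectionForm (θ : OneForm (n + 1) E) : Prop where
  invariant : ∀ (z : Circle) (q : E) (v : TangentSpace (𝓡 (n + 1)) q),
    θ.form (z • q) (mfderiv (𝓡 (n + 1)) (𝓡 (n + 1)) (fun q' : E => z • q') q v) = θ.form q v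
  normalized : ∀ q : E, θ.form q (fundamentalField n q) = 1

/-- The curvature of `θ` is `σ`, that is, `dθ = τ^* σ`. -/
def HasCurvature (τ : E → M) (θ : OneForm (n + 1) E) (σ : TwoForm n M) : Prop :=
  ∀ (q : E) (u v : TangentSpace (𝓡 (n + 1)) q),
    θ.d q u v = σ.form (τ q) (mfderiv (𝓡 (n + 1)) (𝓡 n) τ q u) (mfderiv (𝓡 (n + 1)) (𝓡 n) τ q v)

/-- The metric `g^θ = τ^* g + θ ⊗ θ` on the total space. -/
def liftedInner (g : Metric n M) (τ : E → M) (θ : OneForm (n + 1) E) (q : E)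
    (u v : TangentSpace (𝓡 (n + 1)) q) : ℝ :=
  g.inner (τ q) (mfderiv (𝓡 (n + 1)) (𝓡 n) τ q u) (mfderiv (𝓡 (n + 1)) (𝓡 n) τ q v) +
    θ.form q u * θ.form q v

end BundleSection

/-! ## Loops of Sobolev class `H¹` -/

/-- Loops `S¹ = ℝ/ℤ → N` of class `H¹` in a (compact) manifold, written as `1`-periodic maps:
absolutely continuous with square-integrable derivative. A continuous loop has this property in
local coordinates of `N` iff its composition with every smooth real function on `N` has it. -/
structure H1Loop (m : ℕ) (N : Type*) [TopologicalSpace N]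
    [ChartedSpace (EuclideanSpace ℝ (Fin m)) N] where
  toFun : ℝ → N
  periodic : Function.Periodic toFun 1
  continuous : Continuous toFun
  absolutelyContinuous : ∀ f : C^∞⟮𝓡 m, N; 𝓘(ℝ, ℝ), ℝ⟯,
    AbsolutelyContinuousOnInterval (fun t => f (toFun t)) 0 1
  memLp_deriv : ∀ f : C^∞⟮𝓡 m, N; 𝓘(ℝ, ℝ), ℝ⟯,
    MemLp (deriv (fun t => f (toFun t))) 2 (volume.restrict (Ioc (0 : ℝ) 1))

section Loops

variable {m : ℕ} {N : Type*} [TopologicalSpace N] [ChartedSpace (EuclideanSpace ℝ (Fin m)) N]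

theorem H1Loop.memLp (γ : H1Loop m N) (f : C^∞⟮𝓡 m, N; 𝓘(ℝ, ℝ), ℝ⟯) :
    MemLp (fun t => f (γ.toFun t)) 2 (volume.restrict (Ioc (0 : ℝ) 1)) := by
  have hc : Continuous (fun t => f (γ.toFun t)) := f.contMDiff.continuous.comp γ.continuous
  obtain ⟨C, hC⟩ := (isCompact_Icc (a := (0 : ℝ)) (b := 1)).exists_bound_of_continuousOn
    hc.continuousOn
  refine MemLp.of_bound hc.aestronglyMeasurable C ?_
  filter_upwards [ae_restrict_mem measurableSet_Ioc] with t ht using hC t (Ioc_subset_Icc_self ht)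

/-- The element `f ∘ γ` of the Sobolev space `H¹(S¹, ℝ)`, which is identified with the closed
subspace `{(u, u')}` of `L² × L²`. -/
def H1Loop.comp (γ : H1Loop m N) (f : C^∞⟮𝓡 m, N; 𝓘(ℝ, ℝ), ℝ⟯) :
    Lp ℝ 2 (volume.restrict (Ioc (0 : ℝ) 1)) × Lp ℝ 2 (volume.restrict (Ioc (0 : ℝ) 1)) :=
  ((γ.memLp f).toLp _, (γ.memLp_deriv f).toLp _)

/-- The manifold `H¹(S¹, N) × (0, ∞) × ℝ`. -/
abbrev LoopSpace (m : ℕ) (N : Type*) [TopologicalSpace N]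
    [ChartedSpace (EuclideanSpace ℝ (Fin m)) N] : Type _ :=
  H1Loop m N × Ioi (0 : ℝ) × ℝ

/-- A `C¹` curve in the Hilbert manifold `H¹(S¹, N) × (0, ∞) × ℝ`. The Hilbert manifold structure of
`H¹(S¹, N)`, for compact `N`, is the one of a submanifold of `H¹(S¹, ℝᵈ)`, for any smooth embedding
of `N` in `ℝᵈ`; hence a curve in `H¹(S¹, N)` is `C¹` iff its composition with every smooth real
function `f` on `N` is a `C¹` curve in the Hilbert space `H¹(S¹, ℝ)`. -/
structure IsC1Curve (c : ℝ → LoopSpace m N) : Prop where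
  loop : ∀ f : C^∞⟮𝓡 m, N; 𝓘(ℝ, ℝ), ℝ⟯, ContDiff ℝ 1 (fun s => (c s).1.comp f)
  period : ContDiff ℝ 1 (fun s => ((c s).2.1 : ℝ))
  phase : ContDiff ℝ 1 (fun s => (c s).2.2)

/-- `p` is a critical point of the functional `S`: along every `C¹` curve through `p` the functional
is differentiable at `p`, with derivative zero. -/
def IsCriticalPoint (S : LoopSpace m N → ℝ) (p : LoopSpace m N) : Prop :=
  ∀ c : ℝ → LoopSpace m N, IsC1Curve c → c 0 = p → HasDerivAt (fun s => S (c s)) 0 0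

end Loops

/-! ## The functional -/

/-- `S_k(γ, T, φ) = (1 / 2T) ∫₀¹ |γ'(t) + φ Z(γ(t))|² dt - φ + k T`, with the norm of the metric
`g^θ` on the total space. -/
def actionFunctional {n : ℕ} {M E : Type*} [TopologicalSpace M]
    [ChartedSpace (EuclideanSpace ℝ (Fin n)) M] [IsManifold (𝓡 n) ∞ M]
    [TopologicalSpace E] [ChartedSpace (EuclideanSpace ℝ (Fin (n + 1))) E]
    [IsManifold (𝓡 (n + 1)) ∞ E] [MulAction Circle E]
    (g : Metric n M) (τ : E → M) (θ : OneForm (n + 1) E) (k : ℝ) (p : LoopSpace (n + 1) E) : ℝ :=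
  let γ : ℝ → E := p.1.toFun
  let T : ℝ := p.2.1
  let φ : ℝ := p.2.2
  let w : ∀ t : ℝ, TangentSpace (𝓡 (n + 1)) (γ t) :=
    fun t => velocity γ t + φ • fundamentalField n (γ t)
  1 / (2 * T) * (∫ t in (0 : ℝ)..1, liftedInner g τ θ (γ t) (w t) (w t)) - φ + k * T

end

end Magnetic

/-!
The action functional of a loop `γ` with period `T` and phase `φ` splits into the kinetic energy of
the projection `ν = τ ∘ γ` and the square of the shifted vertical speed `θ(γ') + φ`. Its
Euler-Lagrange equations split accordingly. Along the fibres they say that `θ(γ') + φ` is constant,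
and the derivative in `φ` identifies the constant as `T`. With `dθ = τ^*σ` and Cartan's formula, the
remaining equations become `∇ₜν' = T Y(ν')`, the equation of a magnetic geodesic run through in
time `1` instead of `T`. The Lorentz force `Y` is skew-symmetric, so `|ν'|²` is constant, and the
derivative in `T` fixes its value.

All of this happens for loops of class `H¹` only, and everything is expressed through finitely many
scalar `H¹` functions. A compact manifold carries smooth functions `fₖ` and smooth vector fields
`Xₖ` with `∑ dfₖ ⊗ Xₖ = id`, where the `fₖ` separate points and contain local coordinates
(`exists_smoothFrame`). In such a frame the metric has the coefficients `g(Xᵢ, Xⱼ)` and the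
connection form the coefficients `θ(Xₖ)`, the action becomes an integral of products of functions
`F(γ)` and derivatives `(G(γ))'`, and the Sobolev embedding of `H¹` into `L^∞` yields its derivative
along every `C¹` curve of loops (`IsC1Curve.hasDerivAt_action`). Likewise the exterior derivative and
the covariant acceleration are expressed in a frame (`OneForm.d_eq_sum`,
`SmoothFrame.inner_covariantAcceleration`).

For a critical point, the variations `Φ (s η, γ)` generated by families of maps `Φ` with initial
velocity `X` and periodic functions `η` in `H¹`, together with the lemma of du Bois-Reymond, give
the Euler-Lagrange equations in integrated form (`linDensity_eq_of_critical`,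
`momentum_eq_of_critical`). Thus the inner products of the velocity with the fields of a frame are
primitives of integrable functions. They determine the velocity, because the Gram matrix of the
frame can be completed to a smooth invertible matrix without changing its values on velocities
(`deriv_fn_eq`). So the loop is of class `C¹`, and by the same argument of class `C²`
(`regularity_of_critical`), and the equations hold pointwise.

Conversely, a closed magnetic geodesic, reparametrized to period `1`, has a horizontal lift, built
from local trivializations (`exists_lift`). Its end point is a rotation of its initial point;
rotating back at constant speed yields a closed lift of constant vertical speed `β`
(`exists_closed_lift`). With the phase `φ = T - β` the derivative of the action in each direction
vanishes, since the contribution of the loop is the integral of a total derivative over the circle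
(`isCriticalPoint_of_lift`).
-/

namespace Magnetic

set_option linter.unusedSectionVars false

/-! ### Periodic functions of class `H¹` -/

/-- Lebesgue measure on a period. -/
noncomputable abbrev unitMeasure : Measure ℝ := volume.restrict (Ioc (0 : ℝ) 1)

/-- A `1`-periodic real function of class `H¹`: absolutely continuous on a period, with
square-integrable derivative. -/
structure PeriodicH1 (u : ℝ → ℝ) : Prop where
  periodic : Function.Periodic u 1
  absolutelyContinuous : AbsolutelyContinuousOnInterval u 0 1
  memLp_deriv : MemLp (deriv u) 2 unitMeasure

theorem periodic_deriv {u : ℝ → ℝ} {c : ℝ} (h : Function.Periodic u c) :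
    Function.Periodic (deriv u) c := by
  intro t
  rw [← deriv_comp_add_const]
  congr 1
  exact funext h

theorem ae_unitMeasure_of_Ioo {p : ℝ → Prop} (h : ∀ᵐ t, t ∈ Ioo (0 : ℝ) 1 → p t) :
    ∀ᵐ t ∂unitMeasure, p t := by
  rw [unitMeasure, ← restrict_Ioo_eq_restrict_Ioc]
  exact (ae_restrict_iff' measurableSet_Ioo).2 h

theorem ae_unitMeasure_mem_Ioo : ∀ᵐ t ∂unitMeasure, t ∈ Ioo (0 : ℝ) 1 :=
  ae_unitMeasure_of_Ioo (.of_forall fun _ h => h)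

/-- A continuous function is square integrable over a period. -/
theorem memLp_two_of_continuousOn {u : ℝ → ℝ} (hu : ContinuousOn u (Icc 0 1)) :
    MemLp u 2 unitMeasure := by
  obtain ⟨C, hC⟩ := (isCompact_Icc (a := (0 : ℝ)) (b := 1)).exists_bound_of_continuousOn hu
  refine MemLp.of_bound ((hu.mono Ioc_subset_Icc_self).aestronglyMeasurable measurableSet_Ioc) C ?_
  filter_upwards [ae_restrict_mem measurableSet_Ioc] with t ht using hC t (Ioc_subset_Icc_self ht)

theorem MemLp.continuousOn_mul {u v : ℝ → ℝ} (hu : ContinuousOn u (Icc 0 1))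
    (hv : MemLp v 2 unitMeasure) : MemLp (fun t => u t * v t) 2 unitMeasure := by
  obtain ⟨C, hC⟩ := (isCompact_Icc (a := (0 : ℝ)) (b := 1)).exists_bound_of_continuousOn hu
  refine MemLp.of_le_mul (c := C) hv
    (((hu.mono Ioc_subset_Icc_self).aestronglyMeasurable measurableSet_Ioc).mul
      hv.aestronglyMeasurable) ?_
  filter_upwards [ae_restrict_mem measurableSet_Ioc] with t ht
  rw [norm_mul]
  gcongr
  exact hC t (Ioc_subset_Icc_self ht)

theorem MemLp.intervalIntegrable_mul {u v : ℝ → ℝ} (hu : MemLp u 2 unitMeasure)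
    (hv : MemLp v 2 unitMeasure) : IntervalIntegrable (fun t => u t * v t) volume 0 1 := by
  rw [intervalIntegrable_iff_integrableOn_Ioc_of_le zero_le_one]
  exact MemLp.integrable_mul hu hv

theorem MemLp.intervalIntegrable_unit {u : ℝ → ℝ} (hu : MemLp u 2 unitMeasure) :
    IntervalIntegrable u volume 0 1 := by
  rw [intervalIntegrable_iff_integrableOn_Ioc_of_le zero_le_one]
  exact hu.integrable one_le_two

theorem uIcc_zero_one : uIcc (0 : ℝ) 1 = Icc 0 1 := uIcc_of_le zero_le_one

theorem continuous_of_periodic {α : Type*} [TopologicalSpace α] {u : ℝ → α}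
    (hp : Function.Periodic u 1) (hc : ContinuousOn u (Icc 0 1)) : Continuous u := by
  have h : Continuous (u ∘ Int.fract) :=
    hc.comp_fract'' (by have := hp 0; rw [zero_add] at this; exact this.symm)
  convert h using 1
  ext t
  rw [Function.comp_apply, Int.fract]
  have := hp.sub_int_mul_eq ⌊t⌋ (x := t)
  rw [mul_one] at this
  exact this.symm

/-- Lebesgue's differentiation theorem: a primitive has the integrand as its derivative almost
everywhere. -/
theorem ae_deriv_eq_of_eq_integral {u v : ℝ → ℝ} {c : ℝ} (hv : IntervalIntegrable v volume 0 1)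
    (h : ∀ t ∈ Icc (0 : ℝ) 1, u t = c + ∫ r in (0 : ℝ)..t, v r) :
    ∀ᵐ t ∂unitMeasure, HasDerivAt u (v t) t := by
  refine ae_unitMeasure_of_Ioo ?_
  filter_upwards [hv.ae_hasDerivAt_integral] with t ht htI
  have h1 := (ht (by rw [uIcc_zero_one]; exact Ioo_subset_Icc_self htI) 0 (by simp)).const_add c
  refine h1.congr_of_eventuallyEq ?_
  filter_upwards [Ioo_mem_nhds htI.1 htI.2] with s hs using h s (Ioo_subset_Icc_self hs)

namespace PeriodicH1

variable {u w : ℝ → ℝ}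

theorem continuousOn (hu : PeriodicH1 u) : ContinuousOn u (Icc 0 1) := by
  have := hu.absolutelyContinuous.continuousOn
  rwa [uIcc_zero_one] at this

theorem continuous (hu : PeriodicH1 u) : Continuous u :=
  continuous_of_periodic hu.periodic hu.continuousOn

theorem memLp (hu : PeriodicH1 u) : MemLp u 2 unitMeasure :=
  memLp_two_of_continuousOn hu.continuousOn

theorem ae_hasDerivAt (hu : PeriodicH1 u) : ∀ᵐ t ∂unitMeasure, HasDerivAt u (deriv u t) t := by
  refine ae_unitMeasure_of_Ioo ?_
  filter_upwards [hu.absolutelyContinuous.ae_differentiableAt] with t ht htI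
  exact (ht (by rw [uIcc_zero_one]; exact Ioo_subset_Icc_self htI)).hasDerivAt

theorem apply_one (hu : PeriodicH1 u) : u 1 = u 0 := by
  have := hu.periodic 0
  rwa [zero_add] at this

theorem eq_integral (hu : PeriodicH1 u) {t : ℝ} (ht : t ∈ Icc (0 : ℝ) 1) :
    u t = u 0 + ∫ r in (0 : ℝ)..t, deriv u r := by
  have := (hu.absolutelyContinuous.mono (c := 0) (d := t) (by
    rw [uIcc_zero_one, uIcc_of_le ht.1]; exact Icc_subset_Icc_right ht.2)).integral_deriv_eq_sub
  rw [this]; ring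

theorem integral_deriv (hu : PeriodicH1 u) : ∫ t in (0 : ℝ)..1, deriv u t = 0 := by
  rw [hu.absolutelyContinuous.integral_deriv_eq_sub, hu.apply_one, sub_self]

/-- A periodic function which is a primitive of a square-integrable function over a period is of
class `H¹`. -/
theorem of_eq_integral {v : ℝ → ℝ} (hp : Function.Periodic u 1) (hv : MemLp v 2 unitMeasure)
    (h : ∀ t ∈ Icc (0 : ℝ) 1, u t = u 0 + ∫ r in (0 : ℝ)..t, v r) : PeriodicH1 u := by
  have hvi := MemLp.intervalIntegrable_unit hv
  refine ⟨hp, ?_, ?_⟩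
  · have h1 := hvi.absolutelyContinuousOnInterval_intervalIntegral (c := 0) (by simp)
    have h2 : AbsolutelyContinuousOnInterval (fun _ : ℝ => u 0) 0 1 :=
      (LipschitzWith.const (u 0)).lipschitzOnWith.absolutelyContinuousOnInterval
    have h3 := h2.fun_add h1
    rw [absolutelyContinuousOnInterval_iff] at h3 ⊢
    intro ε hε
    obtain ⟨δ, hδ, H⟩ := h3 ε hε
    refine ⟨δ, hδ, fun E hE hd => ?_⟩
    convert! H E hE hd using 1
    refine Finset.sum_congr rfl fun i hi => ?_
    have := hE.1 i hi
    rw [uIcc_zero_one] at this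
    rw [h _ this.1, h _ this.2]
  · refine hv.ae_eq ?_
    filter_upwards [ae_deriv_eq_of_eq_integral hvi h] with t ht using ht.deriv.symm

theorem const (c : ℝ) : PeriodicH1 (fun _ => c) where
  periodic _ := rfl
  absolutelyContinuous :=
    (LipschitzWith.const c).lipschitzOnWith.absolutelyContinuousOnInterval
  memLp_deriv := by simp

theorem add (hu : PeriodicH1 u) (hw : PeriodicH1 w) : PeriodicH1 (fun t => u t + w t) where
  periodic t := by simp only [hu.periodic t, hw.periodic t]
  absolutelyContinuous := hu.absolutelyContinuous.fun_add hw.absolutelyContinuous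
  memLp_deriv := by
    refine (hu.memLp_deriv.add hw.memLp_deriv).ae_eq ?_
    filter_upwards [hu.ae_hasDerivAt, hw.ae_hasDerivAt] with t h1 h2
    exact (h1.fun_add h2).deriv.symm

theorem mul (hu : PeriodicH1 u) (hw : PeriodicH1 w) : PeriodicH1 (fun t => u t * w t) where
  periodic t := by simp only [hu.periodic t, hw.periodic t]
  absolutelyContinuous := hu.absolutelyContinuous.fun_mul hw.absolutelyContinuous
  memLp_deriv := by
    have h1 := MemLp.continuousOn_mul hw.continuousOn hu.memLp_deriv
    have h2 := MemLp.continuousOn_mul hu.continuousOn hw.memLp_deriv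
    refine (h1.add h2).ae_eq ?_
    filter_upwards [hu.ae_hasDerivAt, hw.ae_hasDerivAt] with t h1 h2
    rw [(h1.fun_mul h2).deriv, Pi.add_apply]
    ring

theorem sum {ι : Type*} (s : Finset ι) {u : ι → ℝ → ℝ} (hu : ∀ i, PeriodicH1 (u i)) :
    PeriodicH1 (fun t => ∑ i ∈ s, u i t) := by
  classical
  induction s using Finset.induction_on with
  | empty => simpa using const 0
  | insert i s hi ih =>
    simp only [Finset.sum_insert hi]
    exact (hu i).add ih

/-- A periodic `H¹` function whose derivative agrees almost everywhere with a continuous function is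
differentiable everywhere. -/
theorem hasDerivAt_of_ae_eq {v : ℝ → ℝ} (hu : PeriodicH1 u) (hv : Continuous v)
    (hvp : Function.Periodic v 1) (h : ∀ᵐ t ∂unitMeasure, deriv u t = v t) (t : ℝ) :
    HasDerivAt u (v t) t := by
  have hI : ∀ s ∈ Icc (0 : ℝ) 1, u s = u 0 + ∫ r in (0 : ℝ)..s, v r := by
    intro s hs
    rw [hu.eq_integral hs]
    congr 1
    refine intervalIntegral.integral_congr_ae ?_
    have h' := (ae_restrict_iff' measurableSet_Ioc).1 h
    filter_upwards [h'] with r hr hrs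
    rw [uIoc_of_le hs.1] at hrs
    exact hr ⟨hrs.1, hrs.2.trans hs.2⟩
  have hint : ∫ r in (0 : ℝ)..1, v r = 0 := by
    have := hI 1 (by simp)
    rw [hu.apply_one] at this
    linarith
  have hper : Function.Periodic (fun s => u s - ∫ r in (0 : ℝ)..s, v r) 1 := by
    intro s
    have h1 : ∫ r in (0 : ℝ)..(s + 1), v r
        = (∫ r in (0 : ℝ)..s, v r) + ∫ r in s..(s + 1), v r :=
      (intervalIntegral.integral_add_adjacent_intervals (hv.intervalIntegrable _ _)
        (hv.intervalIntegrable _ _)).symm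
    have h2 : ∫ r in s..(s + 1), v r = 0 := by
      have := hvp.intervalIntegral_add_eq s 0
      rw [zero_add] at this
      rw [this, hint]
    simp only [hu.periodic s, h1, h2, add_zero]
  have hconst : ∀ s, u s = u 0 + ∫ r in (0 : ℝ)..s, v r := by
    intro s
    have h1 := hper.sub_int_mul_eq ⌊s⌋ (x := s)
    rw [mul_one] at h1
    have h2 := hI (Int.fract s) ⟨Int.fract_nonneg s, (Int.fract_lt_one s).le⟩
    rw [Int.fract] at h2
    linarith
  have h3 := (intervalIntegral.integral_hasDerivAt_right (hv.intervalIntegrable 0 t)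
    hv.stronglyMeasurable.stronglyMeasurableAtFilter hv.continuousAt).const_add (u 0)
  exact h3.congr_of_eventuallyEq (.of_forall hconst)

/-- A periodic function whose increments are controlled by those of finitely many `H¹` functions is
of class `H¹`. -/
theorem of_dist_le {ι : Type*} [Fintype ι] {U : ι → ℝ → ℝ} (hU : ∀ i, PeriodicH1 (U i))
    (hp : Function.Periodic u 1) {C : ℝ}
    (h : ∀ t ∈ Icc (0 : ℝ) 1, ∀ s ∈ Icc (0 : ℝ) 1, |u t - u s| ≤ C * ∑ i, |U i t - U i s|) :
    PeriodicH1 u := by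
  have hac : AbsolutelyContinuousOnInterval u 0 1 := by
    have hs : Tendsto (fun E : ℕ × (ℕ → ℝ × ℝ) =>
        C * ∑ i, ∑ j ∈ Finset.range E.1, dist (U i (E.2 j).1) (U i (E.2 j).2))
        (AbsolutelyContinuousOnInterval.totalLengthFilter ⊓
          𝓟 (AbsolutelyContinuousOnInterval.disjWithin 0 1)) (𝓝 0) := by
      have := (tendsto_finsetSum Finset.univ
        fun i _ => (hU i).absolutelyContinuous).const_mul C
      simpa using this
    refine squeeze_zero' (.of_forall fun E => Finset.sum_nonneg fun _ _ => dist_nonneg) ?_ hs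
    filter_upwards [mem_inf_of_right (mem_principal_self _)] with E hE
    rw [Finset.sum_comm, Finset.mul_sum]
    refine Finset.sum_le_sum fun j hj => ?_
    have := hE.1 j hj
    rw [uIcc_zero_one] at this
    simpa only [Real.dist_eq] using h _ this.1 _ this.2
  refine ⟨hp, hac, ?_⟩
  have hsum : MemLp (fun t => ∑ i, |deriv (U i) t|) 2 unitMeasure :=
    memLp_finsetSum _ fun i _ => (hU i).memLp_deriv.abs
  refine MemLp.of_le_mul (c := C) hsum (measurable_deriv u).aestronglyMeasurable ?_
  have hu : ∀ᵐ t ∂unitMeasure, HasDerivAt u (deriv u t) t := by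
    refine ae_unitMeasure_of_Ioo ?_
    filter_upwards [hac.ae_differentiableAt] with t ht htI
    exact (ht (by rw [uIcc_zero_one]; exact Ioo_subset_Icc_self htI)).hasDerivAt
  filter_upwards [hu, ae_all_iff.2 fun i => (hU i).ae_hasDerivAt, ae_unitMeasure_mem_Ioo]
    with t h1 h2 h3
  rw [Real.norm_of_nonneg (Finset.sum_nonneg fun _ _ => abs_nonneg _), Real.norm_eq_abs]
  have hL := (hasDerivAt_iff_tendsto_slope.1 h1).abs
  have hR := (tendsto_finsetSum Finset.univ fun i _ =>
    (hasDerivAt_iff_tendsto_slope.1 (h2 i)).abs).const_mul C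
  refine le_of_tendsto_of_tendsto hL hR ?_
  filter_upwards [mem_nhdsWithin_of_mem_nhds (Ioo_mem_nhds h3.1 h3.2)] with s hs
  have := h s (Ioo_subset_Icc_self hs) t (Ioo_subset_Icc_self h3)
  simp only [slope_def_field, abs_div]
  rw [← Finset.sum_div, ← mul_div_assoc]
  gcongr

end PeriodicH1

/-- The lemma of du Bois-Reymond on the circle: if `∫ (η' P + η R) = 0` for all periodic `H¹`
functions `η`, then `P` is a primitive of `R`. -/
theorem duBoisReymond {P R : ℝ → ℝ} (hP : MemLp P 2 unitMeasure)
    (hR : IntervalIntegrable R volume 0 1)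
    (h : ∀ η, PeriodicH1 η → ∫ t in (0 : ℝ)..1, (deriv η t * P t + η t * R t) = 0) :
    (∫ t in (0 : ℝ)..1, R t = 0) ∧
      ∃ c, ∀ᵐ t ∂unitMeasure, P t = c + ∫ r in (0 : ℝ)..t, R r := by
  have hR0 : ∫ t in (0 : ℝ)..1, R t = 0 := by simpa using h _ (PeriodicH1.const 1)
  refine ⟨hR0, ?_⟩
  set Q : ℝ → ℝ := fun t => ∫ r in (0 : ℝ)..t, R r with hQ
  have hQac : AbsolutelyContinuousOnInterval Q 0 1 :=
    hR.absolutelyContinuousOnInterval_intervalIntegral (by simp)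
  have hQc : ContinuousOn Q (Icc 0 1) := by
    have := hQac.continuousOn; rwa [uIcc_zero_one] at this
  have hPQ : MemLp (fun t => P t - Q t) 2 unitMeasure := hP.sub (memLp_two_of_continuousOn hQc)
  set c : ℝ := ∫ t in (0 : ℝ)..1, (P t - Q t) with hc
  -- the optimal test function: its derivative is the mean-free part of `P - Q`
  set v : ℝ → ℝ := fun t => P t - Q t - c with hv
  have hvL : MemLp v 2 unitMeasure := hPQ.sub (memLp_const c)
  have hvi := MemLp.intervalIntegrable_unit hvL
  have hv0 : ∫ t in (0 : ℝ)..1, v t = 0 := by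
    rw [hv, intervalIntegral.integral_sub (MemLp.intervalIntegrable_unit hPQ)
      intervalIntegrable_const]
    simp [hc]
  set η : ℝ → ℝ := fun t => ∫ r in (0 : ℝ)..(Int.fract t), v r with hη
  have hηI : ∀ t ∈ Icc (0 : ℝ) 1, η t = η 0 + ∫ r in (0 : ℝ)..t, v r := by
    intro t ht
    rcases eq_or_lt_of_le ht.2 with rfl | h1
    · simp [hη, hv0]
    · simp [hη, Int.fract_eq_self.2 ⟨ht.1, h1⟩]
  have hηH : PeriodicH1 η := PeriodicH1.of_eq_integral (fun t => by simp [hη]) hvL hηI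
  have hη0 : η 0 = 0 := by simp [hη]
  have hη' : ∀ᵐ t ∂unitMeasure, deriv η t = v t := by
    filter_upwards [ae_deriv_eq_of_eq_integral hvi hηI] with t ht using ht.deriv
  have hQ' : ∀ᵐ t ∂unitMeasure, deriv Q t = R t := by
    filter_upwards [ae_deriv_eq_of_eq_integral (c := 0) (u := Q) hR (by simp [hQ])] with t ht
      using ht.deriv
  have hparts := hηH.absolutelyContinuous.integral_deriv_mul_eq_sub hQac
  rw [hηH.apply_one, hη0, zero_mul, zero_mul, sub_self] at hparts
  have hsq : ∫ t in (0 : ℝ)..1, v t * v t = 0 := by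
    have e1 := h η hηH
    have i1 : IntervalIntegrable (fun t => deriv η t * P t + η t * R t) volume 0 1 :=
      (MemLp.intervalIntegrable_mul hηH.memLp_deriv hP).add
        (hR.continuousOn_mul (by rw [uIcc_zero_one]; exact hηH.continuousOn))
    have i2 : IntervalIntegrable (fun t => deriv η t * Q t + η t * deriv Q t) volume 0 1 :=
      (MemLp.intervalIntegrable_mul hηH.memLp_deriv (memLp_two_of_continuousOn hQc)).add
        (hQac.intervalIntegrable_deriv.continuousOn_mul
          (by rw [uIcc_zero_one]; exact hηH.continuousOn))
    have i3 : IntervalIntegrable (fun t => c * deriv η t) volume 0 1 :=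
      (MemLp.intervalIntegrable_unit hηH.memLp_deriv).const_mul c
    have e2 : ∫ t in (0 : ℝ)..1, v t * v t = ∫ t in (0 : ℝ)..1,
        ((deriv η t * P t + η t * R t) - (deriv η t * Q t + η t * deriv Q t) - c * deriv η t) := by
      rw [intervalIntegral.integral_of_le zero_le_one, intervalIntegral.integral_of_le zero_le_one]
      refine integral_congr_ae ?_
      filter_upwards [hη', hQ'] with t h1 h2
      rw [h1, h2, hv]
      ring
    rw [e2, intervalIntegral.integral_sub (i1.sub i2) i3, intervalIntegral.integral_sub i1 i2, e1,
      hparts, intervalIntegral.integral_const_mul, hηH.integral_deriv]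
    simp
  refine ⟨c, ?_⟩
  rw [intervalIntegral.integral_of_le zero_le_one,
    integral_eq_zero_iff_of_nonneg (fun t => mul_self_nonneg _)
      (MemLp.integrable_mul hvL hvL)] at hsq
  filter_upwards [hsq] with t ht
  have h0 : v t = 0 := mul_self_eq_zero.1 ht
  simp only [hv] at h0
  linarith

/-! ### Evaluation of Sobolev functions -/

/-- The kernel `r ↦ 1_{r ≤ t} - (1 - r)`, with which `u(t) = ∫ u + ∫ K_t u'` for all `u` of class
`H¹` on `[0, 1]`. -/
noncomputable def evalKernel (t r : ℝ) : ℝ := (Iic t).indicator 1 r - (1 - r)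

theorem measurable_evalKernel (t : ℝ) : Measurable (evalKernel t) :=
  (measurable_one.indicator measurableSet_Iic).sub (measurable_const.sub measurable_id)

theorem abs_evalKernel_le (t : ℝ) {r : ℝ} (hr : r ∈ Ioc (0 : ℝ) 1) : |evalKernel t r| ≤ 1 := by
  obtain ⟨h0, h1⟩ := hr
  by_cases h : r ∈ Iic t
  · simp only [evalKernel, indicator_of_mem h, Pi.one_apply, abs_le]
    constructor <;> linarith
  · simp only [evalKernel, indicator_of_notMem h, abs_le]
    constructor <;> linarith

theorem memLp_evalKernel (t : ℝ) : MemLp (evalKernel t) 2 unitMeasure := by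
  refine MemLp.of_bound (measurable_evalKernel t).aestronglyMeasurable 1 ?_
  filter_upwards [ae_restrict_mem measurableSet_Ioc] with r hr using abs_evalKernel_le t hr

/-- The space `L²` on a period. -/
abbrev UnitL2 : Type := Lp ℝ 2 unitMeasure

/-- Evaluation at `t`, as a continuous functional of the pair `(u, u')`. It is defined on all pairs
of square-integrable functions, including those whose second component is not the derivative of the
first, so that it can be differentiated along any curve in the product of the two spaces. -/
noncomputable def evalCLM (t : ℝ) : UnitL2 × UnitL2 →L[ℝ] ℝ :=
  (innerSL ℝ ((memLp_const (1 : ℝ)).toLp _ : UnitL2)).comp (ContinuousLinearMap.fst ℝ UnitL2 UnitL2)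
    + (innerSL ℝ ((memLp_evalKernel t).toLp _ : UnitL2)).comp
      (ContinuousLinearMap.snd ℝ UnitL2 UnitL2)

theorem inner_toLp_left {u : ℝ → ℝ} (hu : MemLp u 2 unitMeasure) (v : UnitL2) :
    inner ℝ (hu.toLp u) v = ∫ t in (0 : ℝ)..1, u t * v t := by
  rw [L2.inner_def, intervalIntegral.integral_of_le zero_le_one]
  refine integral_congr_ae ?_
  filter_upwards [hu.coeFn_toLp] with t ht
  rw [ht]
  simp [mul_comm]

theorem evalCLM_apply (p : UnitL2 × UnitL2) {t : ℝ} (ht : t ∈ Icc (0 : ℝ) 1) :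
    evalCLM t p = (∫ r in (0 : ℝ)..1, p.1 r) + (∫ r in (0 : ℝ)..t, p.2 r)
      - ∫ r in (0 : ℝ)..1, (1 - r) * p.2 r := by
  have hp2 : IntervalIntegrable p.2 volume 0 1 := MemLp.intervalIntegrable_unit (Lp.memLp p.2)
  have hp3 : IntervalIntegrable (fun r => (1 - r) * p.2 r) volume 0 1 :=
    hp2.continuousOn_mul (by fun_prop)
  have hI : IntervalIntegrable ((Iic t).indicator p.2) volume 0 1 := by
    rw [intervalIntegrable_iff] at hp2 ⊢
    exact hp2.indicator measurableSet_Iic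
  have e1 : ∫ r in (0 : ℝ)..t, p.2 r = ∫ r in (0 : ℝ)..1, (Iic t).indicator p.2 r := by
    rw [intervalIntegral.integral_of_le zero_le_one, intervalIntegral.integral_of_le ht.1,
      setIntegral_indicator measurableSet_Iic]
    congr 2
    ext r
    simp only [mem_Ioc, mem_inter_iff, mem_Iic]
    constructor
    · rintro ⟨h1, h2⟩; exact ⟨⟨h1, h2.trans ht.2⟩, h2⟩
    · rintro ⟨⟨h1, _⟩, h2⟩; exact ⟨h1, h2⟩
  simp only [evalCLM, add_apply, ContinuousLinearMap.comp_apply, ContinuousLinearMap.coe_fst',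
    ContinuousLinearMap.coe_snd', innerSL_apply_apply, inner_toLp_left, one_mul]
  rw [e1, add_sub_assoc, ← intervalIntegral.integral_sub hI hp3]
  congr 1
  refine intervalIntegral.integral_congr fun r _ => ?_
  by_cases h : r ∈ Iic t
  · simp only [evalKernel, indicator_of_mem h, Pi.one_apply]; ring
  · simp only [evalKernel, indicator_of_notMem h]; ring

theorem PeriodicH1.evalCLM_toLp {u : ℝ → ℝ} (hu : PeriodicH1 u) {t : ℝ} (ht : t ∈ Icc (0 : ℝ) 1) :
    evalCLM t (hu.memLp.toLp u, hu.memLp_deriv.toLp (deriv u)) = u t := by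
  rw [evalCLM_apply _ ht]
  have h1 : ∫ r in (0 : ℝ)..1, (hu.memLp.toLp u) r = ∫ r in (0 : ℝ)..1, u r := by
    rw [intervalIntegral.integral_of_le zero_le_one, intervalIntegral.integral_of_le zero_le_one]
    exact integral_congr_ae hu.memLp.coeFn_toLp
  have h2 : ∫ r in (0 : ℝ)..t, (hu.memLp_deriv.toLp (deriv u)) r
      = ∫ r in (0 : ℝ)..t, deriv u r := by
    rw [intervalIntegral.integral_of_le ht.1, intervalIntegral.integral_of_le ht.1]
    exact integral_congr_ae
      (ae_restrict_of_ae_restrict_of_subset (Ioc_subset_Ioc_right ht.2) hu.memLp_deriv.coeFn_toLp)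
  have h3 : ∫ r in (0 : ℝ)..1, (1 - r) * (hu.memLp_deriv.toLp (deriv u)) r
      = ∫ r in (0 : ℝ)..1, (1 - r) * deriv u r := by
    rw [intervalIntegral.integral_of_le zero_le_one, intervalIntegral.integral_of_le zero_le_one]
    refine integral_congr_ae ?_
    filter_upwards [hu.memLp_deriv.coeFn_toLp] with r hr
    rw [hr]
  have hd : ∀ r : ℝ, HasDerivAt (fun r : ℝ => 1 - r) (-1) r := fun r =>
    (hasDerivAt_id r).const_sub 1
  have hlin : AbsolutelyContinuousOnInterval (fun r : ℝ => 1 - r) 0 1 :=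
    ContDiffOn.absolutelyContinuousOnInterval (by fun_prop)
  have h4 := hlin.integral_mul_deriv_eq_deriv_mul hu.absolutelyContinuous
  simp only [(hd _).deriv] at h4
  rw [h1, h2, h3, h4, hu.eq_integral ht]
  simp only [neg_mul, one_mul, intervalIntegral.integral_neg]
  ring

/-- The functionals of evaluation are bounded uniformly in `t`, which makes the Sobolev embedding
into `L^∞` bounded. -/
theorem norm_evalCLM_le (t : ℝ) : ‖evalCLM t‖ ≤
    ‖((memLp_const (1 : ℝ)).toLp _ : UnitL2)‖ + 1 := by
  have hK : ‖((memLp_evalKernel t).toLp _ : UnitL2)‖ ≤ 1 := by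
    rw [Lp.norm_toLp]
    refine ENNReal.toReal_le_of_le_ofReal zero_le_one ?_
    refine (eLpNorm_le_of_ae_bound (C := 1) (by
      filter_upwards [ae_restrict_mem measurableSet_Ioc] with r hr
        using abs_evalKernel_le t hr)).trans ?_
    simp
  refine (ContinuousLinearMap.opNorm_le_bound _ (by positivity) fun p => ?_)
  simp only [evalCLM, add_apply, ContinuousLinearMap.comp_apply, ContinuousLinearMap.coe_fst',
    ContinuousLinearMap.coe_snd', innerSL_apply_apply]
  refine (norm_add_le _ _).trans ?_
  rw [add_mul]
  refine add_le_add ((norm_inner_le_norm _ _).trans ?_) ((norm_inner_le_norm _ _).trans ?_)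
  · gcongr
    exact norm_fst_le p
  · gcongr
    exact norm_snd_le p

theorem continuousOn_evalCLM (p : UnitL2 × UnitL2) :
    ContinuousOn (fun t => evalCLM t p) (Icc 0 1) := by
  have hp2 : IntervalIntegrable p.2 volume 0 1 := MemLp.intervalIntegrable_unit (Lp.memLp p.2)
  have h := (hp2.absolutelyContinuousOnInterval_intervalIntegral (c := 0) (by simp)).continuousOn
  rw [uIcc_zero_one] at h
  refine ContinuousOn.congr ?_ fun t ht => evalCLM_apply p ht
  fun_prop

theorem memLp_top_evalCLM (p : UnitL2 × UnitL2) :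
    MemLp (fun t => evalCLM t p) ∞ unitMeasure := by
  refine memLp_top_of_bound (((continuousOn_evalCLM p).mono
    Ioc_subset_Icc_self).aestronglyMeasurable measurableSet_Ioc)
    ((‖((memLp_const (1 : ℝ)).toLp _ : UnitL2)‖ + 1) * ‖p‖) (.of_forall fun t => ?_)
  exact (ContinuousLinearMap.le_opNorm _ _).trans (by gcongr; exact norm_evalCLM_le t)

/-- The Sobolev embedding `(u, u') ↦ u` into `L^∞`. -/
noncomputable def sobolevEmbedding : UnitL2 × UnitL2 →L[ℝ] Lp ℝ ∞ unitMeasure :=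
  LinearMap.mkContinuous
    { toFun := fun p => (memLp_top_evalCLM p).toLp _
      map_add' := fun p q => by
        rw [← MemLp.toLp_add]
        congr 1
        ext t
        simp
      map_smul' := fun a p => by
        rw [RingHom.id_apply, ← MemLp.toLp_const_smul]
        congr 1
        ext t
        simp }
    (‖((memLp_const (1 : ℝ)).toLp _ : UnitL2)‖ + 1)
    (fun p => by
      simp only [LinearMap.coe_mk, AddHom.coe_mk]
      rw [Lp.norm_toLp (f := fun t => evalCLM t p)]
      refine ENNReal.toReal_le_of_le_ofReal (by positivity) ?_
      refine (eLpNorm_le_of_ae_bound (C := (‖((memLp_const (1 : ℝ)).toLp _ : UnitL2)‖ + 1) * ‖p‖)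
        (.of_forall fun t => (ContinuousLinearMap.le_opNorm _ _).trans
          (by gcongr; exact norm_evalCLM_le t))).trans ?_
      simp only [ENNReal.toReal_top, inv_zero, ENNReal.rpow_zero, one_mul]
      exact le_rfl)

theorem coeFn_sobolevEmbedding (p : UnitL2 × UnitL2) :
    sobolevEmbedding p =ᵐ[unitMeasure] fun t => evalCLM t p :=
  (memLp_top_evalCLM p).coeFn_toLp

/-! ### Differentiable curves in `L²` -/

/-- The curve `s ↦ A s` in `L²` is differentiable at `s₀`, with derivative `A'`. -/
def HasL2DerivAt (A : ℝ → ℝ → ℝ) (A' : ℝ → ℝ) (s₀ : ℝ) : Prop :=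
  ∃ (hA : ∀ s, MemLp (A s) 2 unitMeasure) (hA' : MemLp A' 2 unitMeasure),
    HasDerivAt (fun s => (hA s).toLp (A s)) (hA'.toLp A') s₀

namespace HasL2DerivAt

variable {A B : ℝ → ℝ → ℝ} {A' B' : ℝ → ℝ} {s₀ : ℝ}

theorem congr_ae (h : HasL2DerivAt A A' s₀) (hB : ∀ s, A s =ᵐ[unitMeasure] B s)
    (hB' : A' =ᵐ[unitMeasure] B') : HasL2DerivAt B B' s₀ := by
  obtain ⟨hA, hA', hd⟩ := h
  refine ⟨fun s => (hA s).ae_eq (hB s), hA'.ae_eq hB', ?_⟩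
  convert hd using 1
  · ext1 s
    exact ((hA s).toLp_eq_toLp_iff _).2 (hB s) |>.symm
  · exact (hA'.toLp_eq_toLp_iff _).2 hB' |>.symm

theorem of_Lp {U : ℝ → UnitL2} {U' : UnitL2} (h : HasDerivAt U U' s₀)
    (hA : ∀ s, U s =ᵐ[unitMeasure] A s) (hA' : U' =ᵐ[unitMeasure] A') : HasL2DerivAt A A' s₀ := by
  refine HasL2DerivAt.congr_ae (A := fun s => U s) (A' := U')
    ⟨fun s => Lp.memLp _, Lp.memLp _, ?_⟩ hA hA'
  simpa only [Lp.toLp_coeFn] using h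

theorem add (hA : HasL2DerivAt A A' s₀) (hB : HasL2DerivAt B B' s₀) :
    HasL2DerivAt (fun s t => A s t + B s t) (fun t => A' t + B' t) s₀ := by
  obtain ⟨hA, hA', hdA⟩ := hA
  obtain ⟨hB, hB', hdB⟩ := hB
  exact ⟨fun s => (hA s).add (hB s), hA'.add hB', hdA.add hdB⟩

theorem zero : HasL2DerivAt (fun _ _ => 0) (fun _ => 0) s₀ :=
  ⟨fun _ => MemLp.zero', MemLp.zero', hasDerivAt_const _ _⟩

theorem sum {ι : Type*} (S : Finset ι) {A : ι → ℝ → ℝ → ℝ} {A' : ι → ℝ → ℝ}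
    (h : ∀ i, HasL2DerivAt (A i) (A' i) s₀) :
    HasL2DerivAt (fun s t => ∑ i ∈ S, A i s t) (fun t => ∑ i ∈ S, A' i t) s₀ := by
  classical
  induction S using Finset.induction_on with
  | empty => simpa using zero
  | insert i S hi ih =>
    simp only [Finset.sum_insert hi]
    exact (h i).add ih

theorem const {φ : ℝ → ℝ} {φ' : ℝ} (h : HasDerivAt φ φ' s₀) :
    HasL2DerivAt (fun s _ => φ s) (fun _ => φ') s₀ := by
  refine of_Lp (h.smul_const ((memLp_const (1 : ℝ)).toLp _ : UnitL2)) (fun s => ?_) ?_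
  · filter_upwards [Lp.coeFn_smul (φ s) ((memLp_const (1 : ℝ)).toLp _ : UnitL2),
      (memLp_const (1 : ℝ)).coeFn_toLp (p := 2) (μ := unitMeasure)] with t h1 h2
    rw [h1, Pi.smul_apply, h2]; simp
  · filter_upwards [Lp.coeFn_smul φ' ((memLp_const (1 : ℝ)).toLp _ : UnitL2),
      (memLp_const (1 : ℝ)).coeFn_toLp (p := 2) (μ := unitMeasure)] with t h1 h2
    rw [h1, Pi.smul_apply, h2]; simp

/-- The integral of the product of two differentiable curves in `L²` is differentiable. -/
theorem integral_mul (hA : HasL2DerivAt A A' s₀) (hB : HasL2DerivAt B B' s₀) :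
    HasDerivAt (fun s => ∫ t in (0 : ℝ)..1, A s t * B s t)
      (∫ t in (0 : ℝ)..1, (A' t * B s₀ t + A s₀ t * B' t)) s₀ := by
  obtain ⟨hA, hA', hdA⟩ := hA
  obtain ⟨hB, hB', hdB⟩ := hB
  have key : ∀ {u v : ℝ → ℝ} (hu : MemLp u 2 unitMeasure) (hv : MemLp v 2 unitMeasure),
      inner ℝ (hu.toLp u) (hv.toLp v) = ∫ t in (0 : ℝ)..1, u t * v t := by
    intro u v hu hv
    rw [inner_toLp_left, intervalIntegral.integral_of_le zero_le_one,
      intervalIntegral.integral_of_le zero_le_one]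
    refine integral_congr_ae ?_
    filter_upwards [hv.coeFn_toLp] with t ht
    rw [ht]
  have h := hdA.inner ℝ hdB
  simp only [key] at h
  rwa [add_comm, ← intervalIntegral.integral_add (MemLp.intervalIntegrable_mul hA' (hB s₀))
    (MemLp.intervalIntegrable_mul (hA s₀) hB')] at h

end HasL2DerivAt

/-! ### Variations of loops -/

section Variation

variable {m : ℕ} {N : Type*} [TopologicalSpace N] [ChartedSpace (EuclideanSpace ℝ (Fin m)) N]

theorem H1Loop.periodicH1 (γ : H1Loop m N) (F : C^∞⟮𝓡 m, N; 𝓘(ℝ, ℝ), ℝ⟯) :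
    PeriodicH1 (fun t => F (γ.toFun t)) where
  periodic t := by simp only [γ.periodic t]
  absolutelyContinuous := γ.absolutelyContinuous F
  memLp_deriv := γ.memLp_deriv F

theorem H1Loop.evalCLM_comp (γ : H1Loop m N) (F : C^∞⟮𝓡 m, N; 𝓘(ℝ, ℝ), ℝ⟯) {t : ℝ}
    (ht : t ∈ Icc (0 : ℝ) 1) : evalCLM t (γ.comp F) = F (γ.toFun t) :=
  (γ.periodicH1 F).evalCLM_toLp ht

/-- The derivative at `s = 0` of `F(γ_s(t))`, for a curve of loops `γ_s`. -/
noncomputable def variation (c : ℝ → LoopSpace m N) (F : C^∞⟮𝓡 m, N; 𝓘(ℝ, ℝ), ℝ⟯) (t : ℝ) : ℝ :=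
  deriv (fun s => F ((c s).1.toFun t)) 0

variable {c : ℝ → LoopSpace m N}

theorem IsC1Curve.hasDerivAt_comp (hc : IsC1Curve c) (F : C^∞⟮𝓡 m, N; 𝓘(ℝ, ℝ), ℝ⟯) :
    HasDerivAt (fun s => (c s).1.comp F) (deriv (fun s => (c s).1.comp F) 0) 0 :=
  ((hc.loop F).differentiable one_ne_zero 0).hasDerivAt

theorem IsC1Curve.hasDerivAt_eval_aux (hc : IsC1Curve c) (F : C^∞⟮𝓡 m, N; 𝓘(ℝ, ℝ), ℝ⟯) {t : ℝ}
    (ht : t ∈ Icc (0 : ℝ) 1) : HasDerivAt (fun s => F ((c s).1.toFun t))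
      (evalCLM t (deriv (fun s => (c s).1.comp F) 0)) 0 := by
  have := (evalCLM t).hasFDerivAt.comp_hasDerivAt 0 (hc.hasDerivAt_comp F)
  refine this.congr_of_eventuallyEq (.of_forall fun s => ?_)
  exact ((c s).1.evalCLM_comp F ht).symm

theorem IsC1Curve.variation_eq (hc : IsC1Curve c) (F : C^∞⟮𝓡 m, N; 𝓘(ℝ, ℝ), ℝ⟯) {t : ℝ}
    (ht : t ∈ Icc (0 : ℝ) 1) :
    variation c F t = evalCLM t (deriv (fun s => (c s).1.comp F) 0) :=
  (hc.hasDerivAt_eval_aux F ht).deriv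

/-- A `C¹` curve of loops, in the sense of the `H¹` topology, is differentiable at each time, since
evaluation is a continuous functional. -/
theorem IsC1Curve.hasDerivAt_eval (hc : IsC1Curve c) (F : C^∞⟮𝓡 m, N; 𝓘(ℝ, ℝ), ℝ⟯) {t : ℝ}
    (ht : t ∈ Icc (0 : ℝ) 1) : HasDerivAt (fun s => F ((c s).1.toFun t)) (variation c F t) 0 := by
  rw [hc.variation_eq F ht]
  exact hc.hasDerivAt_eval_aux F ht

theorem variation_periodic (c : ℝ → LoopSpace m N) (F : C^∞⟮𝓡 m, N; 𝓘(ℝ, ℝ), ℝ⟯) :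
    Function.Periodic (variation c F) 1 := by
  intro t
  simp only [variation, (c _).1.periodic t]

/-- The derivative of the curve `s ↦ (F(γ_s), F(γ_s)')` in `L² × L²` consists of a function and its
weak derivative. -/
theorem IsC1Curve.variation_eq_integral (hc : IsC1Curve c) (F : C^∞⟮𝓡 m, N; 𝓘(ℝ, ℝ), ℝ⟯) {t : ℝ}
    (ht : t ∈ Icc (0 : ℝ) 1) : variation c F t = variation c F 0
      + ∫ r in (0 : ℝ)..t, (deriv (fun s => (c s).1.comp F) 0).2 r := by
  rw [hc.variation_eq F ht, hc.variation_eq F (by simp : (0 : ℝ) ∈ Icc (0 : ℝ) 1),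
    evalCLM_apply _ ht, evalCLM_apply _ (by simp : (0 : ℝ) ∈ Icc (0 : ℝ) 1),
    intervalIntegral.integral_same]
  ring

theorem IsC1Curve.variation_periodicH1 (hc : IsC1Curve c) (F : C^∞⟮𝓡 m, N; 𝓘(ℝ, ℝ), ℝ⟯) :
    PeriodicH1 (variation c F) :=
  PeriodicH1.of_eq_integral (variation_periodic c F) (Lp.memLp _)
    fun _ ht => hc.variation_eq_integral F ht

theorem IsC1Curve.deriv_variation (hc : IsC1Curve c) (F : C^∞⟮𝓡 m, N; 𝓘(ℝ, ℝ), ℝ⟯) :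
    (deriv (fun s => (c s).1.comp F) 0).2 =ᵐ[unitMeasure] deriv (variation c F) := by
  filter_upwards [ae_deriv_eq_of_eq_integral (MemLp.intervalIntegrable_unit (Lp.memLp _))
    fun _ ht => hc.variation_eq_integral F ht] with t ht using ht.deriv.symm

/-- Differentiation in the parameter `s` commutes with differentiation in time. -/
theorem IsC1Curve.hasL2DerivAt_deriv (hc : IsC1Curve c) (F : C^∞⟮𝓡 m, N; 𝓘(ℝ, ℝ), ℝ⟯) :
    HasL2DerivAt (fun s => deriv (fun t => F ((c s).1.toFun t))) (deriv (variation c F)) 0 :=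
  HasL2DerivAt.of_Lp (U := fun s => ((c s).1.comp F).2)
    (hasFDerivAt_snd.comp_hasDerivAt 0 (hc.hasDerivAt_comp F))
    (fun s => ((c s).1.memLp_deriv F).coeFn_toLp) (hc.deriv_variation F)

/-- The derivative of `s ↦ F(γ_s) (G(γ_s))'` in `L²`. -/
theorem IsC1Curve.hasL2DerivAt_mul_deriv (hc : IsC1Curve c) (F G : C^∞⟮𝓡 m, N; 𝓘(ℝ, ℝ), ℝ⟯) :
    HasL2DerivAt (fun s t => F ((c s).1.toFun t) * deriv (fun r => G ((c s).1.toFun r)) t)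
      (fun t => variation c F t * deriv (fun r => G ((c 0).1.toFun r)) t
        + F ((c 0).1.toFun t) * deriv (variation c G) t) 0 := by
  set L := (ContinuousLinearMap.mul ℝ ℝ).holderL unitMeasure ∞ 2 2
  have h1 := sobolevEmbedding.hasFDerivAt.comp_hasDerivAt 0 (hc.hasDerivAt_comp F)
  have h2 := (hasFDerivAt_snd (𝕜 := ℝ)).comp_hasDerivAt (0 : ℝ) (hc.hasDerivAt_comp G)
  have h3 := L.hasFDerivAt_of_bilinear h1.hasFDerivAt h2.hasFDerivAt
  have h4 := h3.hasDerivAt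
  have hmem : ∀ᵐ t ∂unitMeasure, t ∈ Icc (0 : ℝ) 1 := by
    filter_upwards [ae_restrict_mem measurableSet_Ioc] with t ht using Ioc_subset_Icc_self ht
  refine HasL2DerivAt.of_Lp h4 (fun s => ?_) ?_
  · filter_upwards [(ContinuousLinearMap.mul ℝ ℝ).coeFn_holder (r := 2)
      (sobolevEmbedding ((c s).1.comp F)) ((c s).1.comp G).2,
      coeFn_sobolevEmbedding ((c s).1.comp F), ((c s).1.memLp_deriv G).coeFn_toLp, hmem]
      with t e1 e2 e3 ht
    refine e1.trans ?_
    rw [e2, (c s).1.evalCLM_comp F ht]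
    exact congrArg (fun x => F ((c s).1.toFun t) * x) e3
  · set U := deriv (fun s => (c s).1.comp F) 0
    set V := deriv (fun s => (c s).1.comp G) 0
    have e0 : ∀ (X : Lp ℝ ∞ unitMeasure) (Y : UnitL2),
        L X Y =ᵐ[unitMeasure] fun t => X t * Y t := fun X Y =>
      (ContinuousLinearMap.mul ℝ ℝ).coeFn_holder (r := 2) X Y
    have e5 : ∀ X Y : UnitL2, (X + Y : UnitL2) =ᵐ[unitMeasure] fun t => X t + Y t :=
      fun X Y => Lp.coeFn_add X Y
    filter_upwards [e0 (sobolevEmbedding ((c 0).1.comp F)) V.2,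
      e0 (sobolevEmbedding U) ((c 0).1.comp G).2,
      e5 (L (sobolevEmbedding ((c 0).1.comp F)) V.2) (L (sobolevEmbedding U) ((c 0).1.comp G).2),
      coeFn_sobolevEmbedding ((c 0).1.comp F), coeFn_sobolevEmbedding U,
      ((c 0).1.memLp_deriv G).coeFn_toLp, hc.deriv_variation G, hmem]
      with t e1 e2 e3 e4 e6 e7 e8 ht
    have e9 : ((c 0).1.comp G).2 t = deriv (fun t => G ((c 0).1.toFun t)) t := e7
    have : (L (sobolevEmbedding ((c 0).1.comp F)) V.2
        + L (sobolevEmbedding U) ((c 0).1.comp G).2 : UnitL2) t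
        = variation c F t * deriv (fun r => G ((c 0).1.toFun r)) t
        + F ((c 0).1.toFun t) * deriv (variation c G) t := by
      rw [e3, e1, e2, e4, e6, e8, e9, (c 0).1.evalCLM_comp F ht, hc.variation_eq F ht]
      ring
    rw [← this]
    simp [U, V]

end Variation

/-! ### The first variation formula -/

section FirstVariation

variable {m : ℕ} {N : Type*} [TopologicalSpace N] [ChartedSpace (EuclideanSpace ℝ (Fin m)) N]
  {ι κ : Type*} [Fintype ι] [Fintype κ]

/-- The quadratic form `∑ aᵢⱼ dpᵢ dpⱼ` on the velocity of a curve. -/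
noncomputable def quadDensity (a : ι → ι → C^∞⟮𝓡 m, N; 𝓘(ℝ, ℝ), ℝ⟯)
    (p : ι → C^∞⟮𝓡 m, N; 𝓘(ℝ, ℝ), ℝ⟯) (γ : ℝ → N) (t : ℝ) : ℝ :=
  ∑ j, (∑ i, a i j (γ t) * deriv (fun r => p i (γ r)) t) * deriv (fun r => p j (γ r)) t

/-- The one-form `∑ bᵢ dfᵢ` on the velocity of a curve. -/
noncomputable def linDensity (b f : κ → C^∞⟮𝓡 m, N; 𝓘(ℝ, ℝ), ℝ⟯) (γ : ℝ → N) (t : ℝ) : ℝ :=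
  ∑ i, b i (γ t) * deriv (fun r => f i (γ r)) t

/-- The derivative of half of `quadDensity` (for symmetric coefficients) along a variation `D`. -/
noncomputable def quadVariation (a : ι → ι → C^∞⟮𝓡 m, N; 𝓘(ℝ, ℝ), ℝ⟯)
    (p : ι → C^∞⟮𝓡 m, N; 𝓘(ℝ, ℝ), ℝ⟯) (γ : ℝ → N)
    (D : C^∞⟮𝓡 m, N; 𝓘(ℝ, ℝ), ℝ⟯ → ℝ → ℝ) (t : ℝ) : ℝ :=
  ∑ j, ∑ i, (1 / 2 * D (a i j) t * deriv (fun r => p i (γ r)) t * deriv (fun r => p j (γ r)) t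
    + a i j (γ t) * deriv (D (p i)) t * deriv (fun r => p j (γ r)) t)

/-- The derivative of `linDensity` along a variation `D`. -/
noncomputable def linVariation (b f : κ → C^∞⟮𝓡 m, N; 𝓘(ℝ, ℝ), ℝ⟯) (γ : ℝ → N)
    (D : C^∞⟮𝓡 m, N; 𝓘(ℝ, ℝ), ℝ⟯ → ℝ → ℝ) (t : ℝ) : ℝ :=
  ∑ i, (D (b i) t * deriv (fun r => f i (γ r)) t + b i (γ t) * deriv (D (f i)) t)

theorem H1Loop.memLp_mul_deriv (γ : H1Loop m N) (F G : C^∞⟮𝓡 m, N; 𝓘(ℝ, ℝ), ℝ⟯) :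
    MemLp (fun t => F (γ.toFun t) * deriv (fun r => G (γ.toFun r)) t) 2 unitMeasure :=
  MemLp.continuousOn_mul (γ.periodicH1 F).continuousOn (γ.memLp_deriv G)

theorem H1Loop.memLp_linDensity (γ : H1Loop m N) (b f : κ → C^∞⟮𝓡 m, N; 𝓘(ℝ, ℝ), ℝ⟯) :
    MemLp (linDensity b f γ.toFun) 2 unitMeasure :=
  memLp_finsetSum _ fun i _ => γ.memLp_mul_deriv (b i) (f i)

theorem H1Loop.intervalIntegrable_quadDensity (γ : H1Loop m N)
    (a : ι → ι → C^∞⟮𝓡 m, N; 𝓘(ℝ, ℝ), ℝ⟯) (p : ι → C^∞⟮𝓡 m, N; 𝓘(ℝ, ℝ), ℝ⟯) :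
    IntervalIntegrable (quadDensity a p γ.toFun) volume 0 1 := by
  have := IntervalIntegrable.sum (μ := volume) (a := 0) (b := 1) Finset.univ fun j _ =>
    MemLp.intervalIntegrable_mul
      (memLp_finsetSum Finset.univ fun i _ => γ.memLp_mul_deriv (a i j) (p i))
      (γ.memLp_deriv (p j))
  convert! this using 1
  ext t
  simp [quadDensity]

variable {c : ℝ → LoopSpace m N}

theorem IsC1Curve.memLp_linVariation (hc : IsC1Curve c) (b f : κ → C^∞⟮𝓡 m, N; 𝓘(ℝ, ℝ), ℝ⟯) :
    MemLp (linVariation b f (c 0).1.toFun (variation c)) 2 unitMeasure :=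
  memLp_finsetSum _ fun i _ =>
    (MemLp.continuousOn_mul (hc.variation_periodicH1 (b i)).continuousOn
      ((c 0).1.memLp_deriv (f i))).add
    (MemLp.continuousOn_mul ((c 0).1.periodicH1 (b i)).continuousOn
      (hc.variation_periodicH1 (f i)).memLp_deriv)

/-- The first variation of the kinetic energy. -/
theorem IsC1Curve.hasDerivAt_integral_quadDensity (hc : IsC1Curve c)
    (a : ι → ι → C^∞⟮𝓡 m, N; 𝓘(ℝ, ℝ), ℝ⟯) (p : ι → C^∞⟮𝓡 m, N; 𝓘(ℝ, ℝ), ℝ⟯)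
    (ha : ∀ i j, a i j = a j i) :
    HasDerivAt (fun s => ∫ t in (0 : ℝ)..1, quadDensity a p (c s).1.toFun t)
      (2 * ∫ t in (0 : ℝ)..1, quadVariation a p (c 0).1.toFun (variation c) t) 0 := by
  have h := HasDerivAt.fun_sum (u := Finset.univ) fun j _ =>
    (HasL2DerivAt.sum Finset.univ fun i => hc.hasL2DerivAt_mul_deriv (a i j) (p i)).integral_mul
      (hc.hasL2DerivAt_deriv (p j))
  have hA : ∀ (s : ℝ) (j : ι), MemLp (fun t => ∑ i, a i j ((c s).1.toFun t)
      * deriv (fun r => p i ((c s).1.toFun r)) t) 2 unitMeasure := fun s j =>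
    memLp_finsetSum _ fun i _ => (c s).1.memLp_mul_deriv (a i j) (p i)
  have hA' : ∀ j : ι, MemLp (fun t => ∑ i, (variation c (a i j) t
      * deriv (fun r => p i ((c 0).1.toFun r)) t
      + a i j ((c 0).1.toFun t) * deriv (variation c (p i)) t)) 2 unitMeasure := fun j =>
    memLp_finsetSum _ fun i _ =>
    (MemLp.continuousOn_mul (hc.variation_periodicH1 (a i j)).continuousOn
      ((c 0).1.memLp_deriv (p i))).add
    (MemLp.continuousOn_mul ((c 0).1.periodicH1 (a i j)).continuousOn
      (hc.variation_periodicH1 (p i)).memLp_deriv)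
  convert! h using 1
  · ext1 s
    rw [← intervalIntegral.integral_finsetSum fun j _ =>
      MemLp.intervalIntegrable_mul (hA s j) ((c s).1.memLp_deriv (p j))]
    rfl
  · rw [← intervalIntegral.integral_finsetSum fun j _ =>
      (MemLp.intervalIntegrable_mul (hA' j) ((c 0).1.memLp_deriv (p j))).add
      (MemLp.intervalIntegrable_mul (hA 0 j) (hc.variation_periodicH1 (p j)).memLp_deriv),
      ← intervalIntegral.integral_const_mul]
    refine intervalIntegral.integral_congr fun t _ => ?_
    simp only [quadVariation]
    -- the two terms containing a derivative of `D (p i)` agree by symmetry of `a`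
    have hs : ∑ j, (∑ i, a i j ((c 0).1.toFun t) * deriv (fun r => p i ((c 0).1.toFun r)) t)
        * deriv (variation c (p j)) t
        = ∑ j, (∑ i, a i j ((c 0).1.toFun t) * deriv (variation c (p i)) t)
          * deriv (fun r => p j ((c 0).1.toFun r)) t := by
      simp only [Finset.sum_mul]
      rw [Finset.sum_comm]
      refine Finset.sum_congr rfl fun i _ => Finset.sum_congr rfl fun j _ => ?_
      rw [ha i j]
      ring
    rw [Finset.sum_add_distrib, hs, ← Finset.sum_add_distrib, Finset.mul_sum]
    refine Finset.sum_congr rfl fun j _ => ?_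
    rw [← add_mul, ← Finset.sum_add_distrib, Finset.sum_mul, Finset.mul_sum]
    refine Finset.sum_congr rfl fun i _ => ?_
    ring

/-- The first variation of the square of the vertical speed, shifted by the phase. -/
theorem IsC1Curve.hasDerivAt_integral_linDensity (hc : IsC1Curve c)
    (b f : κ → C^∞⟮𝓡 m, N; 𝓘(ℝ, ℝ), ℝ⟯) :
    HasDerivAt (fun s => ∫ t in (0 : ℝ)..1, (linDensity b f (c s).1.toFun t + (c s).2.2) ^ 2)
      (2 * ∫ t in (0 : ℝ)..1, (linDensity b f (c 0).1.toFun t + (c 0).2.2)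
        * (linVariation b f (c 0).1.toFun (variation c) t + deriv (fun s => (c s).2.2) 0)) 0 := by
  have h1 : HasL2DerivAt (fun s t => linDensity b f (c s).1.toFun t + (c s).2.2)
      (fun t => linVariation b f (c 0).1.toFun (variation c) t + deriv (fun s => (c s).2.2) 0) 0 :=
    (HasL2DerivAt.sum Finset.univ fun i => hc.hasL2DerivAt_mul_deriv (b i) (f i)).add
      (HasL2DerivAt.const (hc.phase.differentiable one_ne_zero 0).hasDerivAt)
  convert! h1.integral_mul h1 using 1
  · ext1 s
    refine intervalIntegral.integral_congr fun t _ => ?_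
    simp only [sq]
  · rw [← intervalIntegral.integral_const_mul]
    refine intervalIntegral.integral_congr fun t _ => ?_
    ring

/-- The first variation of the action functional, in terms of finitely many smooth functions. -/
theorem IsC1Curve.hasDerivAt_action (hc : IsC1Curve c)
    (a : ι → ι → C^∞⟮𝓡 m, N; 𝓘(ℝ, ℝ), ℝ⟯) (p : ι → C^∞⟮𝓡 m, N; 𝓘(ℝ, ℝ), ℝ⟯)
    (ha : ∀ i j, a i j = a j i) (b f : κ → C^∞⟮𝓡 m, N; 𝓘(ℝ, ℝ), ℝ⟯) (k : ℝ) :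
    HasDerivAt (fun s => 1 / (2 * ((c s).2.1 : ℝ)) *
        ((∫ t in (0 : ℝ)..1, quadDensity a p (c s).1.toFun t)
          + ∫ t in (0 : ℝ)..1, (linDensity b f (c s).1.toFun t + (c s).2.2) ^ 2)
        - (c s).2.2 + k * ((c s).2.1 : ℝ))
      ((k - ((∫ t in (0 : ℝ)..1, quadDensity a p (c 0).1.toFun t)
          + ∫ t in (0 : ℝ)..1, (linDensity b f (c 0).1.toFun t + (c 0).2.2) ^ 2)
            / (2 * ((c 0).2.1 : ℝ) ^ 2)) * deriv (fun s => ((c s).2.1 : ℝ)) 0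
        + 1 / ((c 0).2.1 : ℝ) * ((∫ t in (0 : ℝ)..1,
            quadVariation a p (c 0).1.toFun (variation c) t)
          + ∫ t in (0 : ℝ)..1, (linDensity b f (c 0).1.toFun t + (c 0).2.2)
            * (linVariation b f (c 0).1.toFun (variation c) t + deriv (fun s => (c s).2.2) 0))
        - deriv (fun s => (c s).2.2) 0) 0 := by
  have hT : ((c 0).2.1 : ℝ) ≠ 0 := (c 0).2.1.2.ne'
  have h1 := (hc.hasDerivAt_integral_quadDensity a p ha).add (hc.hasDerivAt_integral_linDensity b f)
  have h2 := (hc.period.differentiable one_ne_zero 0).hasDerivAt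
  have h3 := (hc.phase.differentiable one_ne_zero 0).hasDerivAt
  have h4 := ((h2.const_mul 2).inv (mul_ne_zero two_ne_zero hT)).mul h1
  have h5 := (h4.sub h3).add (h2.const_mul k)
  convert! h5 using 1
  · ext1 s
    simp [one_div]
  · simp only [Pi.add_apply, Pi.inv_apply]
    field_simp
    ring

end FirstVariation

/-! ### Frames of vector fields and smooth functions on a compact manifold -/

section Frame

variable {m : ℕ} {N : Type*} [TopologicalSpace N] [ChartedSpace (EuclideanSpace ℝ (Fin m)) N]

/-- The differential of a smooth function, as a covector. -/
noncomputable def differential (F : C^∞⟮𝓡 m, N; 𝓘(ℝ, ℝ), ℝ⟯) (q : N) :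
    TangentSpace (𝓡 m) q →L[ℝ] ℝ :=
  mfderiv (𝓡 m) 𝓘(ℝ, ℝ) F q

/-- The velocity at `s = 0` of `s ↦ Φ (s, q)`, for a map with `Φ (0, q) = q`. -/
noncomputable def variationField (Φ : ℝ × N → N) (q : N) : TangentSpace (𝓡 m) q :=
  (mfderiv 𝓘(ℝ, ℝ) (𝓡 m) (fun s : ℝ => Φ (s, q)) 0 (1 : ℝ) : EuclideanSpace ℝ (Fin m))

theorem hasMFDerivAt_differential (F : C^∞⟮𝓡 m, N; 𝓘(ℝ, ℝ), ℝ⟯) (q : N) :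
    HasMFDerivAt (𝓡 m) 𝓘(ℝ, ℝ) F q (differential F q) :=
  (F.contMDiff.mdifferentiableAt (by simp)).hasMFDerivAt

theorem hasDerivAt_of_hasMFDerivAt {V : Type*} [NormedAddCommGroup V] [NormedSpace ℝ V] {f : ℝ → V}
    {t : ℝ} {A : ℝ →L[ℝ] V} (h : HasMFDerivAt 𝓘(ℝ, ℝ) 𝓘(ℝ, V) f t A) : HasDerivAt f (A 1) t := by
  have h' : HasFDerivAt f A t := h.hasFDerivAt
  exact h'.hasDerivAt

/-- The chain rule for a function along a curve. -/
theorem hasDerivAt_comp_curve (F : C^∞⟮𝓡 m, N; 𝓘(ℝ, ℝ), ℝ⟯) {c : ℝ → N} {t : ℝ}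
    (hc : MDifferentiableAt 𝓘(ℝ, ℝ) (𝓡 m) c t) :
    HasDerivAt (fun s => F (c s)) (differential F (c t) (mfderiv 𝓘(ℝ, ℝ) (𝓡 m) c t (1 : ℝ))) t := by
  exact hasDerivAt_of_hasMFDerivAt
    ((hasMFDerivAt_differential F (c t)).comp t hc.hasMFDerivAt)

theorem hasDerivAt_variationField {Φ : ℝ × N → N}
    (hΦ : ContMDiff (𝓘(ℝ, ℝ).prod (𝓡 m)) (𝓡 m) ∞ Φ) {q : N} (h0 : Φ (0, q) = q)
    (F : C^∞⟮𝓡 m, N; 𝓘(ℝ, ℝ), ℝ⟯) :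
    HasDerivAt (fun s => F (Φ (s, q))) (differential F q (variationField Φ q)) 0 := by
  have h1 : ContMDiff 𝓘(ℝ, ℝ) (𝓡 m) ∞ (fun s : ℝ => Φ (s, q)) :=
    hΦ.comp (contMDiff_id.prodMk contMDiff_const)
  have h1' : MDifferentiableAt 𝓘(ℝ, ℝ) (𝓡 m) (fun s : ℝ => Φ (s, q)) 0 :=
    h1.mdifferentiableAt (by simp)
  have h2 := hasDerivAt_comp_curve F h1'
  have h3 : ∀ (x : N) (hx : x = q) (v : EuclideanSpace ℝ (Fin m)),
      (differential F x : EuclideanSpace ℝ (Fin m) →L[ℝ] ℝ) v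
        = (differential F q : EuclideanSpace ℝ (Fin m) →L[ℝ] ℝ) v := by
    rintro x rfl v; rfl
  convert! h2 using 1
  exact (h3 _ h0 _).symm

/-- Finitely many smooth functions `fₖ` and vector fields `Xₖ` on a manifold with `∑ dfₖ ⊗ Xₖ = id`,
such that the functions separate points and contain local coordinates near every point, and such
that every `Xₖ` is the initial velocity of a smooth family of maps of the manifold. -/
structure SmoothFrame (m : ℕ) (N : Type*) [TopologicalSpace N]
    [ChartedSpace (EuclideanSpace ℝ (Fin m)) N] (ι : Type*) [Fintype ι] where
  fn : ι → C^∞⟮𝓡 m, N; 𝓘(ℝ, ℝ), ℝ⟯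
  flow : ι → ℝ × N → N
  contMDiff_flow : ∀ k, ContMDiff (𝓘(ℝ, ℝ).prod (𝓡 m)) (𝓡 m) ∞ (flow k)
  flow_zero : ∀ k q, flow k (0, q) = q
  sum_smul : ∀ (q : N) (v : TangentSpace (𝓡 m) q),
    ∑ k, differential (fn k) q v • variationField (flow k) q = v
  injective : ∀ q q' : N, (∀ k, fn k q = fn k q') → q = q'
  coord : ∀ q : N, ∃ α : N, q ∈ (chartAt (EuclideanSpace ℝ (Fin m)) α).source ∧
    ∃ L : (ι → ℝ) →L[ℝ] EuclideanSpace ℝ (Fin m),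
      ∀ᶠ q' in 𝓝 q, extChartAt (𝓡 m) α q' = L (fun k => fn k q')

/-- The family of maps that moves points in the direction `e` of the chart at `α`, with speed `ε w`
at `s = 0`. The displacement is proportional to `sin s`, so that it stays bounded and, for small
`ε`, the points do not leave the chart for any value of `s`. -/
noncomputable def chartFlow (α : N) (ε : ℝ) (w : N → ℝ) (e : EuclideanSpace ℝ (Fin m))
    (p : ℝ × N) : N := by
  classical
  exact if p.2 ∈ (chartAt (EuclideanSpace ℝ (Fin m)) α).source then
    (extChartAt (𝓡 m) α).symm (extChartAt (𝓡 m) α p.2 + (ε * Real.sin p.1 * w p.2) • e) else p.2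

theorem chartFlow_of_mem {α : N} {ε : ℝ} {w : N → ℝ} {e : EuclideanSpace ℝ (Fin m)} {p : ℝ × N}
    (hp : p.2 ∈ (chartAt (EuclideanSpace ℝ (Fin m)) α).source) :
    chartFlow α ε w e p = (extChartAt (𝓡 m) α).symm
      (extChartAt (𝓡 m) α p.2 + (ε * Real.sin p.1 * w p.2) • e) := by
  simp [chartFlow, hp]

theorem chartFlow_of_eq_zero {α : N} {ε : ℝ} {w : N → ℝ} {e : EuclideanSpace ℝ (Fin m)} {p : ℝ × N}
    (hp : Real.sin p.1 * w p.2 = 0) : chartFlow α ε w e p = p.2 := by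
  by_cases h : p.2 ∈ (chartAt (EuclideanSpace ℝ (Fin m)) α).source
  · rw [chartFlow_of_mem h, mul_assoc, hp, mul_zero, zero_smul, add_zero,
      (extChartAt (𝓡 m) α).left_inv (by rwa [extChartAt_source])]
  · simp [chartFlow, h]

theorem contMDiff_chartFlow [IsManifold (𝓡 m) ∞ N] {α : N} {ε : ℝ} {w : N → ℝ}
    (hw : ContMDiff (𝓡 m) 𝓘(ℝ, ℝ) ∞ w) {e : EuclideanSpace ℝ (Fin m)}
    (hsupp : tsupport w ⊆ (chartAt (EuclideanSpace ℝ (Fin m)) α).source)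
    (hε : ∀ s : ℝ, ∀ q ∈ tsupport w,
      extChartAt (𝓡 m) α q + (ε * Real.sin s * w q) • e ∈ (extChartAt (𝓡 m) α).target) :
    ContMDiff (𝓘(ℝ, ℝ).prod (𝓡 m)) (𝓡 m) ∞ (chartFlow α ε w e) := by
  rintro ⟨s, q⟩
  by_cases hq : q ∈ tsupport w
  · have hqs := hsupp hq
    have h1 : ContMDiffAt (𝓘(ℝ, ℝ).prod (𝓡 m)) 𝓘(ℝ, EuclideanSpace ℝ (Fin m)) ∞
        (fun p : ℝ × N => extChartAt (𝓡 m) α p.2 + (ε * Real.sin p.1 * w p.2) • e) (s, q) := by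
      have hs : ContMDiffAt (𝓘(ℝ, ℝ).prod (𝓡 m)) 𝓘(ℝ, ℝ) ∞
          (fun p : ℝ × N => ε * Real.sin p.1) (s, q) := by
        have : ContDiff ℝ ∞ (fun s : ℝ => ε * Real.sin s) := by fun_prop
        exact this.contMDiff.contMDiffAt.comp (s, q) contMDiffAt_fst
      have hw' : ContMDiffAt (𝓘(ℝ, ℝ).prod (𝓡 m)) 𝓘(ℝ, ℝ) ∞
          (fun p : ℝ × N => w p.2) (s, q) := hw.contMDiffAt.comp (s, q) contMDiffAt_snd
      have hx : ContMDiffAt (𝓘(ℝ, ℝ).prod (𝓡 m)) 𝓘(ℝ, EuclideanSpace ℝ (Fin m)) ∞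
          (fun p : ℝ × N => extChartAt (𝓡 m) α p.2) (s, q) :=
        (contMDiffAt_extChartAt' hqs).comp (s, q) contMDiffAt_snd
      exact hx.add ((hs.mul hw').smul contMDiffAt_const)
    have h2 : ContMDiffAt 𝓘(ℝ, EuclideanSpace ℝ (Fin m)) (𝓡 m) ∞ (extChartAt (𝓡 m) α).symm
        (extChartAt (𝓡 m) α q + (ε * Real.sin s * w q) • e) :=
      (contMDiffOn_extChartAt_symm α).contMDiffAt
        ((isOpen_extChartAt_target α).mem_nhds (hε s q hq))
    have h3 := ContMDiffAt.comp (s, q) h2 h1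
    refine h3.congr_of_eventuallyEq ?_
    have : ∀ᶠ p : ℝ × N in 𝓝 (s, q), p.2 ∈ (chartAt (EuclideanSpace ℝ (Fin m)) α).source :=
      continuousAt_snd.eventually ((chartAt (EuclideanSpace ℝ (Fin m)) α).open_source.mem_nhds hqs)
    filter_upwards [this] with p hp using chartFlow_of_mem hp
  · refine (contMDiffAt_snd (I := 𝓘(ℝ, ℝ))).congr_of_eventuallyEq ?_
    have : ∀ᶠ p : ℝ × N in 𝓝 (s, q), p.2 ∈ (tsupport w)ᶜ :=
      continuousAt_snd.eventually ((isClosed_tsupport w).isOpen_compl.mem_nhds hq)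
    filter_upwards [this] with p hp
    exact chartFlow_of_eq_zero (by rw [image_eq_zero_of_notMem_tsupport hp, mul_zero])

theorem variationField_eq_zero {Φ : ℝ × N → N} {q : N} (h : ∀ s, Φ (s, q) = q) :
    variationField (m := m) Φ q = 0 := by
  have key : ∀ f : ℝ → N, f = (fun _ => q) →
      (mfderiv 𝓘(ℝ, ℝ) (𝓡 m) f 0 : ℝ →L[ℝ] EuclideanSpace ℝ (Fin m)) 1 = 0 := by
    rintro _ rfl
    rw [mfderiv_const]
    rfl
  exact key _ (funext h)

/-- In the chart at `α`, the initial velocity of `chartFlow α ε w e` is `ε w e`. -/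
theorem mfderiv_extChartAt_variationField [IsManifold (𝓡 m) ∞ N] {α : N} {ε : ℝ} {w : N → ℝ}
    (hw : ContMDiff (𝓡 m) 𝓘(ℝ, ℝ) ∞ w) {e : EuclideanSpace ℝ (Fin m)}
    (hsupp : tsupport w ⊆ (chartAt (EuclideanSpace ℝ (Fin m)) α).source)
    (hε : ∀ s : ℝ, ∀ q ∈ tsupport w,
      extChartAt (𝓡 m) α q + (ε * Real.sin s * w q) • e ∈ (extChartAt (𝓡 m) α).target)
    {q : N} (hq : q ∈ tsupport w) :
    mfderiv (𝓡 m) 𝓘(ℝ, EuclideanSpace ℝ (Fin m)) (extChartAt (𝓡 m) α) q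
      (variationField (chartFlow α ε w e) q) = (ε * w q) • e := by
  have hqs := hsupp hq
  have h0 : chartFlow α ε w e (0, q) = q := chartFlow_of_eq_zero (by simp)
  have h1 : MDifferentiableAt 𝓘(ℝ, ℝ) (𝓡 m) (fun s : ℝ => chartFlow α ε w e (s, q)) 0 :=
    ((contMDiff_chartFlow hw hsupp hε).comp
      (contMDiff_id.prodMk contMDiff_const)).mdifferentiableAt (by simp)
  have h2 : MDifferentiableAt (𝓡 m) 𝓘(ℝ, EuclideanSpace ℝ (Fin m)) (extChartAt (𝓡 m) α)
      (chartFlow α ε w e (0, q)) := by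
    rw [h0]
    exact (contMDiffAt_extChartAt' (n := ∞) hqs).mdifferentiableAt (by simp)
  have h3 := hasDerivAt_of_hasMFDerivAt (h2.hasMFDerivAt.comp (0 : ℝ) h1.hasMFDerivAt)
  have h4 : HasDerivAt (fun s : ℝ => extChartAt (𝓡 m) α q + (ε * Real.sin s * w q) • e)
      ((ε * w q) • e) 0 := by
    have := (((Real.hasDerivAt_sin 0).const_mul ε).mul_const (w q)).smul_const e
    rw [Real.cos_zero, mul_one] at this
    exact this.const_add _
  have h5 : HasDerivAt (extChartAt (𝓡 m) α ∘ fun s : ℝ => chartFlow α ε w e (s, q))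
      ((ε * w q) • e) 0 := by
    refine h4.congr_of_eventuallyEq (.of_forall fun s => ?_)
    simp only [Function.comp_apply]
    rw [chartFlow_of_mem hqs, (extChartAt (𝓡 m) α).right_inv (hε s q hq)]
  have h6 := h3.unique h5
  have h7 : ∀ (x : N) (hx : x = q) (v : EuclideanSpace ℝ (Fin m)),
      (mfderiv (𝓡 m) 𝓘(ℝ, EuclideanSpace ℝ (Fin m)) (extChartAt (𝓡 m) α) x :
        EuclideanSpace ℝ (Fin m) →L[ℝ] EuclideanSpace ℝ (Fin m)) v
        = (mfderiv (𝓡 m) 𝓘(ℝ, EuclideanSpace ℝ (Fin m)) (extChartAt (𝓡 m) α) q :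
        EuclideanSpace ℝ (Fin m) →L[ℝ] EuclideanSpace ℝ (Fin m)) v := by
    rintro x rfl v; rfl
  rw [← h6]
  exact (h7 _ h0 _).symm

/-- Every compact manifold has a smooth frame: finitely many charts, cut off by bump functions,
provide the functions, and the coordinate fields, cut off by a partition of unity, the vector
fields. -/
theorem exists_smoothFrame (m : ℕ) (N : Type*) [TopologicalSpace N] [T2Space N] [CompactSpace N]
    [ChartedSpace (EuclideanSpace ℝ (Fin m)) N] [IsManifold (𝓡 m) ∞ N] :
    ∃ s : Finset N, Nonempty (SmoothFrame m N (s × Option (Fin m))) := by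
  classical
  let χ : ∀ α : N, SmoothBumpFunction (𝓡 m) α := fun α => Classical.arbitrary _
  let V : N → Set N := fun α => interior {q | χ α q = 1}
  have hVmem : ∀ α, α ∈ V α := fun α => mem_interior_iff_mem_nhds.2 (χ α).eventuallyEq_one
  obtain ⟨s, hs⟩ := isCompact_univ.elim_finite_subcover V (fun _ => isOpen_interior)
    fun α _ => mem_iUnion.2 ⟨α, hVmem α⟩
  have hV1 : ∀ α, ∀ q ∈ V α, χ α q = 1 := fun α q hq => interior_subset (s := {q | χ α q = 1}) hq
  have hVsrc : ∀ α, ∀ q, χ α q = 1 → q ∈ (chartAt (EuclideanSpace ℝ (Fin m)) α).source :=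
    fun α q hq => (χ α).support_subset_source (by rw [Function.mem_support, hq]; exact one_ne_zero)
  obtain ⟨w, hw⟩ := SmoothPartitionOfUnity.exists_isSubordinate (𝓡 m) isClosed_univ
    (fun α : s => V α) (fun _ => isOpen_interior) (by
      intro q hq
      obtain ⟨α, hα, hqα⟩ := mem_iUnion₂.1 (hs hq)
      exact mem_iUnion.2 ⟨⟨α, hα⟩, hqα⟩)
  have hwsrc : ∀ α : s, tsupport (w α) ⊆ (chartAt (EuclideanSpace ℝ (Fin m)) (α : N)).source :=
    fun α q hq => hVsrc α q (hV1 α q (hw α hq))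
  -- the room around the image of the support of `w α` in the target of the chart
  have hroom : ∀ α : s, ∃ ε : ℝ, 0 < ε ∧ ∀ i : Fin m, ∀ r : ℝ, ∀ q ∈ tsupport (w α),
      extChartAt (𝓡 m) (α : N) q + (ε * Real.sin r * w α q) • EuclideanSpace.single i (1 : ℝ)
        ∈ (extChartAt (𝓡 m) (α : N)).target := by
    intro α
    have hK : IsCompact (extChartAt (𝓡 m) (α : N) '' tsupport (w α)) := by
      refine (isClosed_tsupport _).isCompact.image_of_continuousOn ?_
      refine (continuousOn_extChartAt (α : N)).mono ?_
      rw [extChartAt_source]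
      exact hwsrc α
    have hsub : extChartAt (𝓡 m) (α : N) '' tsupport (w α) ⊆ (extChartAt (𝓡 m) (α : N)).target := by
      rintro _ ⟨q, hq, rfl⟩
      exact (extChartAt (𝓡 m) (α : N)).map_source (by rw [extChartAt_source]; exact hwsrc α hq)
    obtain ⟨ε, hε, hsubε⟩ := hK.exists_cthickening_subset_open (isOpen_extChartAt_target _) hsub
    refine ⟨ε, hε, fun i r q hq => hsubε ?_⟩
    refine Metric.mem_cthickening_of_dist_le _ _ _ _ (mem_image_of_mem _ hq) ?_
    rw [dist_eq_norm, add_sub_cancel_left, norm_smul, PiLp.norm_single, norm_one, mul_one,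
      norm_mul, norm_mul, Real.norm_of_nonneg hε.le, Real.norm_eq_abs, Real.norm_eq_abs,
      abs_of_nonneg (w.nonneg α q)]
    have h1 := Real.abs_sin_le_one r
    have h2 := w.le_one α q
    have h3 := w.nonneg α q
    calc ε * |Real.sin r| * w α q ≤ ε * 1 * 1 := by gcongr
      _ = ε := by ring
  choose ε hε hεt using hroom
  have hsm : ∀ (α : s) (i : Fin m), ContMDiff (𝓡 m) 𝓘(ℝ, ℝ) ∞
      (fun q => (ε α)⁻¹ * (χ α q * (extChartAt (𝓡 m) (α : N) q) i)) := by
    intro α i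
    have h1 : ContMDiffOn (𝓡 m) 𝓘(ℝ, ℝ) ∞ (fun q => (extChartAt (𝓡 m) (α : N) q) i)
        (chartAt (EuclideanSpace ℝ (Fin m)) (α : N)).source := by
      have hp : ContDiff ℝ ∞ (fun y : EuclideanSpace ℝ (Fin m) => y i) := by fun_prop
      exact hp.contMDiff.comp_contMDiffOn contMDiffOn_extChartAt
    have h2 := (χ α).contMDiff_smul h1
    exact contMDiff_const.mul h2
  -- the index `(α, some i)` carries the `i`-th coordinate of the chart at `α` and its coordinate
  -- field; the index `(α, none)` carries the bump function, which separates the points of the chart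
  -- from the others, and the zero field
  let fn : s × Option (Fin m) → C^∞⟮𝓡 m, N; 𝓘(ℝ, ℝ), ℝ⟯ := fun k =>
    match k with
    | (α, some i) => ⟨_, hsm α i⟩
    | (α, none) => ⟨χ α, (χ α).contMDiff⟩
  let flow : s × Option (Fin m) → ℝ × N → N := fun k =>
    match k with
    | (α, some i) => chartFlow (α : N) (ε α) (w α) (EuclideanSpace.single i 1)
    | (_, none) => Prod.snd
  refine ⟨s, ⟨⟨fn, flow, ?_, ?_, ?_, ?_, ?_⟩⟩⟩
  · rintro ⟨α, _ | i⟩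
    · exact contMDiff_snd
    · exact contMDiff_chartFlow (w α).contMDiff (hwsrc α) (hεt α i)
  · rintro ⟨α, _ | i⟩ q
    · rfl
    · exact chartFlow_of_eq_zero (by simp)
  · intro q v
    rw [Fintype.sum_prod_type]
    have hα : ∀ α : s, ∑ o : Option (Fin m), differential (fn (α, o)) q v •
        variationField (m := m) (flow (α, o)) q = (w α q) • v := by
      intro α
      rw [Fintype.sum_option]
      have hnone : variationField (m := m) (flow (α, none)) q = 0 :=
        variationField_eq_zero fun _ => rfl
      rw [hnone, smul_zero, zero_add]
      by_cases hq : q ∈ tsupport (w α)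
      · have hqs := hwsrc α hq
        set A : TangentSpace (𝓡 m) q →L[ℝ] EuclideanSpace ℝ (Fin m) :=
          mfderiv (𝓡 m) 𝓘(ℝ, EuclideanSpace ℝ (Fin m)) (extChartAt (𝓡 m) (α : N)) q with hA
        have hinj : Function.Injective A := by
          have := (isInvertible_mfderiv_extChartAt (I := 𝓡 m) (x := (α : N)) (y := q)
            (by rwa [extChartAt_source])).injective
          exact this
        refine hinj ?_
        rw [map_sum]
        have hterm : ∀ i : Fin m, A (differential (fn (α, some i)) q v •
            variationField (m := m) (flow (α, some i)) q)
            = (w α q * ((A v) i)) •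
              (EuclideanSpace.single i 1 : EuclideanSpace ℝ (Fin m)) := by
          intro i
          have e1 : A (variationField (m := m) (flow (α, some i)) q) = _ :=
            mfderiv_extChartAt_variationField (w α).contMDiff (hwsrc α) (hεt α i) hq
          have hmd : MDifferentiableAt (𝓡 m) 𝓘(ℝ, EuclideanSpace ℝ (Fin m))
              (extChartAt (𝓡 m) (α : N)) q := mdifferentiableAt_extChartAt hqs
          have hp : HasFDerivAt (fun y : EuclideanSpace ℝ (Fin m) => (ε α)⁻¹ * y i)
              ((ε α)⁻¹ • (EuclideanSpace.proj i : EuclideanSpace ℝ (Fin m) →L[ℝ] ℝ))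
              (extChartAt (𝓡 m) (α : N) q) :=
            ((ε α)⁻¹ • (EuclideanSpace.proj i : EuclideanSpace ℝ (Fin m) →L[ℝ] ℝ)).hasFDerivAt
          have e2 := hp.hasMFDerivAt.comp q hmd.hasMFDerivAt
          have e3 : HasMFDerivAt (𝓡 m) 𝓘(ℝ, ℝ) (fn (α, some i)) q
              (((ε α)⁻¹ • (EuclideanSpace.proj i : EuclideanSpace ℝ (Fin m) →L[ℝ] ℝ)).comp A) := by
            refine e2.congr_of_eventuallyEq ?_
            filter_upwards [isOpen_interior.mem_nhds (hw α hq)] with q' hq'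
            change (ε α)⁻¹ * (χ α q' * _) = _
            rw [hV1 α q' hq', one_mul]
            rfl
          -- the factor `ε` of the field is compensated by the factor `ε⁻¹` of the function
          have e4 : differential (fn (α, some i)) q v
              = (ε α)⁻¹ * (A v) i := by
            rw [differential, e3.mfderiv]
            rfl
          rw [map_smul, e1, e4]
          refine (smul_smul _ _ _).trans ?_
          congr 1
          have := (hε α).ne'
          field_simp
        rw [Finset.sum_congr rfl fun i _ => hterm i, map_smul]
        have e5 : ∀ y : EuclideanSpace ℝ (Fin m), ∑ i : Fin m, (w α q * y i) •
            (EuclideanSpace.single i 1 : EuclideanSpace ℝ (Fin m)) = w α q • y := by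
          intro y
          ext j
          simp [Finset.sum_apply, Pi.single_apply]
        exact e5 (A v)
      · have hw0 : w α q = 0 := image_eq_zero_of_notMem_tsupport hq
        rw [hw0, zero_smul]
        refine Finset.sum_eq_zero fun i _ => ?_
        have : variationField (m := m) (flow (α, some i)) q = 0 :=
          variationField_eq_zero fun r => chartFlow_of_eq_zero (by simp [hw0])
        rw [this, smul_zero]
    rw [Finset.sum_congr rfl fun α _ => hα α, ← Finset.sum_smul]
    have := w.sum_eq_one (mem_univ q)
    rw [finsum_eq_sum_of_fintype] at this
    rw [this, one_smul]
  · intro q q' h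
    obtain ⟨α, hα, hqα⟩ := mem_iUnion₂.1 (hs (mem_univ q))
    have h1 : χ α q = 1 := hV1 α q hqα
    have h2 : χ α q = χ α q' := h (⟨α, hα⟩, none)
    have h3 : ∀ i, extChartAt (𝓡 m) α q i = extChartAt (𝓡 m) α q' i := by
      intro i
      have h4 : (ε ⟨α, hα⟩)⁻¹ * (χ α q * (extChartAt (𝓡 m) α q) i)
        = (ε ⟨α, hα⟩)⁻¹ * (χ α q' * (extChartAt (𝓡 m) α q') i) := h (⟨α, hα⟩, some i)
      rw [← h2, h1, one_mul, one_mul] at h4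
      exact mul_left_cancel₀ (inv_ne_zero (hε _).ne') h4
    refine (extChartAt (𝓡 m) α).injOn ?_ ?_ (PiLp.ext h3)
    · rw [extChartAt_source]; exact hVsrc α q h1
    · rw [extChartAt_source]; exact hVsrc α q' (h2 ▸ h1)
  · intro q
    obtain ⟨α, hα, hqα⟩ := mem_iUnion₂.1 (hs (mem_univ q))
    refine ⟨α, hVsrc α q (hV1 α q hqα),
      (EuclideanSpace.equiv (Fin m) ℝ).symm.toContinuousLinearMap.comp
        (ContinuousLinearMap.pi fun i => ε ⟨α, hα⟩ •
          ContinuousLinearMap.proj ((⟨α, hα⟩, some i) : s × Option (Fin m))), ?_⟩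
    filter_upwards [isOpen_interior.mem_nhds hqα] with q' hq'
    ext i
    have h1 : fn (⟨α, hα⟩, some i) q' = (ε ⟨α, hα⟩)⁻¹ * (extChartAt (𝓡 m) α q') i := by
      change (ε ⟨α, hα⟩)⁻¹ * (χ α q' * _) = _
      rw [hV1 α q' hq', one_mul]
    have := (hε ⟨α, hα⟩).ne'
    simp [h1]
    field_simp

end Frame

/-! ### Calculus with a smooth frame -/

/-- The partial derivative in a real variable of a smooth function on a product is smooth. -/
theorem contMDiff_deriv_fst {V H P : Type*} [NormedAddCommGroup V] [NormedSpace ℝ V]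
    [TopologicalSpace H] {J : ModelWithCorners ℝ V H} [TopologicalSpace P] [ChartedSpace H P]
    [IsManifold J ∞ P] {f : ℝ × P → ℝ}
    (hf : ContMDiff (𝓘(ℝ, ℝ).prod J) 𝓘(ℝ, ℝ) ∞ f) :
    ContMDiff J 𝓘(ℝ, ℝ) ∞ (fun p => deriv (fun s => f (s, p)) 0) := by
  intro p
  have h1 : ContMDiffAt (J.prod 𝓘(ℝ, ℝ)) 𝓘(ℝ, ℝ) ∞
      (Function.uncurry fun (p : P) (s : ℝ) => f (s, p)) (p, 0) :=
    (hf.comp (contMDiff_snd.prodMk contMDiff_fst)).contMDiffAt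
  have h2 := ContMDiffAt.mfderiv (m := ∞) (fun (p : P) (s : ℝ) => f (s, p)) (fun _ => 0) h1
    contMDiffAt_const (by simp)
  have h3 : ContMDiffAt J 𝓘(ℝ, ℝ →L[ℝ] ℝ) ∞
      (fun p => fderiv ℝ (fun s => f (s, p)) 0) p := by
    refine h2.congr_of_eventuallyEq (.of_forall fun x => ?_)
    have h4 := congrFun (inTangentCoordinates_model_space (I := 𝓘(ℝ, ℝ)) (I' := 𝓘(ℝ, ℝ))
      (fun _ : P => (0 : ℝ)) (fun x => f (0, x))
      (fun x => (mfderiv 𝓘(ℝ, ℝ) 𝓘(ℝ, ℝ) (fun s => f (s, x)) 0 : ℝ →L[ℝ] ℝ)) p) x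
    refine Eq.trans ?_ h4.symm
    exact mfderiv_eq_fderiv.symm
  have h4 := h3.clm_apply (contMDiffAt_const (c := (1 : ℝ)))
  simpa only [fderiv_apply_one_eq_deriv] using h4

section FrameCalculus

variable {m : ℕ} {N : Type*} [TopologicalSpace N] [ChartedSpace (EuclideanSpace ℝ (Fin m)) N]

/-- The derivative in the real variable of a function on `ℝ × N`. -/
noncomputable def paramDeriv (G : ℝ × N → ℝ) (p : ℝ × N) : ℝ := deriv (fun s => G (p.1 + s, p.2)) 0

theorem hasDerivAt_paramDeriv {G : ℝ × N → ℝ}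
    (hG : ContMDiff (𝓘(ℝ, ℝ).prod (𝓡 m)) 𝓘(ℝ, ℝ) ∞ G) (r : ℝ) (q : N) :
    HasDerivAt (fun s => G (s, q)) (paramDeriv G (r, q)) r := by
  have h1 : ContMDiff 𝓘(ℝ, ℝ) 𝓘(ℝ, ℝ) ∞ (fun s => G (s, q)) :=
    hG.comp (contMDiff_id.prodMk contMDiff_const)
  have h2 : HasDerivAt (fun s => G (s, q)) (deriv (fun s => G (s, q)) r) r :=
    (h1.contDiff.differentiable (by simp) r).hasDerivAt
  have h3 : paramDeriv G (r, q) = deriv (fun s => G (s, q)) r := by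
    have := deriv_comp_const_add (fun s => G (s, q)) r 0
    rw [add_zero] at this
    exact this
  rwa [h3]

variable [IsManifold (𝓡 m) ∞ N]

/-- The derivative of a smooth function in the direction of the velocity of a family of maps. -/
noncomputable def variationDeriv (Φ : ℝ × N → N)
    (hΦ : ContMDiff (𝓘(ℝ, ℝ).prod (𝓡 m)) (𝓡 m) ∞ Φ) (F : C^∞⟮𝓡 m, N; 𝓘(ℝ, ℝ), ℝ⟯) :
    C^∞⟮𝓡 m, N; 𝓘(ℝ, ℝ), ℝ⟯ :=
  ⟨fun q => deriv (fun s => F (Φ (s, q))) 0, contMDiff_deriv_fst (F.contMDiff.comp hΦ)⟩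

theorem variationDeriv_apply {Φ : ℝ × N → N}
    (hΦ : ContMDiff (𝓘(ℝ, ℝ).prod (𝓡 m)) (𝓡 m) ∞ Φ) (h0 : ∀ q, Φ (0, q) = q)
    (F : C^∞⟮𝓡 m, N; 𝓘(ℝ, ℝ), ℝ⟯) (q : N) :
    variationDeriv Φ hΦ F q = differential F q (variationField Φ q) :=
  (hasDerivAt_variationField hΦ (h0 q) F).deriv

theorem contMDiff_paramDeriv {G : ℝ × N → ℝ}
    (hG : ContMDiff (𝓘(ℝ, ℝ).prod (𝓡 m)) 𝓘(ℝ, ℝ) ∞ G) :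
    ContMDiff (𝓘(ℝ, ℝ).prod (𝓡 m)) 𝓘(ℝ, ℝ) ∞ (paramDeriv G) := by
  refine contMDiff_deriv_fst (f := fun z : ℝ × (ℝ × N) => G (z.2.1 + z.1, z.2.2)) ?_
  refine hG.comp (ContMDiff.prodMk ?_ (contMDiff_snd.comp contMDiff_snd))
  exact (contMDiff_fst.comp contMDiff_snd).add contMDiff_fst

namespace SmoothFrame

variable {ι : Type*} [Fintype ι] (Fr : SmoothFrame m N ι)

/-- The derivative of a smooth function in the direction of the `k`-th field of a frame. -/
noncomputable def along (k : ι) (F : C^∞⟮𝓡 m, N; 𝓘(ℝ, ℝ), ℝ⟯) : C^∞⟮𝓡 m, N; 𝓘(ℝ, ℝ), ℝ⟯ :=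
  variationDeriv (Fr.flow k) (Fr.contMDiff_flow k) F

theorem along_apply (k : ι) (F : C^∞⟮𝓡 m, N; 𝓘(ℝ, ℝ), ℝ⟯) (q : N) :
    Fr.along k F q = differential F q (variationField (Fr.flow k) q) :=
  variationDeriv_apply _ (Fr.flow_zero k) F q

/-- The derivative in the direction of the `k`-th field, for a function on `ℝ × N`. -/
noncomputable def alongParam (k : ι) (G : ℝ × N → ℝ) (p : ℝ × N) : ℝ :=
  deriv (fun s => G (p.1, Fr.flow k (s, p.2))) 0

theorem contMDiff_alongParam (k : ι) {G : ℝ × N → ℝ}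
    (hG : ContMDiff (𝓘(ℝ, ℝ).prod (𝓡 m)) 𝓘(ℝ, ℝ) ∞ G) :
    ContMDiff (𝓘(ℝ, ℝ).prod (𝓡 m)) 𝓘(ℝ, ℝ) ∞ (Fr.alongParam k G) := by
  refine contMDiff_deriv_fst (f := fun z : ℝ × (ℝ × N) => G (z.2.1, Fr.flow k (z.1, z.2.2))) ?_
  refine hG.comp ((contMDiff_fst.comp contMDiff_snd).prodMk ((Fr.contMDiff_flow k).comp ?_))
  exact contMDiff_fst.prodMk (contMDiff_snd.comp contMDiff_snd)

theorem differential_eq_sum (F : C^∞⟮𝓡 m, N; 𝓘(ℝ, ℝ), ℝ⟯) (q : N) (v : TangentSpace (𝓡 m) q) :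
    differential F q v = ∑ k, Fr.along k F q * differential (Fr.fn k) q v := by
  conv_lhs => rw [← Fr.sum_smul q v]
  rw [map_sum]
  refine Finset.sum_congr rfl fun k _ => ?_
  rw [map_smul, Fr.along_apply, smul_eq_mul, mul_comm]

/-- A curve is as regular as its images under the functions of a frame, since these contain local
coordinates. -/
theorem contMDiffAt_curve {r : WithTop ℕ∞} (hr : r ≤ (∞ : WithTop ℕ∞)) {c : ℝ → N} {t : ℝ}
    (hc : ContinuousAt c t) (h : ∀ k, ContDiffAt ℝ r (fun s => Fr.fn k (c s)) t) :
    ContMDiffAt 𝓘(ℝ, ℝ) (𝓡 m) r c t := by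
  have : IsManifold (𝓡 m) r N := IsManifold.of_le hr
  obtain ⟨α, hα, L, hL⟩ := Fr.coord (c t)
  rw [contMDiffAt_iff_target_of_mem_source hα]
  refine ⟨hc, ?_⟩
  have h1 : ContDiffAt ℝ r (fun s => L (fun k => Fr.fn k (c s))) t :=
    L.contDiff.contDiffAt.comp t (contDiffAt_pi.2 h)
  refine h1.contMDiffAt.congr_of_eventuallyEq ?_
  filter_upwards [hc.eventually hL] with s hs using hs

theorem mdifferentiableAt_curve {c : ℝ → N} {t : ℝ} (hc : ContinuousAt c t)
    (h : ∀ k, DifferentiableAt ℝ (fun s => Fr.fn k (c s)) t) :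
    MDifferentiableAt 𝓘(ℝ, ℝ) (𝓡 m) c t := by
  have : IsManifold (𝓡 m) 1 N := IsManifold.of_le (n := ∞) (by simp)
  obtain ⟨α, hα, L, hL⟩ := Fr.coord (c t)
  rw [mdifferentiableAt_iff_target_of_mem_source hα]
  refine ⟨hc, ?_⟩
  have h1 : DifferentiableAt ℝ (fun s => L (fun k => Fr.fn k (c s))) t :=
    L.differentiableAt.comp t (differentiableAt_pi.2 h)
  refine h1.mdifferentiableAt.congr_of_eventuallyEq ?_
  filter_upwards [hc.eventually hL] with s hs using hs

theorem ae_mdifferentiableAt (Fr : SmoothFrame m N ι) (γ : H1Loop m N) :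
    ∀ᵐ t ∂unitMeasure, MDifferentiableAt 𝓘(ℝ, ℝ) (𝓡 m) γ.toFun t := by
  filter_upwards [ae_all_iff.2 fun k => (γ.periodicH1 (Fr.fn k)).ae_hasDerivAt] with t ht
  exact Fr.mdifferentiableAt_curve γ.continuous.continuousAt fun k => (ht k).differentiableAt

/-- The chain rule for a time-dependent function along a curve, in terms of a frame. -/
theorem hasDerivAt_comp_param {G : ℝ × N → ℝ}
    (hG : ContMDiff (𝓘(ℝ, ℝ).prod (𝓡 m)) 𝓘(ℝ, ℝ) ∞ G) {ρ : ℝ → ℝ} {ρ' : ℝ} {c : ℝ → N} {t : ℝ}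
    (hρ : HasDerivAt ρ ρ' t) (hc : MDifferentiableAt 𝓘(ℝ, ℝ) (𝓡 m) c t) :
    HasDerivAt (fun s => G (ρ s, c s)) (paramDeriv G (ρ t, c t) * ρ'
      + ∑ k, Fr.alongParam k G (ρ t, c t) * deriv (fun s => Fr.fn k (c s)) t) t := by
  have hGd : MDifferentiableAt (𝓘(ℝ, ℝ).prod (𝓡 m)) 𝓘(ℝ, ℝ) G (ρ t, c t) :=
    hG.mdifferentiableAt (by simp)
  have h1 := hρ.hasFDerivAt.hasMFDerivAt.prodMk hc.hasMFDerivAt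
  have h2 := hasDerivAt_of_hasMFDerivAt (hGd.hasMFDerivAt.comp t h1)
  let Gq : C^∞⟮𝓡 m, N; 𝓘(ℝ, ℝ), ℝ⟯ :=
    ⟨fun q => G (ρ t, q), hG.comp (contMDiff_const.prodMk contMDiff_id)⟩
  convert! h2 using 1
  refine Eq.trans ?_ (mfderiv_prod_eq_add_apply (p := (ρ t, c t))
    (v := ((ρ', mfderiv 𝓘(ℝ, ℝ) (𝓡 m) c t (1 : ℝ)) :
      TangentSpace (𝓘(ℝ, ℝ).prod (𝓡 m)) (ρ t, c t))) hGd).symm |>.trans ?_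
  · congr 1
    · rw [mfderiv_eq_fderiv]
      have := (hasDerivAt_paramDeriv hG (ρ t) (c t)).hasFDerivAt.fderiv
      simp only
      rw [this]
      change _ = ContinuousLinearMap.toSpanSingleton ℝ (paramDeriv G (ρ t, c t)) ρ'
      rw [ContinuousLinearMap.toSpanSingleton_apply, smul_eq_mul, mul_comm]
    · have := Fr.differential_eq_sum Gq (c t) (mfderiv 𝓘(ℝ, ℝ) (𝓡 m) c t (1 : ℝ))
      refine Eq.trans ?_ this.symm
      refine Finset.sum_congr rfl fun k _ => ?_
      rw [(hasDerivAt_comp_curve (Fr.fn k) hc).deriv]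
      rfl
  · have h4 : ContinuousLinearMap.toSpanSingleton ℝ ρ' (1 : ℝ) = ρ' := by simp
    conv_lhs => rw [← h4]
    rfl

/-- The chain rule for a function along a curve, in terms of a frame. -/
theorem hasDerivAt_comp (F : C^∞⟮𝓡 m, N; 𝓘(ℝ, ℝ), ℝ⟯) {c : ℝ → N} {t : ℝ}
    (hc : MDifferentiableAt 𝓘(ℝ, ℝ) (𝓡 m) c t) :
    HasDerivAt (fun s => F (c s))
      (∑ k, Fr.along k F (c t) * deriv (fun s => Fr.fn k (c s)) t) t := by
  convert! hasDerivAt_comp_curve F hc using 1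
  rw [Fr.differential_eq_sum]
  refine Finset.sum_congr rfl fun k _ => ?_
  rw [(hasDerivAt_comp_curve (Fr.fn k) hc).deriv]

/-- A smooth function on `ℝ × N`, with `N` compact, is Lipschitz on `[-R, R] × N` with respect to
the distance defined by the functions of a frame. Hence compositions with `H¹` loops are
absolutely continuous. -/
theorem exists_lipschitz [T2Space N] [CompactSpace N] {G : ℝ × N → ℝ}
    (hG : ContMDiff (𝓘(ℝ, ℝ).prod (𝓡 m)) 𝓘(ℝ, ℝ) ∞ G) (R : ℝ) :
    ∃ C : ℝ, ∀ r ∈ Icc (-R) R, ∀ r' ∈ Icc (-R) R, ∀ q q' : N,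
      |G (r, q) - G (r', q')| ≤ C * (|r - r'| + ∑ k, |Fr.fn k q - Fr.fn k q'|) := by
  set δ : (ℝ × N) × (ℝ × N) → ℝ := fun z =>
    |z.1.1 - z.2.1| + ∑ k, |Fr.fn k z.1.2 - Fr.fn k z.2.2| with hδ
  have hδ0 : ∀ z, 0 ≤ δ z := fun z => by positivity
  have hfn : ∀ k, Continuous (Fr.fn k) := fun k => (Fr.fn k).contMDiff.continuous
  have hδc : Continuous δ := by
    have h1 : ∀ k, Continuous fun z : (ℝ × N) × (ℝ × N) =>
        |Fr.fn k z.1.2 - Fr.fn k z.2.2| := fun k =>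
      (((hfn k).comp (continuous_snd.comp continuous_fst)).sub
        ((hfn k).comp (continuous_snd.comp continuous_snd))).abs
    exact (by fun_prop : Continuous fun z : (ℝ × N) × (ℝ × N) => |z.1.1 - z.2.1|).add
      (continuous_finsetSum _ fun k _ => h1 k)
  set K : Set (ℝ × N) := Icc (-R) R ×ˢ univ with hK
  have hKc : IsCompact (K ×ˢ K) := (isCompact_Icc.prod isCompact_univ).prod
    (isCompact_Icc.prod isCompact_univ)
  suffices h : ∃ C : ℝ, 0 ≤ C ∧ ∀ z ∈ K ×ˢ K, |G z.1 - G z.2| ≤ C * δ z by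
    obtain ⟨C, _, hC⟩ := h
    exact ⟨C, fun r hr r' hr' q q' => hC ((r, q), (r', q'))
      ⟨⟨hr, mem_univ _⟩, ⟨hr', mem_univ _⟩⟩⟩
  refine hKc.induction_on (p := fun S => ∃ C : ℝ, 0 ≤ C ∧ ∀ z ∈ S, |G z.1 - G z.2| ≤ C * δ z)
    ⟨0, le_rfl, by simp⟩ (fun S S' hS ⟨C, hC0, hC⟩ => ⟨C, hC0, fun z hz => hC z (hS hz)⟩) ?_ ?_
  · rintro S S' ⟨C, hC0, hC⟩ ⟨C', hC0', hC'⟩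
    refine ⟨C + C', by positivity, fun z hz => ?_⟩
    rw [add_mul]
    rcases hz with hz | hz
    · have := hC z hz
      have := mul_nonneg hC0' (hδ0 z)
      linarith
    · have := hC' z hz
      have := mul_nonneg hC0 (hδ0 z)
      linarith
  · rintro ⟨⟨r, q⟩, ⟨r', q'⟩⟩ -
    by_cases h : δ ((r, q), (r', q')) = 0
    · -- on the diagonal the chart provides a Lipschitz constant
      have hs : ∑ k, |Fr.fn k q - Fr.fn k q'| = 0 := le_antisymm
        (by have := abs_nonneg (r - r'); simp only [hδ] at h; linarith)
        (Finset.sum_nonneg fun _ _ => abs_nonneg _)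
      have hr : r = r' := by
        simp only [hδ] at h
        rw [hs, add_zero, abs_eq_zero] at h
        linarith
      have hq : q = q' := Fr.injective q q' fun k => by
        have := (Finset.sum_eq_zero_iff_of_nonneg fun _ _ => abs_nonneg _).1 hs k (Finset.mem_univ k)
        rw [abs_eq_zero] at this
        linarith
      subst hr hq
      obtain ⟨α, hα, L, hL⟩ := Fr.coord q
      set ψ := (extChartAt (𝓡 m) α).symm with hψ
      have hαs : q ∈ (extChartAt (𝓡 m) α).source := by rwa [extChartAt_source]
      have hg : ContDiffAt ℝ 1 (fun y : ℝ × EuclideanSpace ℝ (Fin m) => G (y.1, ψ y.2))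
          (r, extChartAt (𝓡 m) α q) := by
        have h1 : ContMDiffAt 𝓘(ℝ, EuclideanSpace ℝ (Fin m)) (𝓡 m) ∞ ψ
            (extChartAt (𝓡 m) α q) :=
          (contMDiffOn_extChartAt_symm α).contMDiffAt ((isOpen_extChartAt_target α).mem_nhds
            ((extChartAt (𝓡 m) α).map_source hαs))
        have h2 : ContMDiffAt 𝓘(ℝ, ℝ × EuclideanSpace ℝ (Fin m)) (𝓘(ℝ, ℝ).prod (𝓡 m)) ∞
            (fun y : ℝ × EuclideanSpace ℝ (Fin m) => (y.1, ψ y.2)) (r, extChartAt (𝓡 m) α q) :=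
          contDiff_fst.contMDiff.contMDiffAt.prodMk
            (ContMDiffAt.comp (r, extChartAt (𝓡 m) α q) h1 contDiff_snd.contMDiff.contMDiffAt)
        exact (ContMDiffAt.comp _ hG.contMDiffAt h2).contDiffAt.of_le (by simp)
      obtain ⟨C, S, hS, hC⟩ := hg.exists_lipschitzOnWith
      have hcont : ContinuousAt (fun p : ℝ × N => (p.1, extChartAt (𝓡 m) α p.2)) (r, q) :=
        continuousAt_fst.prodMk
          (ContinuousAt.comp (x := (r, q)) (continuousAt_extChartAt' hαs) continuousAt_snd)
      have hsnd : Tendsto (fun p : ℝ × N => p.2) (𝓝 (r, q)) (𝓝 q) := continuousAt_snd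
      have hnhds : ∀ᶠ p : ℝ × N in 𝓝 (r, q), (p.1, extChartAt (𝓡 m) α p.2) ∈ S ∧
          extChartAt (𝓡 m) α p.2 = L (fun k => Fr.fn k p.2) ∧
          p.2 ∈ (extChartAt (𝓡 m) α).source :=
        (hcont.eventually hS).and ((hsnd.eventually hL).and
          (hsnd.eventually (extChartAt_source_mem_nhds' hαs)))
      refine ⟨{z | ((z.1.1, extChartAt (𝓡 m) α z.1.2) ∈ S ∧
          extChartAt (𝓡 m) α z.1.2 = L (fun k => Fr.fn k z.1.2) ∧
          z.1.2 ∈ (extChartAt (𝓡 m) α).source) ∧ ((z.2.1, extChartAt (𝓡 m) α z.2.2) ∈ S ∧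
          extChartAt (𝓡 m) α z.2.2 = L (fun k => Fr.fn k z.2.2) ∧
          z.2.2 ∈ (extChartAt (𝓡 m) α).source)}, ?_, C * (1 + ‖L‖), by positivity, ?_⟩
      · refine mem_nhdsWithin_of_mem_nhds ?_
        rw [nhds_prod_eq]
        exact (tendsto_fst.eventually hnhds).and (tendsto_snd.eventually hnhds)
      · rintro ⟨⟨s, x⟩, ⟨s', x'⟩⟩ ⟨⟨h1, h2, h3⟩, ⟨h1', h2', h3'⟩⟩
        have h4 := hC.dist_le_mul _ h1 _ h1'
        simp only [hψ, (extChartAt (𝓡 m) α).left_inv h3, (extChartAt (𝓡 m) α).left_inv h3'] at h4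
        rw [Real.dist_eq] at h4
        refine h4.trans ?_
        rw [mul_assoc]
        refine mul_le_mul_of_nonneg_left ?_ C.2
        have h5 : ‖(fun k => Fr.fn k x) - fun k => Fr.fn k x'‖ ≤ ∑ k, |Fr.fn k x - Fr.fn k x'| := by
          refine (pi_norm_le_iff_of_nonneg (Finset.sum_nonneg fun _ _ => abs_nonneg _)).2 fun k => ?_
          exact Finset.single_le_sum (f := fun k => |Fr.fn k x - Fr.fn k x'|)
            (fun _ _ => abs_nonneg _) (Finset.mem_univ k)
        have h6 : dist (extChartAt (𝓡 m) α x) (extChartAt (𝓡 m) α x')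
            ≤ ‖L‖ * ∑ k, |Fr.fn k x - Fr.fn k x'| := by
          rw [h2, h2', dist_eq_norm, ← map_sub]
          exact (L.le_opNorm _).trans (by gcongr)
        have h7 : (0 : ℝ) ≤ ∑ k, |Fr.fn k x - Fr.fn k x'| := Finset.sum_nonneg fun _ _ => abs_nonneg _
        have h8 := abs_nonneg (s - s')
        have h9 := norm_nonneg L
        rw [Prod.dist_eq]
        refine max_le ?_ (h6.trans ?_)
        · rw [Real.dist_eq]
          simp only [hδ]
          nlinarith [mul_nonneg h9 h8, mul_nonneg h9 h7]
        · simp only [hδ]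
          nlinarith [mul_nonneg h9 h8, mul_nonneg h9 h7]
    · -- off the diagonal the distance is bounded below
      have hpos : 0 < δ ((r, q), (r', q')) := lt_of_le_of_ne (hδ0 _) (Ne.symm h)
      have hGc : Continuous fun z : (ℝ × N) × (ℝ × N) => |G z.1 - G z.2| :=
        ((hG.continuous.comp continuous_fst).sub (hG.continuous.comp continuous_snd)).abs
      set M := |G (r, q) - G (r', q')| + 1 with hM
      set d := δ ((r, q), (r', q')) with hd
      refine ⟨{z | |G z.1 - G z.2| < M ∧ d / 2 < δ z}, ?_, M / (d / 2), by positivity, ?_⟩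
      · refine mem_nhdsWithin_of_mem_nhds ?_
        refine (hGc.continuousAt.eventually_lt_const (by simp [hM])).and
          (hδc.continuousAt.eventually_const_lt ?_)
        change d / 2 < d
        linarith
      · rintro z ⟨h1, h2⟩
        rw [div_mul_eq_mul_div, le_div_iff₀ (by linarith)]
        have hM0 : 0 ≤ M := by positivity
        calc |G z.1 - G z.2| * (d / 2) ≤ M * (d / 2) := by gcongr
          _ ≤ M * δ z := by gcongr

end SmoothFrame

end FrameCalculus

/-! ### One-forms and metrics in a smooth frame -/

section Forms

variable {m : ℕ} {N : Type*} [TopologicalSpace N] [ChartedSpace (EuclideanSpace ℝ (Fin m)) N]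
  [IsManifold (𝓡 m) ∞ N]

/-- The initial velocity of a smooth family of maps is a smooth vector field: it is the image of
`(∂ₛ, 0)` under the tangent map of the family. -/
theorem contMDiff_variationField {Φ : ℝ × N → N}
    (hΦ : ContMDiff (𝓘(ℝ, ℝ).prod (𝓡 m)) (𝓡 m) ∞ Φ) (h0 : ∀ q, Φ (0, q) = q) :
    ContMDiff (𝓡 m) ((𝓡 m).prod 𝓘(ℝ, EuclideanSpace ℝ (Fin m))) ∞
      (fun q => TotalSpace.mk' (EuclideanSpace ℝ (Fin m)) (E := fun q : N => TangentSpace (𝓡 m) q)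
        q (variationField Φ q)) := by
  have : IsManifold (𝓡 m) 1 N := IsManifold.of_le (n := ∞) (by simp)
  have h1 : ContMDiff (𝓡 m) ((𝓡 m).prod 𝓘(ℝ, EuclideanSpace ℝ (Fin m))) ∞
      (fun q => TotalSpace.mk' (EuclideanSpace ℝ (Fin m)) (E := fun q : N => TangentSpace (𝓡 m) q)
        q 0) := Bundle.contMDiff_zeroSection ℝ (TangentSpace (𝓡 m) : N → Type _)
  let one : TangentBundle 𝓘(ℝ, ℝ) ℝ := ⟨0, (1 : ℝ)⟩
  have h2 : ContMDiff (𝓡 m) (𝓘(ℝ, ℝ).tangent.prod (𝓡 m).tangent) ∞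
      (fun q : N => (one, (⟨q, 0⟩ : TangentBundle (𝓡 m) N))) := contMDiff_const.prodMk h1
  have h3 := (contMDiff_equivTangentBundleProd_symm (n := ∞) (I := 𝓘(ℝ, ℝ)) (M := ℝ) (I' := 𝓡 m)
    (M' := N)).comp h2
  have h4 := (hΦ.contMDiff_tangentMap (m := ∞) (by simp)).comp h3
  convert! h4 using 1
  ext1 q
  have e1 : ∀ (x y : N) (_ : x = y) (v : EuclideanSpace ℝ (Fin m)),
      (⟨x, v⟩ : TangentBundle (𝓡 m) N) = ⟨y, v⟩ := by
    rintro x _ rfl v; rfl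
  have e2 := mfderiv_prod_eq_add_apply (p := ((0 : ℝ), q)) (v := (((1 : ℝ), 0) :
      TangentSpace (𝓘(ℝ, ℝ).prod (𝓡 m)) ((0 : ℝ), q)))
      (hΦ.mdifferentiableAt (by simp) : MDifferentiableAt _ (𝓡 m) Φ (0, q))
  have e3 : mfderiv (𝓘(ℝ, ℝ).prod (𝓡 m)) (𝓡 m) Φ (0, q) (((1 : ℝ), 0) :
      TangentSpace (𝓘(ℝ, ℝ).prod (𝓡 m)) ((0 : ℝ), q))
      = mfderiv 𝓘(ℝ, ℝ) (𝓡 m) (fun s : ℝ => Φ (s, q)) 0 (1 : ℝ) := by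
    refine e2.trans ?_
    simp only
    refine (congrArg _ (map_zero _)).trans ?_
    exact add_zero _
  refine (e1 _ _ (h0 q) (variationField Φ q)).symm.trans ?_
  change (⟨Φ (0, q), _⟩ : TangentBundle (𝓡 m) N) = ⟨Φ (0, q), _⟩
  congr 1
  exact e3.symm

variable {ι : Type*} [Fintype ι]

/-- The coefficients `θ(Xₖ)` of a one-form in a frame. -/
noncomputable def SmoothFrame.coeff (Fr : SmoothFrame m N ι) (θ : OneForm m N) (k : ι) :
    C^∞⟮𝓡 m, N; 𝓘(ℝ, ℝ), ℝ⟯ :=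
  ⟨fun q => θ.form q (variationField (Fr.flow k) q), by
    have h : ContMDiff (𝓡 m) ((𝓡 m).prod 𝓘(ℝ, ℝ)) ∞
        (fun q => TotalSpace.mk' ℝ (E := Bundle.Trivial N ℝ) q
          (θ.form q (variationField (Fr.flow k) q))) := by
      apply ContMDiff.clm_bundle_apply (F₁ := EuclideanSpace ℝ (Fin m))
      · exact θ.smooth
      · exact contMDiff_variationField (Fr.contMDiff_flow k) (Fr.flow_zero k)
    intro q
    have h' := h q
    simp only [contMDiffAt_totalSpace] at h'
    exact h'.2⟩

theorem SmoothFrame.form_eq_sum (Fr : SmoothFrame m N ι) (θ : OneForm m N) (q : N)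
    (v : TangentSpace (𝓡 m) q) :
    θ.form q v = ∑ k, Fr.coeff θ k q * differential (Fr.fn k) q v := by
  conv_lhs => rw [← Fr.sum_smul q v]
  rw [map_sum]
  refine Finset.sum_congr rfl fun k _ => ?_
  rw [map_smul, smul_eq_mul, mul_comm]
  rfl

/-- The Gram matrix `g(Xᵢ, Xⱼ)` of a frame. -/
noncomputable def SmoothFrame.gram (Fr : SmoothFrame m N ι) (g : Metric m N) (i j : ι) :
    C^∞⟮𝓡 m, N; 𝓘(ℝ, ℝ), ℝ⟯ :=
  ⟨fun q => g.inner q (variationField (Fr.flow i) q) (variationField (Fr.flow j) q), by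
    have h : ContMDiff (𝓡 m) ((𝓡 m).prod 𝓘(ℝ, ℝ)) ∞
        (fun q => TotalSpace.mk' ℝ (E := Bundle.Trivial N ℝ) q
          (g.inner q (variationField (Fr.flow i) q) (variationField (Fr.flow j) q))) := by
      intro q
      apply ContMDiffAt.clm_bundle_apply₂ (F₁ := EuclideanSpace ℝ (Fin m))
        (F₂ := EuclideanSpace ℝ (Fin m))
      · exact g.contMDiff q
      · exact contMDiff_variationField (Fr.contMDiff_flow i) (Fr.flow_zero i) q
      · exact contMDiff_variationField (Fr.contMDiff_flow j) (Fr.flow_zero j) q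
    intro q
    have h' := h q
    simp only [contMDiffAt_totalSpace] at h'
    exact h'.2⟩

theorem SmoothFrame.gram_symm (Fr : SmoothFrame m N ι) (g : Metric m N) (i j : ι) :
    Fr.gram g i j = Fr.gram g j i := by
  ext q
  exact g.symm q _ _

theorem SmoothFrame.inner_eq_sum (Fr : SmoothFrame m N ι) (g : Metric m N) (q : N)
    (u v : TangentSpace (𝓡 m) q) :
    g.inner q u v = ∑ j, (∑ i, Fr.gram g i j q * differential (Fr.fn i) q u)
      * differential (Fr.fn j) q v := by
  conv_lhs => rw [← Fr.sum_smul q u, ← Fr.sum_smul q v]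
  rw [map_sum]
  refine Finset.sum_congr rfl fun j _ => ?_
  rw [map_smul, smul_eq_mul, mul_comm, map_sum]
  congr 1
  rw [FunLike.coe_sum, Finset.sum_apply]
  refine Finset.sum_congr rfl fun i _ => ?_
  rw [map_smul, smul_apply, smul_eq_mul, mul_comm]
  rfl

end Forms

/-! ### Variations generated by smooth families of maps -/

/-- A function of two variables that is `C¹` in the first one is a `C¹` curve of continuous
functions of the second one. -/
theorem contDiff_one_curry {X : Type*} [TopologicalSpace X] [CompactSpace X] {K K' : C(ℝ × X, ℝ)}
    (h : ∀ s x, HasDerivAt (fun r => K (r, x)) (K' (s, x)) s) :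
    ContDiff ℝ 1 (fun s => K.curry s) := by
  have hc : Continuous fun s => K'.curry s := K'.curry.continuous
  have hI : ∀ s, K.curry s = K.curry 0 + ∫ r in (0 : ℝ)..s, K'.curry r := by
    intro s
    ext x
    have h1 := (ContinuousMap.evalCLM ℝ x : C(X, ℝ) →L[ℝ] ℝ).intervalIntegral_comp_comm
      (hc.intervalIntegrable (μ := volume) 0 s)
    simp only [ContinuousMap.evalCLM_apply, ContinuousMap.curry_apply] at h1
    have h2 := intervalIntegral.integral_eq_sub_of_hasDerivAt (a := 0) (b := s)
      (fun r _ => h r x) ((by fun_prop : Continuous fun r => K' (r, x)).intervalIntegrable _ _)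
    rw [ContinuousMap.add_apply, ← h1, h2]
    simp
  have hd : ∀ s, HasDerivAt (fun s => K.curry s) (K'.curry s) s := by
    intro s
    have h1 := (intervalIntegral.integral_hasDerivAt_right (hc.intervalIntegrable 0 s)
      (hc.stronglyMeasurableAtFilter _ _) hc.continuousAt).const_add (K.curry 0)
    exact h1.congr_of_eventuallyEq (.of_forall hI)
  rw [contDiff_one_iff_deriv]
  refine ⟨fun s => (hd s).differentiableAt, ?_⟩
  have : deriv (fun s => K.curry s) = fun s => K'.curry s := funext fun s => (hd s).deriv
  rwa [this]

/-- Multiplication of continuous functions with a fixed square integrable function. -/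
noncomputable def mulMemLp {v : ℝ → ℝ} (hv : MemLp v 2 unitMeasure) :
    C(Icc (0 : ℝ) 1, ℝ) →L[ℝ] UnitL2 :=
  have hc : ∀ u : C(Icc (0 : ℝ) 1, ℝ), MemLp (fun t => u (projIcc 0 1 zero_le_one t) * v t) 2
      unitMeasure := fun u =>
    MemLp.continuousOn_mul (u.continuous.comp continuous_projIcc).continuousOn hv
  LinearMap.mkContinuous
    { toFun := fun u => (hc u).toLp _
      map_add' := fun u w => by
        rw [← MemLp.toLp_add]
        congr 1
        ext t
        simp [add_mul]
      map_smul' := fun a u => by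
        rw [RingHom.id_apply, ← MemLp.toLp_const_smul]
        congr 1
        ext t
        simp [mul_assoc] } ‖hv.toLp v‖
    (fun u => by
      rw [mul_comm]
      refine Lp.norm_le_mul_norm_of_ae_le_mul ?_
      filter_upwards [(hc u).coeFn_toLp, hv.coeFn_toLp] with t h1 h2
      simp only [LinearMap.coe_mk, AddHom.coe_mk]
      rw [h1, h2, norm_mul]
      gcongr
      exact u.norm_coe_le_norm _)

theorem coeFn_mulMemLp {v : ℝ → ℝ} (hv : MemLp v 2 unitMeasure) (u : C(Icc (0 : ℝ) 1, ℝ)) :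
    mulMemLp hv u =ᵐ[unitMeasure] fun t => u (projIcc 0 1 zero_le_one t) * v t :=
  (MemLp.continuousOn_mul (u.continuous.comp continuous_projIcc).continuousOn hv).coeFn_toLp

section Vary

variable {m : ℕ} {N : Type*} [TopologicalSpace N] [T2Space N] [CompactSpace N]
  [ChartedSpace (EuclideanSpace ℝ (Fin m)) N] [IsManifold (𝓡 m) ∞ N]

/-- A smooth function of an `H¹` function and an `H¹` loop is of class `H¹`. -/
theorem H1Loop.periodicH1_comp_param (γ : H1Loop m N) {h : ℝ → ℝ} (hh : PeriodicH1 h)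
    {G : ℝ × N → ℝ} (hG : ContMDiff (𝓘(ℝ, ℝ).prod (𝓡 m)) 𝓘(ℝ, ℝ) ∞ G) :
    PeriodicH1 (fun t => G (h t, γ.toFun t)) := by
  obtain ⟨S, ⟨Fr⟩⟩ := exists_smoothFrame m N
  obtain ⟨R, hR⟩ := (isCompact_Icc (a := (0 : ℝ)) (b := 1)).exists_bound_of_continuousOn
    hh.continuousOn
  obtain ⟨C, hC⟩ := Fr.exists_lipschitz hG R
  let U : Option (S × Option (Fin m)) → ℝ → ℝ := fun o t =>
    o.elim (h t) fun k => Fr.fn k (γ.toFun t)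
  have hU : ∀ o, PeriodicH1 (U o) := by
    rintro (_ | k)
    · exact hh
    · exact γ.periodicH1 (Fr.fn k)
  refine PeriodicH1.of_dist_le hU (fun t => by simp only [hh.periodic t, γ.periodic t]) (C := C) ?_
  intro t ht s hs
  rw [Fintype.sum_option]
  exact hC _ (abs_le.1 (hR t ht)) _ (abs_le.1 (hR s hs)) _ _

/-- The loop `t ↦ Φ (h t, γ t)`. -/
noncomputable def H1Loop.vary (γ : H1Loop m N) {h : ℝ → ℝ} (hh : PeriodicH1 h) {Φ : ℝ × N → N}
    (hΦ : ContMDiff (𝓘(ℝ, ℝ).prod (𝓡 m)) (𝓡 m) ∞ Φ) : H1Loop m N where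
  toFun t := Φ (h t, γ.toFun t)
  periodic t := by simp only [hh.periodic t, γ.periodic t]
  continuous := hΦ.continuous.comp (hh.continuous.prodMk γ.continuous)
  absolutelyContinuous F :=
    (γ.periodicH1_comp_param hh (F.contMDiff.comp hΦ)).absolutelyContinuous
  memLp_deriv F := (γ.periodicH1_comp_param hh (F.contMDiff.comp hΦ)).memLp_deriv

theorem PeriodicH1.const_mul {u : ℝ → ℝ} (hu : PeriodicH1 u) (a : ℝ) :
    PeriodicH1 (fun t => a * u t) :=
  (PeriodicH1.const a).mul hu

/-- The `C¹` curve of loops `s ↦ Φ (s h, γ)`, with fixed period and phase. -/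
noncomputable def varyCurve (γ : H1Loop m N) (T : Ioi (0 : ℝ)) (φ : ℝ) {h : ℝ → ℝ}
    (hh : PeriodicH1 h) {Φ : ℝ × N → N}
    (hΦ : ContMDiff (𝓘(ℝ, ℝ).prod (𝓡 m)) (𝓡 m) ∞ Φ) (s : ℝ) : LoopSpace m N :=
  (γ.vary (hh.const_mul s) hΦ, T, φ)

/-- The functions `F(Φ (s h, γ))` form a `C¹` curve of continuous functions, hence one in `L²`; their
derivatives in time are, by the chain rule, sums of `C¹` curves of continuous functions multiplied
by the fixed square-integrable derivatives of `h` and of the loop. -/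
theorem isC1Curve_varyCurve (γ : H1Loop m N) (T : Ioi (0 : ℝ)) (φ : ℝ) {h : ℝ → ℝ}
    (hh : PeriodicH1 h) {Φ : ℝ × N → N}
    (hΦ : ContMDiff (𝓘(ℝ, ℝ).prod (𝓡 m)) (𝓡 m) ∞ Φ) :
    IsC1Curve (varyCurve γ T φ hh hΦ) := by
  obtain ⟨S, ⟨Fr⟩⟩ := exists_smoothFrame m N
  refine ⟨fun F => ?_, contDiff_const (c := (T : ℝ)), contDiff_const (c := φ)⟩
  have hcont : ∀ K : ℝ × N → ℝ, Continuous K →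
      Continuous fun p : ℝ × Icc (0 : ℝ) 1 => K (p.1 * h p.2, γ.toFun p.2) := fun K hK =>
    hK.comp ((continuous_fst.mul (hh.continuous.comp (continuous_subtype_val.comp
      continuous_snd))).prodMk (γ.continuous.comp (continuous_subtype_val.comp continuous_snd)))
  have key : ∀ (K : ℝ × N → ℝ) (hK : ContMDiff (𝓘(ℝ, ℝ).prod (𝓡 m)) 𝓘(ℝ, ℝ) ∞ K),
      ContDiff ℝ 1 (fun s => (⟨_, hcont K hK.continuous⟩ : C(ℝ × Icc (0 : ℝ) 1, ℝ)).curry s) := by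
    intro K hK
    refine contDiff_one_curry (K' := ⟨fun p : ℝ × Icc (0 : ℝ) 1 =>
      paramDeriv K (p.1 * h p.2, γ.toFun p.2) * h p.2,
      (hcont _ (contMDiff_paramDeriv hK).continuous).mul
        (hh.continuous.comp (continuous_subtype_val.comp continuous_snd))⟩) fun s t => ?_
    have h1 : HasDerivAt (fun r : ℝ => r * h t) (h t) s := by
      simpa using (hasDerivAt_id s).mul_const (h t)
    exact (hasDerivAt_paramDeriv hK (s * h t) (γ.toFun t)).comp s h1
  set G : ℝ × N → ℝ := F ∘ Φ with hGdef
  have hG : ContMDiff (𝓘(ℝ, ℝ).prod (𝓡 m)) 𝓘(ℝ, ℝ) ∞ G := F.contMDiff.comp hΦ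
  have hproj : ∀ t ∈ Ioo (0 : ℝ) 1, ((projIcc 0 1 zero_le_one t : Icc (0 : ℝ) 1) : ℝ) = t :=
    fun t ht => by rw [projIcc_of_mem _ (Ioo_subset_Icc_self ht)]
  have hfirst : ContDiff ℝ 1 fun s => mulMemLp (memLp_const (1 : ℝ))
      ((⟨_, hcont G hG.continuous⟩ : C(ℝ × Icc (0 : ℝ) 1, ℝ)).curry s) :=
    (mulMemLp _).contDiff.comp (key G hG)
  have hsecond : ContDiff ℝ 1 fun s => s • mulMemLp hh.memLp_deriv
      ((⟨_, hcont _ (contMDiff_paramDeriv hG).continuous⟩ : C(ℝ × Icc (0 : ℝ) 1, ℝ)).curry s)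
      + ∑ k, mulMemLp (γ.memLp_deriv (Fr.fn k))
        ((⟨_, hcont _ (Fr.contMDiff_alongParam k hG).continuous⟩ :
          C(ℝ × Icc (0 : ℝ) 1, ℝ)).curry s) :=
    (contDiff_id.smul ((mulMemLp _).contDiff.comp (key _ (contMDiff_paramDeriv hG)))).add
      (ContDiff.sum fun k _ => (mulMemLp _).contDiff.comp (key _ (Fr.contMDiff_alongParam k hG)))
  convert! hfirst.prodMk hsecond using 1
  ext1 s
  refine Prod.ext ?_ ?_
  · refine Lp.ext ?_
    filter_upwards [((varyCurve γ T φ hh hΦ s).1.memLp F).coeFn_toLp,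
      coeFn_mulMemLp (memLp_const (1 : ℝ)) ((⟨_, hcont G hG.continuous⟩ :
        C(ℝ × Icc (0 : ℝ) 1, ℝ)).curry s), ae_unitMeasure_mem_Ioo] with t h1 h2 ht
    refine h1.trans (Eq.trans ?_ h2.symm)
    simp only [ContinuousMap.curry_apply, ContinuousMap.coe_mk, hproj t ht, mul_one]
    rfl
  · refine Lp.ext ?_
    have hsum := Lp.coeFn_finsetSum (p := 2) (μ := unitMeasure) Finset.univ fun k =>
      mulMemLp (γ.memLp_deriv (Fr.fn k))
        ((⟨_, hcont _ (Fr.contMDiff_alongParam k hG).continuous⟩ :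
          C(ℝ × Icc (0 : ℝ) 1, ℝ)).curry s)
    filter_upwards [((varyCurve γ T φ hh hΦ s).1.memLp_deriv F).coeFn_toLp,
      Lp.coeFn_add (s • mulMemLp hh.memLp_deriv ((⟨_, hcont _
        (contMDiff_paramDeriv hG).continuous⟩ : C(ℝ × Icc (0 : ℝ) 1, ℝ)).curry s))
        (∑ k, mulMemLp (γ.memLp_deriv (Fr.fn k))
          ((⟨_, hcont _ (Fr.contMDiff_alongParam k hG).continuous⟩ :
          C(ℝ × Icc (0 : ℝ) 1, ℝ)).curry s)), hsum,
      Lp.coeFn_smul s (mulMemLp hh.memLp_deriv ((⟨_, hcont _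
        (contMDiff_paramDeriv hG).continuous⟩ : C(ℝ × Icc (0 : ℝ) 1, ℝ)).curry s)),
      coeFn_mulMemLp hh.memLp_deriv ((⟨_, hcont _ (contMDiff_paramDeriv hG).continuous⟩ :
        C(ℝ × Icc (0 : ℝ) 1, ℝ)).curry s),
      ae_all_iff.2 fun k => coeFn_mulMemLp (γ.memLp_deriv (Fr.fn k))
        ((⟨_, hcont _ (Fr.contMDiff_alongParam k hG).continuous⟩ :
          C(ℝ × Icc (0 : ℝ) 1, ℝ)).curry s),
      hh.ae_hasDerivAt, Fr.ae_mdifferentiableAt γ, ae_unitMeasure_mem_Ioo]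
      with t h1 h2 h3 h4 h5 h6 h7 h8 ht
    refine h1.trans (Eq.trans ?_ h2.symm)
    rw [Pi.add_apply, h3, h4, Pi.smul_apply, h5, Finset.sum_apply]
    simp only [h6, ContinuousMap.curry_apply, ContinuousMap.coe_mk, hproj t ht]
    have h9 := (Fr.hasDerivAt_comp_param hG (h7.const_mul s) h8).deriv
    refine h9.trans ?_
    rw [smul_eq_mul]
    ring

theorem varyCurve_zero (γ : H1Loop m N) (T : Ioi (0 : ℝ)) (φ : ℝ) {h : ℝ → ℝ}
    (hh : PeriodicH1 h) {Φ : ℝ × N → N}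
    (hΦ : ContMDiff (𝓘(ℝ, ℝ).prod (𝓡 m)) (𝓡 m) ∞ Φ) (h0 : ∀ q, Φ (0, q) = q) :
    varyCurve γ T φ hh hΦ 0 = (γ, T, φ) := by
  have : γ.vary (hh.const_mul 0) hΦ = γ := by
    cases γ
    simp only [H1Loop.vary, zero_mul, h0]
  rw [varyCurve, this]

theorem variation_varyCurve (γ : H1Loop m N) (T : Ioi (0 : ℝ)) (φ : ℝ) {h : ℝ → ℝ}
    (hh : PeriodicH1 h) {Φ : ℝ × N → N}
    (hΦ : ContMDiff (𝓘(ℝ, ℝ).prod (𝓡 m)) (𝓡 m) ∞ Φ)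
    (F : C^∞⟮𝓡 m, N; 𝓘(ℝ, ℝ), ℝ⟯) :
    variation (varyCurve γ T φ hh hΦ) F = fun t => h t * variationDeriv Φ hΦ F (γ.toFun t) := by
  ext1 t
  have h1 : HasDerivAt (fun r : ℝ => r * h t) (h t) 0 := by
    simpa using (hasDerivAt_id (0 : ℝ)).mul_const (h t)
  have h2 : HasDerivAt (fun s => F (Φ (s, γ.toFun t)))
      (variationDeriv Φ hΦ F (γ.toFun t)) (0 * h t) := by
    rw [zero_mul]
    have h3 : ContMDiff 𝓘(ℝ, ℝ) 𝓘(ℝ, ℝ) ∞ (fun s => F (Φ (s, γ.toFun t))) :=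
      F.contMDiff.comp (hΦ.comp (contMDiff_id.prodMk contMDiff_const))
    exact (h3.contDiff.differentiable (by simp) 0).hasDerivAt
  have h4 := h2.comp 0 h1
  rw [mul_comm]
  exact h4.deriv

end Vary

/-! ### Exterior derivative and covariant acceleration in a smooth frame -/

theorem two_le_infty : (2 : WithTop ℕ∞) ≤ (∞ : WithTop ℕ∞) :=
  WithTop.coe_le_coe.2 (le_top : (2 : ℕ∞) ≤ ⊤)

/-- The derivative of a family of bilinear forms `∑ aᵢⱼ αᵢ ⊗ αⱼ`. -/
theorem fderiv_sum_bilinear {V ι : Type*} [NormedAddCommGroup V] [NormedSpace ℝ V] [Fintype ι]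
    {G : V → V →L[ℝ] V →L[ℝ] ℝ} {A : ι → ι → V → ℝ} {F : ι → V → V →L[ℝ] ℝ} {y : V}
    (hG : ∀ᶠ y' in 𝓝 y, ∀ v w, G y' v w = ∑ j, (∑ i, A i j y' * F i y' v) * F j y' w)
    (hA : ∀ i j, ContDiffAt ℝ 1 (A i j) y) (hF : ∀ i, ContDiffAt ℝ 1 (F i) y) (u v w : V) :
    fderiv ℝ G y u v w = ∑ j, ((∑ i, (fderiv ℝ (A i j) y u * F i y v
      + A i j y * fderiv ℝ (F i) y u v)) * F j y w
      + (∑ i, A i j y * F i y v) * fderiv ℝ (F j) y u w) := by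
  have hd : DifferentiableAt ℝ G y := by
    have h2 : ∀ i j, ContDiffAt ℝ 1 (fun y' => (A i j y' • F i y').smulRight (F j y')) y :=
      fun i j => ((hA i j).smul (hF i)).smulRight (hF j)
    have h1 : DifferentiableAt ℝ (fun y' => ∑ j, ∑ i, (A i j y' • F i y').smulRight (F j y')) y :=
      (ContDiffAt.sum fun j _ => ContDiffAt.sum fun i _ => h2 i j).differentiableAt one_ne_zero
    refine h1.congr_of_eventuallyEq ?_
    filter_upwards [hG] with y' hy'
    ext v w
    rw [hy']
    simp [Finset.sum_mul, mul_assoc]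
  have h1 := (hd.hasFDerivAt.clm_apply (hasFDerivAt_const v y)).clm_apply (hasFDerivAt_const w y)
  have h2 : HasFDerivAt (fun y' => ∑ j, (∑ i, A i j y' * F i y' v) * F j y' w) _ y :=
    HasFDerivAt.fun_sum fun j _ => (HasFDerivAt.fun_sum fun i _ => ((hA i j).differentiableAt one_ne_zero).hasFDerivAt.mul
      (((hF i).differentiableAt one_ne_zero).hasFDerivAt.clm_apply (hasFDerivAt_const v y))).mul
      (((hF j).differentiableAt one_ne_zero).hasFDerivAt.clm_apply (hasFDerivAt_const w y))
  have h3 := congrArg (fun L => L u) (h1.unique (h2.congr_of_eventuallyEq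
    (by filter_upwards [hG] with y' hy' using hy' v w)))
  simp at h3
  rw [h3]
  refine Finset.sum_congr rfl fun j _ => ?_
  rw [add_comm, mul_comm (F j y w)]
  congr 2
  refine Finset.sum_congr rfl fun i _ => ?_
  ring

theorem sum_bilinear_comm {ι : Type*} [Fintype ι] {α : ι → ι → ℝ} (hα : ∀ i j, α i j = α j i)
    (P w : ι → ℝ) : ∑ j, (∑ i, α i j * P i) * w j = ∑ j, (∑ i, α i j * w i) * P j := by
  simp only [Finset.sum_mul]
  rw [Finset.sum_comm]
  refine Finset.sum_congr rfl fun i _ => Finset.sum_congr rfl fun j _ => ?_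
  rw [hα i j]
  ring

/-- The algebra that turns Christoffel symbols of the first kind of a metric `∑ αᵢⱼ dfᵢ dfⱼ` into
the Euler-Lagrange expression; `p`, `P`, `w` stand for values of the `dfᵢ`, `s`, `q` for values of
their second derivatives, `av`, `au` for derivatives of the `αᵢⱼ`. -/
theorem kinetic_identity {ι : Type*} [Fintype ι] {α : ι → ι → ℝ} (hα : ∀ i j, α i j = α j i)
    (av au : ι → ι → ℝ) (p P s q w : ι → ℝ) :
    (∑ j, (∑ i, α i j * P i) * w j)
      + 1 / 2 * ((∑ j, ((∑ i, (av i j * p i + α i j * s i)) * P j + (∑ i, α i j * p i) * q j))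
        + (∑ j, ((∑ i, (av i j * p i + α i j * s i)) * P j + (∑ i, α i j * p i) * q j))
        - ∑ j, ((∑ i, (au i j * p i + α i j * q i)) * p j + (∑ i, α i j * p i) * q j))
      = ∑ j, (P j * ∑ i, (av i j * p i + α i j * (s i + w i))
        - 1 / 2 * ∑ i, au i j * p i * p j) := by
  have h1 := sum_bilinear_comm hα P w
  have h2 := sum_bilinear_comm hα p q
  have h3 : ∑ j, ((∑ i, (au i j * p i + α i j * q i)) * p j + (∑ i, α i j * p i) * q j)
      = ∑ j, (∑ i, au i j * p i * p j) + 2 * ∑ j, (∑ i, α i j * p i) * q j := by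
    simp only [Finset.sum_add_distrib, add_mul, ← h2]
    simp only [Finset.sum_mul]
    ring
  have h4 : ∑ j, ((∑ i, (av i j * p i + α i j * s i)) * P j + (∑ i, α i j * p i) * q j)
      = (∑ j, (∑ i, (av i j * p i + α i j * s i)) * P j) + ∑ j, (∑ i, α i j * p i) * q j := by
    rw [Finset.sum_add_distrib]
  have h5 : ∑ j, P j * ∑ i, (av i j * p i + α i j * (s i + w i))
      = (∑ j, (∑ i, (av i j * p i + α i j * s i)) * P j) + ∑ j, (∑ i, α i j * w i) * P j := by
    rw [← Finset.sum_add_distrib]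
    refine Finset.sum_congr rfl fun j _ => ?_
    rw [← add_mul, ← Finset.sum_add_distrib, mul_comm]
    congr 1
    refine Finset.sum_congr rfl fun i _ => ?_
    ring
  rw [h1, h3, h4, Finset.sum_sub_distrib, h5, ← Finset.mul_sum]
  ring

section Local

variable {m : ℕ} {N : Type*} [TopologicalSpace N] [ChartedSpace (EuclideanSpace ℝ (Fin m)) N]
  [IsManifold (𝓡 m) ∞ N]

/-- The expression of a smooth function in the preferred chart at `x`. -/
noncomputable def inChart (F : C^∞⟮𝓡 m, N; 𝓘(ℝ, ℝ), ℝ⟯) (x : N) (y : EuclideanSpace ℝ (Fin m)) : ℝ :=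
  F ((extChartAt (𝓡 m) x).symm y)

theorem contDiffAt_inChart (F : C^∞⟮𝓡 m, N; 𝓘(ℝ, ℝ), ℝ⟯) (x : N) {y : EuclideanSpace ℝ (Fin m)}
    (hy : y ∈ (extChartAt (𝓡 m) x).target) : ContDiffAt ℝ ∞ (inChart F x) y := by
  have h1 : ContMDiffOn 𝓘(ℝ, EuclideanSpace ℝ (Fin m)) 𝓘(ℝ, ℝ) ∞ (inChart F x)
      (extChartAt (𝓡 m) x).target := F.contMDiff.comp_contMDiffOn (contMDiffOn_extChartAt_symm x)
  exact (h1.contMDiffAt ((isOpen_extChartAt_target x).mem_nhds hy)).contDiffAt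

theorem fderiv_inChart (F : C^∞⟮𝓡 m, N; 𝓘(ℝ, ℝ), ℝ⟯) (x : N) {y : EuclideanSpace ℝ (Fin m)}
    (hy : y ∈ (extChartAt (𝓡 m) x).target) (w : EuclideanSpace ℝ (Fin m)) :
    fderiv ℝ (inChart F x) y w
      = differential F ((extChartAt (𝓡 m) x).symm y) (chartInvDeriv x y w) := by
  have h1 : MDifferentiableAt 𝓘(ℝ, EuclideanSpace ℝ (Fin m)) (𝓡 m) (extChartAt (𝓡 m) x).symm y :=
    ((contMDiffOn_extChartAt_symm (n := ∞) x).contMDiffAt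
      ((isOpen_extChartAt_target x).mem_nhds hy)).mdifferentiableAt (by simp)
  set A : EuclideanSpace ℝ (Fin m) →L[ℝ] ℝ := (differential F ((extChartAt (𝓡 m) x).symm y)).comp
    (mfderiv 𝓘(ℝ, EuclideanSpace ℝ (Fin m)) (𝓡 m) (extChartAt (𝓡 m) x).symm y) with hA
  have h2 : HasMFDerivAt 𝓘(ℝ, EuclideanSpace ℝ (Fin m)) 𝓘(ℝ, ℝ) (inChart F x) y A :=
    (hasMFDerivAt_differential F ((extChartAt (𝓡 m) x).symm y)).comp y h1.hasMFDerivAt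
  have h3 : fderiv ℝ (inChart F x) y = A := HasFDerivAt.fderiv (hasMFDerivAt_iff_hasFDerivAt.1 h2)
  rw [h3]
  rfl

theorem differential_eq_fderiv_inChart (F : C^∞⟮𝓡 m, N; 𝓘(ℝ, ℝ), ℝ⟯) (x : N)
    (u : EuclideanSpace ℝ (Fin m)) :
    differential F x u = fderiv ℝ (inChart F x) (extChartAt (𝓡 m) x x) u := by
  have h := (hasMFDerivAt_differential F x).mdifferentiableAt.mfderiv
  have h2 : writtenInExtChartAt (𝓡 m) 𝓘(ℝ, ℝ) x F = inChart F x := by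
    ext1 y
    rfl
  rw [h2] at h
  simp only [ModelWithCorners.Boundaryless.range_eq_univ, fderivWithin_univ] at h
  exact congrArg (fun L => L u) h

theorem contDiffAt_fderiv_inChart (F : C^∞⟮𝓡 m, N; 𝓘(ℝ, ℝ), ℝ⟯) (x : N)
    {y : EuclideanSpace ℝ (Fin m)} (hy : y ∈ (extChartAt (𝓡 m) x).target) :
    ContDiffAt ℝ 1 (fderiv ℝ (inChart F x)) y :=
  (contDiffAt_inChart F x hy).fderiv_right (by rw [one_add_one_eq_two]; exact two_le_infty)

theorem hasFDerivAt_fderiv_inChart (F : C^∞⟮𝓡 m, N; 𝓘(ℝ, ℝ), ℝ⟯) (x : N)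
    {y : EuclideanSpace ℝ (Fin m)} (hy : y ∈ (extChartAt (𝓡 m) x).target) :
    HasFDerivAt (fderiv ℝ (inChart F x)) (fderiv ℝ (fderiv ℝ (inChart F x)) y) y :=
  ((contDiffAt_fderiv_inChart F x hy).differentiableAt one_ne_zero).hasFDerivAt

theorem fderiv_fderiv_inChart_comm (F : C^∞⟮𝓡 m, N; 𝓘(ℝ, ℝ), ℝ⟯) (x : N)
    {y : EuclideanSpace ℝ (Fin m)} (hy : y ∈ (extChartAt (𝓡 m) x).target)
    (u v : EuclideanSpace ℝ (Fin m)) :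
    fderiv ℝ (fderiv ℝ (inChart F x)) y u v = fderiv ℝ (fderiv ℝ (inChart F x)) y v u :=
  ((contDiffAt_inChart F x hy).isSymmSndFDerivAt
    (by simpa using two_le_infty)).eq u v

variable {ι : Type*} [Fintype ι]

/-- `d (∑ bᵢ dfᵢ) = ∑ dbᵢ ∧ dfᵢ`. -/
theorem OneForm.d_eq_sum (θ : OneForm m N) (b f : ι → C^∞⟮𝓡 m, N; 𝓘(ℝ, ℝ), ℝ⟯)
    (h : ∀ (q : N) (v : TangentSpace (𝓡 m) q), θ.form q v = ∑ i, b i q * differential (f i) q v)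
    (x : N) (u v : TangentSpace (𝓡 m) x) :
    θ.d x u v = ∑ i, (differential (b i) x u * differential (f i) x v
      - differential (b i) x v * differential (f i) x u) := by
  set y₀ := extChartAt (𝓡 m) x x with hy₀
  have hy : y₀ ∈ (extChartAt (𝓡 m) x).target := mem_extChartAt_target x
  have h1 : θ.local x =ᶠ[𝓝 y₀] fun y => ∑ i, inChart (b i) x y • fderiv ℝ (inChart (f i) x) y := by
    filter_upwards [(isOpen_extChartAt_target x).mem_nhds hy] with y hy'
    ext1 w
    rw [FunLike.coe_sum, Finset.sum_apply]
    refine (h _ _).trans (Finset.sum_congr rfl fun i _ => ?_)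
    exact congrArg (inChart (b i) x y * ·) (fderiv_inChart (f i) x hy' w).symm
  have h2 : HasFDerivAt (fun y => ∑ i, inChart (b i) x y • fderiv ℝ (inChart (f i) x) y)
      (∑ i, (inChart (b i) x y₀ • fderiv ℝ (fderiv ℝ (inChart (f i) x)) y₀
        + (fderiv ℝ (inChart (b i) x) y₀).smulRight (fderiv ℝ (inChart (f i) x) y₀))) y₀ :=
    HasFDerivAt.fun_sum fun i _ =>
      ((contDiffAt_inChart (b i) x hy).differentiableAt (by simp)).hasFDerivAt.smul
        (hasFDerivAt_fderiv_inChart (f i) x hy)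
  have h3 := (h2.congr_of_eventuallyEq h1).fderiv
  have h4 : ∀ u v : EuclideanSpace ℝ (Fin m), fderiv ℝ (θ.local x) y₀ u v
      = ∑ i, (inChart (b i) x y₀ * fderiv ℝ (fderiv ℝ (inChart (f i) x)) y₀ u v
        + fderiv ℝ (inChart (b i) x) y₀ u * fderiv ℝ (inChart (f i) x) y₀ v) := by
    intro u v
    rw [h3]
    simp
  refine (congrArg₂ (· - ·) (h4 u v) (h4 v u)).trans ?_
  rw [← Finset.sum_sub_distrib]
  refine Finset.sum_congr rfl fun i _ => ?_
  have e1 := fderiv_fderiv_inChart_comm (f i) x hy u v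
  have e2 := fun (F : C^∞⟮𝓡 m, N; 𝓘(ℝ, ℝ), ℝ⟯) w => differential_eq_fderiv_inChart F x w
  have e3 := e2 (b i) u
  have e4 := e2 (b i) v
  have e5 := e2 (f i) u
  have e6 := e2 (f i) v
  rw [e1]
  refine Eq.trans ?_ (congrArg₂ (· - ·) (congrArg₂ (· * ·) e3.symm e6.symm)
    (congrArg₂ (· * ·) e4.symm e5.symm))
  ring

/-- The velocity of a curve, in the preferred chart at its current position. -/
theorem hasDerivAt_extChartAt_curve {c : ℝ → N} {t : ℝ}
    (hc : MDifferentiableAt 𝓘(ℝ, ℝ) (𝓡 m) c t) :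
    HasDerivAt (fun s => extChartAt (𝓡 m) (c t) (c s))
      (velocity (n := m) c t : EuclideanSpace ℝ (Fin m)) t := by
  set A : ℝ →L[ℝ] EuclideanSpace ℝ (Fin m) := mfderiv 𝓘(ℝ, ℝ) (𝓡 m) c t with hA
  have h : HasFDerivWithinAt (writtenInExtChartAt 𝓘(ℝ, ℝ) (𝓡 m) t c) A (range 𝓘(ℝ, ℝ)) t :=
    hc.hasMFDerivAt.2
  have h1 : HasFDerivAt (writtenInExtChartAt 𝓘(ℝ, ℝ) (𝓡 m) t c) A t := by
    rw [ModelWithCorners.Boundaryless.range_eq_univ] at h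
    exact hasFDerivWithinAt_univ.1 h
  exact h1.hasDerivAt

/-- The covariant acceleration is the Euler-Lagrange expression of the kinetic energy. -/
theorem SmoothFrame.inner_covariantAcceleration (Fr : SmoothFrame m N ι) (g : Metric m N)
    {c : ℝ → N} {t : ℝ} (hc : ContMDiffAt 𝓘(ℝ, ℝ) (𝓡 m) 2 c t) (u : TangentSpace (𝓡 m) (c t)) :
    g.inner (c t) u (covariantAcceleration g c t)
      = ∑ j, (differential (Fr.fn j) (c t) u
          * deriv (fun s => ∑ i, Fr.gram g i j (c s) * deriv (fun r => Fr.fn i (c r)) s) t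
        - 1 / 2 * ∑ i, differential (Fr.gram g i j) (c t) u * deriv (fun r => Fr.fn i (c r)) t
          * deriv (fun r => Fr.fn j (c r)) t) := by
  have hN2 : IsManifold (𝓡 m) 2 N := IsManifold.of_le (n := ∞) two_le_infty
  revert u
  set x := c t with hx
  intro u
  set y₀ := extChartAt (𝓡 m) x x with hy₀
  have hy : y₀ ∈ (extChartAt (𝓡 m) x).target := mem_extChartAt_target x
  set z : ℝ → EuclideanSpace ℝ (Fin m) := fun s => extChartAt (𝓡 m) x (c s) with hz
  set v : EuclideanSpace ℝ (Fin m) := velocity (n := m) c t with hv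
  have hzC : ContDiffAt ℝ 2 z t := by
    have h1 : ContMDiffAt (𝓡 m) 𝓘(ℝ, EuclideanSpace ℝ (Fin m)) 2 (extChartAt (𝓡 m) x) (c t) :=
      contMDiffAt_extChartAt
    exact (h1.comp t hc).contDiffAt
  have hz' : ∀ᶠ s in 𝓝 t, HasDerivAt z (deriv z s) s := by
    filter_upwards [hzC.eventually (by simp)] with s hs
    exact (hs.differentiableAt (by simp)).hasDerivAt
  have hv' : deriv z t = v := (hasDerivAt_extChartAt_curve (hc.mdifferentiableAt (by simp))).deriv
  have hz'' : HasDerivAt (deriv z) (deriv (deriv z) t) t := by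
    have h1 : ContDiffAt ℝ 1 (fderiv ℝ z) t := hzC.fderiv_right (m := 1) (by norm_num)
    have h2 : DifferentiableAt ℝ (fun s => fderiv ℝ z s 1) t :=
      (h1.differentiableAt (by simp)).clm_apply (differentiableAt_const _)
    exact h2.hasDerivAt
  have hsrc : ∀ᶠ s in 𝓝 t, c s ∈ (extChartAt (𝓡 m) x).source :=
    hc.continuousAt.eventually (extChartAt_source_mem_nhds x)
  have hzt : ∀ᶠ s in 𝓝 t, z s ∈ (extChartAt (𝓡 m) x).target := by
    filter_upwards [hsrc] with s hs using (extChartAt (𝓡 m) x).map_source hs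
  have hFz : ∀ F : C^∞⟮𝓡 m, N; 𝓘(ℝ, ℝ), ℝ⟯, ∀ᶠ s in 𝓝 t, F (c s) = inChart F x (z s) := by
    intro F
    filter_upwards [hsrc] with s hs
    rw [inChart, hz, (extChartAt (𝓡 m) x).left_inv hs]
  have hFd : ∀ F : C^∞⟮𝓡 m, N; 𝓘(ℝ, ℝ), ℝ⟯, ∀ᶠ s in 𝓝 t,
      HasDerivAt (fun r => F (c r)) (fderiv ℝ (inChart F x) (z s) (deriv z s)) s := by
    intro F
    filter_upwards [(hFz F).eventually_nhds, hz', hzt] with s h1 h2 h3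
    have h4 := ((contDiffAt_inChart F x h3).differentiableAt (by simp)).hasFDerivAt
      |>.comp_hasDerivAt s h2
    exact h4.congr_of_eventuallyEq h1
  have hmom : ∀ i j, HasDerivAt (fun s => Fr.gram g i j (c s) * deriv (fun r => Fr.fn i (c r)) s)
      (fderiv ℝ (inChart (Fr.gram g i j) x) y₀ v * fderiv ℝ (inChart (Fr.fn i) x) y₀ v
        + inChart (Fr.gram g i j) x y₀ * (fderiv ℝ (fderiv ℝ (inChart (Fr.fn i) x)) y₀ v v
          + fderiv ℝ (inChart (Fr.fn i) x) y₀ (deriv (deriv z) t))) t := by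
    intro i j
    have h1 := (hFd (Fr.gram g i j)).self_of_nhds
    have h2 : HasDerivAt (fun s => fderiv ℝ (inChart (Fr.fn i) x) (z s) (deriv z s))
        (fderiv ℝ (fderiv ℝ (inChart (Fr.fn i) x)) y₀ v v
          + fderiv ℝ (inChart (Fr.fn i) x) y₀ (deriv (deriv z) t)) t := by
      have h3 := (hasFDerivAt_fderiv_inChart (Fr.fn i) x hy).comp_hasDerivAt t hz'.self_of_nhds
      have h4 := h3.clm_apply hz''
      rw [hv'] at h4
      exact h4
    have h5 := h1.mul h2
    rw [hv'] at h5
    refine (h5.congr_of_eventuallyEq ?_).congr_deriv ?_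
    · filter_upwards [hFd (Fr.fn i)] with s hs
      rw [hs.deriv]
      rfl
    · rw [(hFz (Fr.gram g i j)).self_of_nhds]
  have hsum : ∀ j, deriv (fun s => ∑ i, Fr.gram g i j (c s) * deriv (fun r => Fr.fn i (c r)) s) t
      = ∑ i, (fderiv ℝ (inChart (Fr.gram g i j) x) y₀ v * fderiv ℝ (inChart (Fr.fn i) x) y₀ v
        + inChart (Fr.gram g i j) x y₀ * (fderiv ℝ (fderiv ℝ (inChart (Fr.fn i) x)) y₀ v v
          + fderiv ℝ (inChart (Fr.fn i) x) y₀ (deriv (deriv z) t))) := fun j =>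
    (HasDerivAt.fun_sum fun i _ => hmom i j).deriv
  have hfd : ∀ i, deriv (fun r => Fr.fn i (c r)) t = fderiv ℝ (inChart (Fr.fn i) x) y₀ v := by
    intro i
    rw [(hFd (Fr.fn i)).self_of_nhds.deriv, hv']
  have hG : ∀ᶠ y in 𝓝 y₀, ∀ v w : EuclideanSpace ℝ (Fin m), localMetric g x y v w
      = ∑ j, (∑ i, inChart (Fr.gram g i j) x y * fderiv ℝ (inChart (Fr.fn i) x) y v)
        * fderiv ℝ (inChart (Fr.fn j) x) y w := by
    filter_upwards [(isOpen_extChartAt_target x).mem_nhds hy] with y hy' v w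
    refine (Fr.inner_eq_sum g _ (chartInvDeriv x y v) (chartInvDeriv x y w)).trans ?_
    simp only [← fderiv_inChart _ x hy']
    rfl
  have hD := fderiv_sum_bilinear hG (fun i j =>
    (contDiffAt_inChart (Fr.gram g i j) x hy).of_le (by simp))
    (fun i => contDiffAt_fderiv_inChart (Fr.fn i) x hy)
  have hu : ∀ F : C^∞⟮𝓡 m, N; 𝓘(ℝ, ℝ), ℝ⟯, ∀ w : EuclideanSpace ℝ (Fin m),
      (differential F x : EuclideanSpace ℝ (Fin m) →L[ℝ] ℝ) w = fderiv ℝ (inChart F x) y₀ w :=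
    fun F w => differential_eq_fderiv_inChart F x w
  have hgram : ∀ i j, inChart (Fr.gram g i j) x y₀ = Fr.gram g i j x := fun i j =>
    ((hFz (Fr.gram g i j)).self_of_nhds).symm
  set w : EuclideanSpace ℝ (Fin m) := u with hw
  set a : EuclideanSpace ℝ (Fin m) := deriv (deriv z) t with ha
  have h1 : g.inner x u (covariantAcceleration g c t)
      = (∑ j, (∑ i, Fr.gram g i j x * fderiv ℝ (inChart (Fr.fn i) x) y₀ w)
        * fderiv ℝ (inChart (Fr.fn j) x) y₀ a)
        + 1 / 2 * (fderiv ℝ (localMetric g x) y₀ v v w + fderiv ℝ (localMetric g x) y₀ v v w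
          - fderiv ℝ (localMetric g x) y₀ w v v) := by
    refine ((g.inner x u).map_add _ _).trans (congrArg₂ (· + ·) ?_ ?_)
    · refine (Fr.inner_eq_sum g x u _).trans ?_
      refine Finset.sum_congr rfl fun j _ => congrArg₂ (· * ·)
        (Finset.sum_congr rfl fun i _ => congrArg _ (hu _ _)) (hu _ _)
    · exact inner_sharp g x _ u
  refine h1.trans ?_
  rw [hD, hD]
  simp only [hsum, hfd, hgram]
  have hcomm := fun i => fderiv_fderiv_inChart_comm (Fr.fn i) x hy v w
  simp only [hcomm]
  refine (kinetic_identity (α := fun i j => Fr.gram g i j x) (fun i j => by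
    rw [Fr.gram_symm]) _ _ _ _ _ _ _).trans ?_
  refine Finset.sum_congr rfl fun j _ => congrArg₂ (· - ·)
    (congrArg₂ (· * ·) (hu _ _).symm rfl) (congrArg _ (Finset.sum_congr rfl fun i _ =>
      congrArg₂ (· * ·) (congrArg₂ (· * ·) (hu _ _).symm rfl) rfl))

end Local

/-! ### The action functional in smooth frames of the base and of the total space -/

section Curves

variable {m : ℕ} {N : Type*} [TopologicalSpace N] [ChartedSpace (EuclideanSpace ℝ (Fin m)) N]
  [IsManifold (𝓡 m) ∞ N] {ι : Type*} [Fintype ι]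

/-- The functions of a frame embed a compact manifold topologically. -/
theorem SmoothFrame.continuousAt_curve [T2Space N] [CompactSpace N] (Fr : SmoothFrame m N ι)
    {c : ℝ → N} {t : ℝ} (h : ∀ k, ContinuousAt (fun s => Fr.fn k (c s)) t) : ContinuousAt c t := by
  have h1 : Continuous fun q => fun k => Fr.fn k q :=
    continuous_pi fun k => (Fr.fn k).contMDiff.continuous
  have h2 : IsClosedEmbedding fun q => fun k => Fr.fn k q :=
    h1.isClosedEmbedding fun q q' hqq => Fr.injective q q' fun k => congrFun hqq k
  rw [h2.isInducing.continuousAt_iff]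
  exact continuousAt_pi.2 h

theorem hasDerivAt_comp_velocity (F : C^∞⟮𝓡 m, N; 𝓘(ℝ, ℝ), ℝ⟯) {c : ℝ → N} {t : ℝ}
    (hc : MDifferentiableAt 𝓘(ℝ, ℝ) (𝓡 m) c t) :
    HasDerivAt (fun s => F (c s)) (differential F (c t) (velocity c t)) t :=
  hasDerivAt_comp_curve F hc

/-- A `C¹` curve of loops has a velocity vector at every time. -/
theorem IsC1Curve.exists_vector [T2Space N] [CompactSpace N] {c : ℝ → LoopSpace m N}
    (hc : IsC1Curve c) {t : ℝ} (ht : t ∈ Icc (0 : ℝ) 1) :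
    ∃ V : TangentSpace (𝓡 m) ((c 0).1.toFun t), ∀ F : C^∞⟮𝓡 m, N; 𝓘(ℝ, ℝ), ℝ⟯,
      variation c F t = differential F _ V := by
  obtain ⟨S, ⟨Fr⟩⟩ := exists_smoothFrame m N
  have h1 : ContinuousAt (fun s => (c s).1.toFun t) 0 := Fr.continuousAt_curve fun k =>
    (hc.hasDerivAt_eval (Fr.fn k) ht).continuousAt
  have h2 : MDifferentiableAt 𝓘(ℝ, ℝ) (𝓡 m) (fun s => (c s).1.toFun t) 0 :=
    Fr.mdifferentiableAt_curve h1 fun k => (hc.hasDerivAt_eval (Fr.fn k) ht).differentiableAt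
  exact ⟨velocity (fun s => (c s).1.toFun t) 0, fun F =>
    (hc.hasDerivAt_eval F ht).unique (hasDerivAt_comp_velocity F h2)⟩

/-- Cartan's formula along a curve: the variation of `∑ bᵢ dfᵢ` is the derivative of its value on
the variation plus its exterior derivative. -/
theorem linVariation_eq (θ : OneForm m N) (b f : ι → C^∞⟮𝓡 m, N; 𝓘(ℝ, ℝ), ℝ⟯)
    (h : ∀ (q : N) (v : TangentSpace (𝓡 m) q), θ.form q v = ∑ i, b i q * differential (f i) q v)
    {c : ℝ → N} {t : ℝ} (hc : MDifferentiableAt 𝓘(ℝ, ℝ) (𝓡 m) c t)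
    {D : C^∞⟮𝓡 m, N; 𝓘(ℝ, ℝ), ℝ⟯ → ℝ → ℝ} (hD : ∀ i, DifferentiableAt ℝ (D (f i)) t)
    {V : TangentSpace (𝓡 m) (c t)}
    (hV : ∀ F : C^∞⟮𝓡 m, N; 𝓘(ℝ, ℝ), ℝ⟯, D F t = differential F (c t) V) :
    linVariation b f c D t = deriv (fun s => ∑ i, b i (c s) * D (f i) s) t
      + θ.d (c t) V (velocity c t) := by
  have h1 : HasDerivAt (fun s => ∑ i, b i (c s) * D (f i) s)
      (∑ i, (differential (b i) (c t) (velocity c t) * D (f i) t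
        + b i (c t) * deriv (D (f i)) t)) t :=
    HasDerivAt.fun_sum fun i _ => (hasDerivAt_comp_velocity (b i) hc).mul (hD i).hasDerivAt
  rw [h1.deriv, θ.d_eq_sum b f h, linVariation, ← Finset.sum_add_distrib]
  refine Finset.sum_congr rfl fun i _ => ?_
  rw [hV, hV, (hasDerivAt_comp_velocity (f i) hc).deriv]
  ring

end Curves

section Total

variable {n : ℕ} {M : Type*} [TopologicalSpace M] [T2Space M] [CompactSpace M]
  [ChartedSpace (EuclideanSpace ℝ (Fin n)) M] [IsManifold (𝓡 n) ∞ M]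
  {E : Type*} [TopologicalSpace E] [T2Space E]
  [ChartedSpace (EuclideanSpace ℝ (Fin (n + 1))) E] [IsManifold (𝓡 (n + 1)) ∞ E]
  [MulAction Circle E] {τ : E → M}

namespace IsPrincipalCircleBundle

/-- The total space of a circle bundle over a compact manifold is compact. -/
theorem compactSpace (hτ : IsPrincipalCircleBundle n τ) : CompactSpace E := by
  choose e he _ _ _ using hτ.exists_trivialization
  have : LocallyCompactSpace M := inferInstance
  have h1 : ∀ x : M, ∃ K : Set M, K ∈ 𝓝 x ∧ K ⊆ (e x).baseSet ∧ IsCompact K := fun x =>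
    local_compact_nhds ((e x).open_baseSet.mem_nhds (he x))
  choose K hK hKb hKc using h1
  obtain ⟨s, _, hs⟩ := (isCompact_univ (X := M)).elim_nhds_subcover K fun x _ => hK x
  have h2 : ∀ x, IsCompact ((e x).toOpenPartialHomeomorph.symm '' (K x ×ˢ univ)) := fun x => by
    refine ((hKc x).prod isCompact_univ).image_of_continuousOn ?_
    refine (e x).toOpenPartialHomeomorph.continuousOn_symm.mono ?_
    rw [(e x).target_eq]
    exact prod_mono_left (hKb x)
  refine ⟨?_⟩
  have h3 : (univ : Set E) = ⋃ x ∈ s, (e x).toOpenPartialHomeomorph.symm '' (K x ×ˢ univ) := by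
    refine (eq_univ_of_forall fun q => ?_).symm
    obtain ⟨x, hx, hq⟩ := mem_iUnion₂.1 (hs (mem_univ (τ q)))
    have hq' : q ∈ (e x).source := (e x).mem_source.2 (hKb x hq)
    refine mem_iUnion₂.2 ⟨x, hx, (e x) q, ⟨?_, mem_univ _⟩, (e x).left_inv hq'⟩
    rwa [(e x).coe_fst hq']
  rw [h3]
  exact s.isCompact_biUnion fun x _ => h2 x

/-- The pullback of a smooth function on the base to the total space. -/
noncomputable def pull (hτ : IsPrincipalCircleBundle n τ) (F : C^∞⟮𝓡 n, M; 𝓘(ℝ, ℝ), ℝ⟯) :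
    C^∞⟮𝓡 (n + 1), E; 𝓘(ℝ, ℝ), ℝ⟯ :=
  ⟨F ∘ τ, F.contMDiff.comp hτ.contMDiff_proj⟩

theorem pull_apply (hτ : IsPrincipalCircleBundle n τ) (F : C^∞⟮𝓡 n, M; 𝓘(ℝ, ℝ), ℝ⟯) (q : E) :
    hτ.pull F q = F (τ q) := rfl

theorem mdifferentiableAt_proj (hτ : IsPrincipalCircleBundle n τ) (q : E) :
    MDifferentiableAt (𝓡 (n + 1)) (𝓡 n) τ q :=
  hτ.contMDiff_proj.mdifferentiableAt (by simp)

theorem differential_pull (hτ : IsPrincipalCircleBundle n τ) (F : C^∞⟮𝓡 n, M; 𝓘(ℝ, ℝ), ℝ⟯) (q : E)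
    (v : TangentSpace (𝓡 (n + 1)) q) :
    differential (hτ.pull F) q v = differential F (τ q) (mfderiv (𝓡 (n + 1)) (𝓡 n) τ q v) := by
  have h := (hasMFDerivAt_differential F (τ q)).comp q (hτ.mdifferentiableAt_proj q).hasMFDerivAt
  exact congrArg (fun L => L v) h.mfderiv

/-- The flow `(t, q) ↦ e^{it} q` of the fundamental vector field. -/
noncomputable def rotate (p : ℝ × E) : E := Circle.exp p.1 • p.2

theorem contMDiff_rotate (hτ : IsPrincipalCircleBundle n τ) :
    ContMDiff (𝓘(ℝ, ℝ).prod (𝓡 (n + 1))) (𝓡 (n + 1)) ∞ (rotate (E := E)) :=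
  hτ.contMDiff_smul.comp ((contMDiff_circleExp.comp contMDiff_fst).prodMk contMDiff_snd)

theorem rotate_zero (q : E) : rotate (0, q) = q := by simp [rotate]

theorem differential_pull_fundamentalField (hτ : IsPrincipalCircleBundle n τ)
    (F : C^∞⟮𝓡 n, M; 𝓘(ℝ, ℝ), ℝ⟯) (q : E) :
    differential (hτ.pull F) q (fundamentalField n q) = 0 := by
  have h1 := hasDerivAt_variationField hτ.contMDiff_rotate (rotate_zero q) (hτ.pull F)
  have h2 : (fun s => hτ.pull F (rotate (s, q))) = fun _ => F (τ q) := by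
    ext1 s
    rw [pull_apply, rotate, hτ.proj_smul]
  rw [h2] at h1
  exact h1.unique (hasDerivAt_const _ _)

theorem mfderiv_proj_fundamentalField (hτ : IsPrincipalCircleBundle n τ) (q : E) :
    mfderiv (𝓡 (n + 1)) (𝓡 n) τ q (fundamentalField n q) = 0 := by
  obtain ⟨S, ⟨Fr⟩⟩ := exists_smoothFrame n M
  rw [← Fr.sum_smul _ (mfderiv (𝓡 (n + 1)) (𝓡 n) τ q (fundamentalField n q))]
  refine Finset.sum_eq_zero fun k _ => ?_
  rw [← hτ.differential_pull, hτ.differential_pull_fundamentalField, zero_smul]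

theorem mdifferentiableAt_proj_comp (hτ : IsPrincipalCircleBundle n τ) {c : ℝ → E} {t : ℝ}
    (hc : MDifferentiableAt 𝓘(ℝ, ℝ) (𝓡 (n + 1)) c t) :
    MDifferentiableAt 𝓘(ℝ, ℝ) (𝓡 n) (fun s => τ (c s)) t :=
  (hτ.mdifferentiableAt_proj (c t)).comp t hc

theorem velocity_proj (hτ : IsPrincipalCircleBundle n τ) {c : ℝ → E} {t : ℝ}
    (hc : MDifferentiableAt 𝓘(ℝ, ℝ) (𝓡 (n + 1)) c t) :
    velocity (fun s => τ (c s)) t = mfderiv (𝓡 (n + 1)) (𝓡 n) τ (c t) (velocity c t) := by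
  have h := (hτ.mdifferentiableAt_proj (c t)).hasMFDerivAt.comp t hc.hasMFDerivAt
  exact congrArg (fun L => L (1 : ℝ)) h.mfderiv

variable {ι κ : Type*} [Fintype ι] [Fintype κ]

/-- The action functional in terms of frames of the base and of the total space. -/
theorem actionFunctional_eq (hτ : IsPrincipalCircleBundle n τ) (FM : SmoothFrame n M ι)
    (FE : SmoothFrame (n + 1) E κ) (g : Metric n M) (θ : OneForm (n + 1) E)
    (hθ : IsConnectionForm θ) (k : ℝ) (p : LoopSpace (n + 1) E) :
    actionFunctional g τ θ k p = 1 / (2 * (p.2.1 : ℝ)) *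
        ((∫ t in (0 : ℝ)..1, quadDensity (fun i j => hτ.pull (FM.gram g i j))
            (fun i => hτ.pull (FM.fn i)) p.1.toFun t)
          + ∫ t in (0 : ℝ)..1, (linDensity (FE.coeff θ) FE.fn p.1.toFun t + p.2.2) ^ 2)
        - p.2.2 + k * (p.2.1 : ℝ) := by
  have h1 : IntervalIntegrable (fun t => (linDensity (FE.coeff θ) FE.fn p.1.toFun t + p.2.2) ^ 2)
      volume 0 1 := by
    have h2 := (p.1.memLp_linDensity (FE.coeff θ) FE.fn).add (memLp_const p.2.2)
    simp only [sq]
    exact MemLp.intervalIntegrable_mul h2 h2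
  rw [← intervalIntegral.integral_add (p.1.intervalIntegrable_quadDensity _ _) h1]
  unfold actionFunctional
  refine congrArg (fun I => 1 / (2 * (p.2.1 : ℝ)) * I - p.2.2 + k * (p.2.1 : ℝ)) ?_
  refine intervalIntegral.integral_congr_ae_restrict ?_
  rw [uIoc_of_le zero_le_one]
  filter_upwards [FE.ae_mdifferentiableAt p.1] with t ht
  have e1 : mfderiv (𝓡 (n + 1)) (𝓡 n) τ (p.1.toFun t)
      (velocity p.1.toFun t + p.2.2 • fundamentalField n (p.1.toFun t))
      = velocity (fun s => τ (p.1.toFun s)) t := by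
    rw [map_add, map_smul, hτ.mfderiv_proj_fundamentalField, smul_zero, add_zero,
      hτ.velocity_proj ht]
  have e2 : θ.form (p.1.toFun t) (velocity p.1.toFun t + p.2.2 • fundamentalField n (p.1.toFun t))
      = linDensity (FE.coeff θ) FE.fn p.1.toFun t + p.2.2 := by
    rw [map_add, map_smul, hθ.normalized, FE.form_eq_sum, smul_eq_mul, mul_one, linDensity]
    congr 1
    refine Finset.sum_congr rfl fun i _ => ?_
    rw [(hasDerivAt_comp_velocity (FE.fn i) ht).deriv]
  unfold liftedInner
  rw [e1, e2, FM.inner_eq_sum, ← sq]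
  congr 1
  have e3 : ∀ i, deriv (fun s => hτ.pull (FM.fn i) (p.1.toFun s)) t
      = differential (FM.fn i) _ (velocity (fun s => τ (p.1.toFun s)) t) := fun i =>
    (hasDerivAt_comp_velocity (FM.fn i) (hτ.mdifferentiableAt_proj_comp ht)).deriv
  simp only [quadDensity, e3]
  rfl

end IsPrincipalCircleBundle

end Total

/-! ### Euler-Lagrange equations in integrated form -/

section EulerLagrange

variable {m : ℕ} {N : Type*} [TopologicalSpace N] [ChartedSpace (EuclideanSpace ℝ (Fin m)) N]
  {ι κ : Type*} [Fintype ι] [Fintype κ]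

/-- The momentum of the Lagrangian `½ ∑ aᵢⱼ dpᵢ dpⱼ` in the direction of a derivation `X`. -/
noncomputable def momentum (a : ι → ι → C^∞⟮𝓡 m, N; 𝓘(ℝ, ℝ), ℝ⟯)
    (p : ι → C^∞⟮𝓡 m, N; 𝓘(ℝ, ℝ), ℝ⟯)
    (X : C^∞⟮𝓡 m, N; 𝓘(ℝ, ℝ), ℝ⟯ → C^∞⟮𝓡 m, N; 𝓘(ℝ, ℝ), ℝ⟯) (γ : ℝ → N) (t : ℝ) : ℝ :=
  ∑ j, ∑ i, a i j (γ t) * X (p i) (γ t) * deriv (fun r => p j (γ r)) t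

/-- The derivative of the Lagrangian `½ ∑ aᵢⱼ dpᵢ dpⱼ` along the flow of a derivation `X`. -/
noncomputable def kineticForce (a : ι → ι → C^∞⟮𝓡 m, N; 𝓘(ℝ, ℝ), ℝ⟯)
    (p : ι → C^∞⟮𝓡 m, N; 𝓘(ℝ, ℝ), ℝ⟯)
    (X : C^∞⟮𝓡 m, N; 𝓘(ℝ, ℝ), ℝ⟯ → C^∞⟮𝓡 m, N; 𝓘(ℝ, ℝ), ℝ⟯) (γ : ℝ → N) (t : ℝ) : ℝ :=
  ∑ j, ∑ i, (1 / 2 * X (a i j) (γ t) * deriv (fun r => p i (γ r)) t * deriv (fun r => p j (γ r)) t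
    + a i j (γ t) * deriv (fun r => X (p i) (γ r)) t * deriv (fun r => p j (γ r)) t)

/-- The value of `d (∑ bᵢ dfᵢ)` on a derivation `X` and the velocity of a curve. -/
noncomputable def magneticForce (b f : κ → C^∞⟮𝓡 m, N; 𝓘(ℝ, ℝ), ℝ⟯)
    (X : C^∞⟮𝓡 m, N; 𝓘(ℝ, ℝ), ℝ⟯ → C^∞⟮𝓡 m, N; 𝓘(ℝ, ℝ), ℝ⟯) (γ : ℝ → N) (t : ℝ) : ℝ :=
  ∑ i, (X (b i) (γ t) * deriv (fun r => f i (γ r)) t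
    - deriv (fun r => b i (γ r)) t * X (f i) (γ t))

variable {X : C^∞⟮𝓡 m, N; 𝓘(ℝ, ℝ), ℝ⟯ → C^∞⟮𝓡 m, N; 𝓘(ℝ, ℝ), ℝ⟯}
  {a : ι → ι → C^∞⟮𝓡 m, N; 𝓘(ℝ, ℝ), ℝ⟯} {p : ι → C^∞⟮𝓡 m, N; 𝓘(ℝ, ℝ), ℝ⟯}
  {b f : κ → C^∞⟮𝓡 m, N; 𝓘(ℝ, ℝ), ℝ⟯}

/-- The first variation of the kinetic energy in the direction of `η X`. -/
theorem quadVariation_mul {γ : ℝ → N} {η : ℝ → ℝ} {t : ℝ} (hη : DifferentiableAt ℝ η t)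
    (hp : ∀ i, DifferentiableAt ℝ (fun r => X (p i) (γ r)) t) :
    quadVariation a p γ (fun F t => η t * X F (γ t)) t
      = deriv η t * momentum a p X γ t + η t * kineticForce a p X γ t := by
  have h : ∀ i, deriv (fun t => η t * X (p i) (γ t)) t
      = deriv η t * X (p i) (γ t) + η t * deriv (fun r => X (p i) (γ r)) t := fun i =>
    (hη.hasDerivAt.mul (hp i).hasDerivAt).deriv
  simp only [quadVariation, momentum, kineticForce, h, Finset.mul_sum, ← Finset.sum_add_distrib]
  refine Finset.sum_congr rfl fun j _ => Finset.sum_congr rfl fun i _ => ?_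
  ring

/-- Cartan's formula for a variation in the direction of `η X`. -/
theorem linVariation_mul {γ : ℝ → N} {η : ℝ → ℝ} {t : ℝ} (hη : DifferentiableAt ℝ η t)
    (hb : ∀ i, DifferentiableAt ℝ (fun r => b i (γ r)) t)
    (hf : ∀ i, DifferentiableAt ℝ (fun r => X (f i) (γ r)) t) :
    linVariation b f γ (fun F t => η t * X F (γ t)) t
      = deriv (fun s => η s * ∑ i, b i (γ s) * X (f i) (γ s)) t
        + η t * magneticForce b f X γ t := by
  have h : ∀ i, deriv (fun t => η t * X (f i) (γ t)) t
      = deriv η t * X (f i) (γ t) + η t * deriv (fun r => X (f i) (γ r)) t := fun i =>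
    (hη.hasDerivAt.mul (hf i).hasDerivAt).deriv
  have h2 := (hη.hasDerivAt.mul (HasDerivAt.fun_sum (u := Finset.univ)
    fun i _ => (hb i).hasDerivAt.mul (hf i).hasDerivAt)).deriv
  refine Eq.trans ?_ (congrArg (· + η t * magneticForce b f X γ t) h2.symm)
  simp only [linVariation, magneticForce, h, Finset.mul_sum, ← Finset.sum_add_distrib]
  refine Finset.sum_congr rfl fun i _ => ?_
  simp only [Pi.mul_apply]
  ring

theorem H1Loop.memLp_momentum (γ : H1Loop m N) : MemLp (momentum a p X γ.toFun) 2 unitMeasure :=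
  memLp_finsetSum _ fun j _ => memLp_finsetSum _ fun i _ =>
    MemLp.continuousOn_mul ((γ.periodicH1 (a i j)).continuousOn.mul
      (γ.periodicH1 (X (p i))).continuousOn) (γ.memLp_deriv (p j))

theorem intervalIntegrable_sum {s : Finset ι} {u : ι → ℝ → ℝ}
    (h : ∀ i, IntervalIntegrable (u i) volume 0 1) :
    IntervalIntegrable (fun t => ∑ i ∈ s, u i t) volume 0 1 := by
  have := IntervalIntegrable.sum (μ := volume) (a := 0) (b := 1) s fun i _ => h i
  convert! this using 1
  ext t
  simp

theorem H1Loop.intervalIntegrable_kineticForce (γ : H1Loop m N) :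
    IntervalIntegrable (kineticForce a p X γ.toFun) volume 0 1 := by
  refine intervalIntegrable_sum fun j => intervalIntegrable_sum fun i => ?_
  refine IntervalIntegrable.add ?_ ?_
  · exact MemLp.intervalIntegrable_mul (MemLp.continuousOn_mul
      (continuousOn_const.mul (γ.periodicH1 (X (a i j))).continuousOn) (γ.memLp_deriv (p i)))
      (γ.memLp_deriv (p j))
  · exact MemLp.intervalIntegrable_mul (γ.memLp_mul_deriv (a i j) (X (p i))) (γ.memLp_deriv (p j))

theorem H1Loop.intervalIntegrable_magneticForce (γ : H1Loop m N) :
    IntervalIntegrable (magneticForce b f X γ.toFun) volume 0 1 := by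
  refine intervalIntegrable_sum fun i => IntervalIntegrable.sub ?_ ?_
  · exact MemLp.intervalIntegrable_unit (γ.memLp_mul_deriv _ _)
  · refine (MemLp.intervalIntegrable_unit (γ.memLp_mul_deriv (X (f i)) (b i))).congr ?_
    exact fun t _ => mul_comm _ _

theorem periodic_deriv_comp {γ : ℝ → N} (hγ : Function.Periodic γ 1)
    (F : C^∞⟮𝓡 m, N; 𝓘(ℝ, ℝ), ℝ⟯) : Function.Periodic (deriv fun r => F (γ r)) 1 :=
  periodic_deriv fun t => by simp only [hγ t]

theorem periodic_momentum {γ : ℝ → N} (hγ : Function.Periodic γ 1) :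
    Function.Periodic (momentum a p X γ) 1 := by
  intro t
  simp only [momentum, hγ t, periodic_deriv_comp hγ _ t]

theorem periodic_kineticForce {γ : ℝ → N} (hγ : Function.Periodic γ 1) :
    Function.Periodic (kineticForce a p X γ) 1 := by
  intro t
  simp only [kineticForce, hγ t, periodic_deriv_comp hγ _ t]

theorem periodic_magneticForce {γ : ℝ → N} (hγ : Function.Periodic γ 1) :
    Function.Periodic (magneticForce b f X γ) 1 := by
  intro t
  simp only [magneticForce, hγ t, periodic_deriv_comp hγ _ t]

end EulerLagrange

/-! ### Periodic functions and inverse matrices -/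

theorem eq_of_ae_eq_of_periodic {u v : ℝ → ℝ} (hu : Continuous u) (hv : Continuous v)
    (hup : Function.Periodic u 1) (hvp : Function.Periodic v 1)
    (h : ∀ᵐ t ∂unitMeasure, u t = v t) (t : ℝ) : u t = v t := by
  have h1 : Ioo (0 : ℝ) 1 ⊆ {t | u t = v t} := by
    have h2 : ∀ᵐ t ∂volume.restrict (Ioo (0 : ℝ) 1), u t = v t :=
      ae_mono (Measure.restrict_mono Ioo_subset_Ioc_self le_rfl) h
    exact Measure.eqOn_open_of_ae_eq h2 isOpen_Ioo hu.continuousOn hv.continuousOn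
  have h3 : Icc (0 : ℝ) 1 ⊆ {t | u t = v t} := by
    rw [← closure_Ioo zero_ne_one]
    exact closure_minimal h1 (isClosed_eq hu hv)
  obtain ⟨s, hs, hst⟩ := (hup.sub hvp).exists_mem_Ico₀ one_pos t
  rw [Pi.sub_apply, Pi.sub_apply, h3 (Ico_subset_Icc_self hs), sub_self] at hst
  exact sub_eq_zero.1 hst

theorem continuous_integral_of_periodic {R : ℝ → ℝ} (hR : IntervalIntegrable R volume 0 1)
    (hp : Function.Periodic R 1) : Continuous fun t => ∫ r in (0 : ℝ)..t, R r :=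
  intervalIntegral.continuous_primitive
    (fun a b => hp.intervalIntegrable₀ one_ne_zero hR a b) 0

theorem periodic_integral {R : ℝ → ℝ} (hR : IntervalIntegrable R volume 0 1)
    (hp : Function.Periodic R 1) (h0 : ∫ r in (0 : ℝ)..1, R r = 0) :
    Function.Periodic (fun t => ∫ r in (0 : ℝ)..t, R r) 1 := by
  intro t
  have hI : ∀ a b, IntervalIntegrable R volume a b :=
    fun a b => hp.intervalIntegrable₀ one_ne_zero hR a b
  have h1 := intervalIntegral.integral_add_adjacent_intervals (hI 0 t) (hI t (t + 1))
  have h2 := hp.intervalIntegral_add_eq t 0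
  rw [zero_add, h0] at h2
  simp only
  rw [← h1, h2, add_zero]

theorem contDiff_det {κ : Type*} [Fintype κ] [DecidableEq κ] {r : WithTop ℕ∞}
    {A : ℝ → Matrix κ κ ℝ} (h : ∀ i j, ContDiff ℝ r fun t => A t i j) :
    ContDiff ℝ r fun t => (A t).det := by
  simp only [Matrix.det_apply]
  exact ContDiff.sum fun σ _ => (contDiff_prod fun i _ => h _ _).const_smul _

theorem contDiff_inv_matrix {κ : Type*} [Fintype κ] [DecidableEq κ] {r : WithTop ℕ∞}
    {A : ℝ → Matrix κ κ ℝ} (h : ∀ i j, ContDiff ℝ r fun t => A t i j) (hA : ∀ t, (A t).det ≠ 0)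
    (i j : κ) : ContDiff ℝ r fun t => (A t)⁻¹ i j := by
  simp only [Matrix.inv_def, Ring.inverse_eq_inv', Matrix.smul_apply, Matrix.adjugate_apply,
    smul_eq_mul]
  refine ((contDiff_det h).inv hA).mul (contDiff_det fun k l => ?_)
  by_cases hk : k = j
  · subst hk
    simp only [Matrix.updateRow_self]
    exact contDiff_const
  · simp only [Matrix.updateRow_ne hk]
    exact h k l

/-! ### Consequences of criticality -/

section Critical

variable {n : ℕ} {M : Type*} [TopologicalSpace M] [T2Space M] [CompactSpace M]
  [ChartedSpace (EuclideanSpace ℝ (Fin n)) M] [IsManifold (𝓡 n) ∞ M]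
  {E : Type*} [TopologicalSpace E] [T2Space E]
  [ChartedSpace (EuclideanSpace ℝ (Fin (n + 1))) E] [IsManifold (𝓡 (n + 1)) ∞ E]
  [MulAction Circle E] {τ : E → M} {ι κ : Type*} [Fintype ι] [Fintype κ]

namespace IsPrincipalCircleBundle

/-- The first variation of the action functional, in terms of frames. -/
theorem hasDerivAt_actionFunctional (hτ : IsPrincipalCircleBundle n τ) (FM : SmoothFrame n M ι)
    (FE : SmoothFrame (n + 1) E κ) (g : Metric n M) (θ : OneForm (n + 1) E)
    (hθ : IsConnectionForm θ) (k : ℝ) {γ : H1Loop (n + 1) E} {T : Ioi (0 : ℝ)} {φ : ℝ}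
    {c : ℝ → LoopSpace (n + 1) E} (hc : IsC1Curve c) (h0 : c 0 = (γ, T, φ)) :
    HasDerivAt (fun s => actionFunctional g τ θ k (c s))
      ((k - ((∫ t in (0 : ℝ)..1, quadDensity (fun i j => hτ.pull (FM.gram g i j))
            (fun i => hτ.pull (FM.fn i)) γ.toFun t)
          + ∫ t in (0 : ℝ)..1, (linDensity (FE.coeff θ) FE.fn γ.toFun t + φ) ^ 2)
            / (2 * (T : ℝ) ^ 2)) * deriv (fun s => ((c s).2.1 : ℝ)) 0
        + 1 / (T : ℝ) * ((∫ t in (0 : ℝ)..1,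
            quadVariation (fun i j => hτ.pull (FM.gram g i j))
            (fun i => hτ.pull (FM.fn i)) γ.toFun (variation c) t)
          + ∫ t in (0 : ℝ)..1, (linDensity (FE.coeff θ) FE.fn γ.toFun t + φ)
            * (linVariation (FE.coeff θ) FE.fn γ.toFun (variation c) t
              + deriv (fun s => (c s).2.2) 0))
        - deriv (fun s => (c s).2.2) 0) 0 := by
  have h := hc.hasDerivAt_action (fun i j => hτ.pull (FM.gram g i j))
    (fun i => hτ.pull (FM.fn i)) (fun i j => by rw [FM.gram_symm]) (FE.coeff θ) FE.fn k
  simp only [h0] at h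
  exact h.congr_of_eventuallyEq (.of_forall fun s => hτ.actionFunctional_eq FM FE g θ hθ k (c s))

variable {g : Metric n M} {θ : OneForm (n + 1) E} {k : ℝ} {γ : H1Loop (n + 1) E} {T : Ioi (0 : ℝ)} {φ : ℝ}

theorem variation_const_loop {m : ℕ} {N : Type*} [TopologicalSpace N]
    [ChartedSpace (EuclideanSpace ℝ (Fin m)) N] (γ : H1Loop m N) (ρ : ℝ → Ioi (0 : ℝ))
    (ψ : ℝ → ℝ) : variation (fun s => (γ, ρ s, ψ s)) = fun _ _ => 0 := by
  ext F t
  simp [variation]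

/-- Variation of the period. The period `T eˢ` stays positive for all `s`. -/
theorem integral_eq_of_critical (hτ : IsPrincipalCircleBundle n τ) (FM : SmoothFrame n M ι)
    (FE : SmoothFrame (n + 1) E κ) (hθ : IsConnectionForm θ)
    (hcrit : IsCriticalPoint (actionFunctional g τ θ k) (γ, T, φ)) :
    ((∫ t in (0 : ℝ)..1, quadDensity (fun i j => hτ.pull (FM.gram g i j))
            (fun i => hτ.pull (FM.fn i)) γ.toFun t)
          + ∫ t in (0 : ℝ)..1, (linDensity (FE.coeff θ) FE.fn γ.toFun t + φ) ^ 2)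
            / (2 * (T : ℝ) ^ 2) = k := by
  have hT : (0 : ℝ) < T := T.2
  set c : ℝ → LoopSpace (n + 1) E := fun s => (γ, ⟨T * Real.exp s, mul_pos hT (Real.exp_pos s)⟩, φ)
    with hcdef
  have hc : IsC1Curve c := ⟨fun F => contDiff_const (c := γ.comp F),
    contDiff_const.mul Real.contDiff_exp, contDiff_const⟩
  have h0 : c 0 = (γ, T, φ) := by simp [hcdef]
  have h1 := (hτ.hasDerivAt_actionFunctional FM FE g θ hθ k hc h0).unique (hcrit c hc h0)
  have hv : variation c = fun _ _ => 0 := variation_const_loop γ _ _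
  have h2 : deriv (fun s => ((c s).2.1 : ℝ)) 0 = T := by
    have h3 := ((Real.hasDerivAt_exp 0).const_mul (T : ℝ)).deriv
    rw [Real.exp_zero, mul_one] at h3
    exact h3
  have h3 : deriv (fun s => (c s).2.2) 0 = 0 := by simp [hcdef]
  rw [hv, h2, h3] at h1
  simp only [quadVariation, linVariation] at h1
  simp only [mul_zero, zero_mul, add_zero, Finset.sum_const_zero, deriv_const,
    intervalIntegral.integral_zero, sub_zero] at h1
  have := (mul_eq_zero.1 h1).resolve_right hT.ne'
  linarith

/-- Variation of the phase. -/
theorem integral_linDensity_eq_of_critical (hτ : IsPrincipalCircleBundle n τ)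
    (FE : SmoothFrame (n + 1) E κ) (hθ : IsConnectionForm θ)
    (hcrit : IsCriticalPoint (actionFunctional g τ θ k) (γ, T, φ)) :
    ∫ t in (0 : ℝ)..1, (linDensity (FE.coeff θ) FE.fn γ.toFun t + φ) = T := by
  have hT : (0 : ℝ) < T := T.2
  obtain ⟨S, ⟨FM⟩⟩ := exists_smoothFrame n M
  set c : ℝ → LoopSpace (n + 1) E := fun s => (γ, T, φ + s) with hcdef
  have hc : IsC1Curve c := ⟨fun F => contDiff_const (c := γ.comp F), contDiff_const (c := (T : ℝ)),
    contDiff_const.add contDiff_id⟩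
  have h0 : c 0 = (γ, T, φ) := by simp [hcdef]
  have h1 := (hτ.hasDerivAt_actionFunctional FM FE g θ hθ k hc h0).unique (hcrit c hc h0)
  have hv : variation c = fun _ _ => 0 := variation_const_loop γ _ _
  have h2 : deriv (fun s => ((c s).2.1 : ℝ)) 0 = 0 := by simp [hcdef]
  have h3 : deriv (fun s => (c s).2.2) 0 = 1 := by simp [hcdef]
  rw [hv, h2, h3] at h1
  simp only [quadVariation, linVariation] at h1
  simp only [mul_zero, zero_mul, add_zero, Finset.sum_const_zero, deriv_const,
    intervalIntegral.integral_zero, zero_add, mul_one] at h1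
  field_simp at h1
  linarith

theorem rotate_field (q : E) : variationField (m := n + 1) (rotate (E := E)) q
    = fundamentalField n q := rfl

/-- Vanishing of the first variation in the direction of `η X`, for a function `η` of time and a
smooth vector field `X` on the total space. -/
theorem integral_variation_eq_zero_of_critical [CompactSpace E] (hτ : IsPrincipalCircleBundle n τ)
    (FM : SmoothFrame n M ι) (FE : SmoothFrame (n + 1) E κ) (hθ : IsConnectionForm θ)
    (hcrit : IsCriticalPoint (actionFunctional g τ θ k) (γ, T, φ)) {Φ : ℝ × E → E}
    (hΦ : ContMDiff (𝓘(ℝ, ℝ).prod (𝓡 (n + 1))) (𝓡 (n + 1)) ∞ Φ) (hΦ0 : ∀ q, Φ (0, q) = q)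
    {η : ℝ → ℝ} (hη : PeriodicH1 η) :
    (∫ t in (0 : ℝ)..1,
      (deriv η t * momentum (fun i j => hτ.pull (FM.gram g i j)) (fun i => hτ.pull (FM.fn i))
          (variationDeriv Φ hΦ) γ.toFun t
        + η t * kineticForce (fun i j => hτ.pull (FM.gram g i j)) (fun i => hτ.pull (FM.fn i))
          (variationDeriv Φ hΦ) γ.toFun t))
      + ∫ t in (0 : ℝ)..1, (linDensity (FE.coeff θ) FE.fn γ.toFun t + φ)
        * (deriv (fun s => η s * θ.form (γ.toFun s) (variationField Φ (γ.toFun s))) t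
          + η t * magneticForce (FE.coeff θ) FE.fn (variationDeriv Φ hΦ) γ.toFun t) = 0 := by
  have hT : (0 : ℝ) < T := T.2
  have hc := isC1Curve_varyCurve γ T φ hη hΦ
  have h0 := varyCurve_zero γ T φ hη hΦ hΦ0
  have h1 := (hτ.hasDerivAt_actionFunctional FM FE g θ hθ k hc h0).unique (hcrit _ hc h0)
  have h2 : deriv (fun s => ((varyCurve γ T φ hη hΦ s).2.1 : ℝ)) 0 = 0 :=
    deriv_const _ (T : ℝ)
  have h3 : deriv (fun s => (varyCurve γ T φ hη hΦ s).2.2) 0 = 0 := deriv_const _ φ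
  have hv : variation (varyCurve γ T φ hη hΦ)
      = fun F t => η t * variationDeriv Φ hΦ F (γ.toFun t) :=
    funext fun F => variation_varyCurve γ T φ hη hΦ F
  rw [h2, h3, hv] at h1
  have h4 := (mul_eq_zero.1 (by linarith :
    1 / (T : ℝ) * ((∫ t in (0 : ℝ)..1,
      quadVariation (fun i j => hτ.pull (FM.gram g i j)) (fun i => hτ.pull (FM.fn i)) γ.toFun
        (fun F t => η t * variationDeriv Φ hΦ F (γ.toFun t)) t)
      + ∫ t in (0 : ℝ)..1, (linDensity (FE.coeff θ) FE.fn γ.toFun t + φ)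
        * (linVariation (FE.coeff θ) FE.fn γ.toFun
          (fun F t => η t * variationDeriv Φ hΦ F (γ.toFun t)) t + 0)) = 0)).resolve_left
      (one_div_ne_zero hT.ne')
  refine Eq.trans (congrArg₂ (· + ·) ?_ ?_) h4
  · refine intervalIntegral.integral_congr_ae_restrict ?_
    rw [uIoc_of_le zero_le_one]
    filter_upwards [hη.ae_hasDerivAt, ae_all_iff.2 fun i =>
      (γ.periodicH1 (variationDeriv Φ hΦ (hτ.pull (FM.fn i)))).ae_hasDerivAt] with t e1 e2
    exact (quadVariation_mul e1.differentiableAt fun i => (e2 i).differentiableAt).symm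
  · refine intervalIntegral.integral_congr_ae_restrict ?_
    rw [uIoc_of_le zero_le_one]
    filter_upwards [hη.ae_hasDerivAt, ae_all_iff.2 fun i =>
      (γ.periodicH1 (variationDeriv Φ hΦ (FE.fn i))).ae_hasDerivAt, ae_all_iff.2 fun i =>
      (γ.periodicH1 (FE.coeff θ i)).ae_hasDerivAt] with t e1 e2 e3
    rw [add_zero, linVariation_mul e1.differentiableAt (fun i => (e3 i).differentiableAt)
      fun i => (e2 i).differentiableAt]
    simp only [FE.form_eq_sum θ, variationDeriv_apply hΦ hΦ0]

/-- The `θ`-component of the velocity of a critical point is constant: this is the Euler-Lagrange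
equation in the direction of the fundamental field. The constant is found by varying the phase. -/
theorem linDensity_eq_of_critical [CompactSpace E] (hτ : IsPrincipalCircleBundle n τ)
    (FE : SmoothFrame (n + 1) E κ) (hθ : IsConnectionForm θ)
    {σ : TwoForm n M} (hσ : HasCurvature τ θ σ)
    (hcrit : IsCriticalPoint (actionFunctional g τ θ k) (γ, T, φ)) :
    ∀ᵐ t ∂unitMeasure, linDensity (FE.coeff θ) FE.fn γ.toFun t + φ = T := by
  obtain ⟨S, ⟨FM⟩⟩ := exists_smoothFrame n M
  -- functions pulled back from the base are constant along the fibres, so momentum and kinetic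
  -- force vanish in this direction; so does the magnetic force, since `dθ = τ^*σ`
  have hX : ∀ F, ∀ q, variationDeriv rotate hτ.contMDiff_rotate (hτ.pull F) q = 0 := fun F q => by
    rw [variationDeriv_apply _ rotate_zero]
    exact hτ.differential_pull_fundamentalField F q
  have hP : MemLp (fun t => linDensity (FE.coeff θ) FE.fn γ.toFun t + φ) 2 unitMeasure :=
    (γ.memLp_linDensity (FE.coeff θ) FE.fn).add (memLp_const φ)
  have key := duBoisReymond hP (R := fun _ => 0) (by simp) fun η hη => by
    have h := hτ.integral_variation_eq_zero_of_critical FM FE hθ hcrit hτ.contMDiff_rotate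
      rotate_zero hη
    have e1 : ∀ t, momentum (fun i j => hτ.pull (FM.gram g i j)) (fun i => hτ.pull (FM.fn i))
          (variationDeriv rotate hτ.contMDiff_rotate) γ.toFun t = 0 := fun t => by
      simp [momentum, hX]
    have e2 : ∀ t, kineticForce (fun i j => hτ.pull (FM.gram g i j)) (fun i => hτ.pull (FM.fn i))
          (variationDeriv rotate hτ.contMDiff_rotate) γ.toFun t = 0 := fun t => by
      simp [kineticForce, hX]
    simp only [e1, e2, mul_zero, add_zero, intervalIntegral.integral_zero, zero_add,
      rotate_field, hθ.normalized, mul_one] at h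
    refine Eq.trans ?_ h
    refine intervalIntegral.integral_congr_ae_restrict ?_
    rw [uIoc_of_le zero_le_one]
    filter_upwards [FE.ae_mdifferentiableAt γ] with t ht
    have e3 : magneticForce (FE.coeff θ) FE.fn (variationDeriv rotate hτ.contMDiff_rotate)
        γ.toFun t = θ.d (γ.toFun t) (fundamentalField n (γ.toFun t)) (velocity γ.toFun t) := by
      rw [θ.d_eq_sum (FE.coeff θ) FE.fn (FE.form_eq_sum θ)]
      refine Finset.sum_congr rfl fun i _ => ?_
      rw [(hasDerivAt_comp_velocity _ ht).deriv, (hasDerivAt_comp_velocity _ ht).deriv,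
        variationDeriv_apply _ rotate_zero, variationDeriv_apply _ rotate_zero]
      rfl
    rw [e3, hσ, hτ.mfderiv_proj_fundamentalField, map_zero, zero_apply, mul_zero, add_zero,
      add_zero, mul_comm]
  obtain ⟨-, c, hc⟩ := key
  simp only [intervalIntegral.integral_zero, add_zero] at hc
  have h1 := hτ.integral_linDensity_eq_of_critical FE hθ hcrit
  have h2 : ∫ t in (0 : ℝ)..1, (linDensity (FE.coeff θ) FE.fn γ.toFun t + φ) = c := by
    rw [intervalIntegral.integral_congr_ae_restrict (g := fun _ => c) (by
      rw [uIoc_of_le zero_le_one]; exact hc)]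
    simp
  rw [← h1, h2]
  exact hc

/-- The Euler-Lagrange equation of a critical point in the direction of a vector field, in
integrated form. As the vertical speed is constant, the total derivative in the variation of the
vertical part integrates to zero. -/
theorem momentum_eq_of_critical [CompactSpace E] (hτ : IsPrincipalCircleBundle n τ)
    (FM : SmoothFrame n M ι) (FE : SmoothFrame (n + 1) E κ) (hθ : IsConnectionForm θ)
    {σ : TwoForm n M} (hσ : HasCurvature τ θ σ)
    (hcrit : IsCriticalPoint (actionFunctional g τ θ k) (γ, T, φ)) {Φ : ℝ × E → E}
    (hΦ : ContMDiff (𝓘(ℝ, ℝ).prod (𝓡 (n + 1))) (𝓡 (n + 1)) ∞ Φ) (hΦ0 : ∀ q, Φ (0, q) = q)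
    {R : ℝ → ℝ} (hR : R = fun t => kineticForce (fun i j => hτ.pull (FM.gram g i j))
        (fun i => hτ.pull (FM.fn i)) (variationDeriv Φ hΦ) γ.toFun t
      + T * magneticForce (FE.coeff θ) FE.fn (variationDeriv Φ hΦ) γ.toFun t) :
    (∫ t in (0 : ℝ)..1, R t = 0) ∧ ∃ c, ∀ᵐ t ∂unitMeasure,
      momentum (fun i j => hτ.pull (FM.gram g i j)) (fun i => hτ.pull (FM.fn i))
          (variationDeriv Φ hΦ) γ.toFun t = c + ∫ r in (0 : ℝ)..t, R r := by
  have hRi : IntervalIntegrable R volume 0 1 := by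
    rw [hR]
    exact γ.intervalIntegrable_kineticForce.add (γ.intervalIntegrable_magneticForce.const_mul _)
  refine duBoisReymond γ.memLp_momentum hRi fun η hη => ?_
  have h := hτ.integral_variation_eq_zero_of_critical FM FE hθ hcrit hΦ hΦ0 hη
  have hu : PeriodicH1 (fun s => η s * θ.form (γ.toFun s) (variationField Φ (γ.toFun s))) := by
    simp only [FE.form_eq_sum θ, ← variationDeriv_apply hΦ hΦ0]
    exact hη.mul (PeriodicH1.sum _ fun i => (γ.periodicH1 _).mul (γ.periodicH1 _))
  have hmag : IntervalIntegrable (fun t => η t * magneticForce (FE.coeff θ) FE.fn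
      (variationDeriv Φ hΦ) γ.toFun t) volume 0 1 :=
    γ.intervalIntegrable_magneticForce.continuousOn_mul hη.continuous.continuousOn
  have h1 : ∫ t in (0 : ℝ)..1, (linDensity (FE.coeff θ) FE.fn γ.toFun t + φ)
        * (deriv (fun s => η s * θ.form (γ.toFun s) (variationField Φ (γ.toFun s))) t
          + η t * magneticForce (FE.coeff θ) FE.fn (variationDeriv Φ hΦ) γ.toFun t)
      = ∫ t in (0 : ℝ)..1, T * (η t * magneticForce (FE.coeff θ) FE.fn
          (variationDeriv Φ hΦ) γ.toFun t) := by
    have e1 : ∫ t in (0 : ℝ)..1, (linDensity (FE.coeff θ) FE.fn γ.toFun t + φ)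
        * (deriv (fun s => η s * θ.form (γ.toFun s) (variationField Φ (γ.toFun s))) t
          + η t * magneticForce (FE.coeff θ) FE.fn (variationDeriv Φ hΦ) γ.toFun t)
        = ∫ t in (0 : ℝ)..1, (T : ℝ)
        * (deriv (fun s => η s * θ.form (γ.toFun s) (variationField Φ (γ.toFun s))) t
          + η t * magneticForce (FE.coeff θ) FE.fn (variationDeriv Φ hΦ) γ.toFun t) := by
      refine intervalIntegral.integral_congr_ae_restrict ?_
      rw [uIoc_of_le zero_le_one]
      filter_upwards [hτ.linDensity_eq_of_critical FE hθ hσ hcrit] with t ht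
      rw [ht]
    rw [e1, intervalIntegral.integral_const_mul, intervalIntegral.integral_const_mul,
      intervalIntegral.integral_add (MemLp.intervalIntegrable_unit hu.memLp_deriv) hmag,
      hu.integral_deriv, zero_add]
  rw [h1] at h
  have h2 := (MemLp.intervalIntegrable_mul hη.memLp_deriv (γ.memLp_momentum
      (a := fun i j => hτ.pull (FM.gram g i j)) (p := fun i => hτ.pull (FM.fn i))
      (X := variationDeriv Φ hΦ))).add
    ((γ.intervalIntegrable_kineticForce (a := fun i j => hτ.pull (FM.gram g i j))
      (p := fun i => hτ.pull (FM.fn i)) (X := variationDeriv Φ hΦ)).continuousOn_mul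
        hη.continuous.continuousOn)
  refine Eq.trans ?_ ((intervalIntegral.integral_add h2 (hmag.const_mul _)).trans h)
  refine intervalIntegral.integral_congr fun t _ => ?_
  simp only [hR]
  ring

end IsPrincipalCircleBundle

end Critical

/-! ### Velocities and the lifted metric in a smooth frame -/

section Regularity

variable {n : ℕ} {M : Type*} [TopologicalSpace M] [T2Space M] [CompactSpace M]
  [ChartedSpace (EuclideanSpace ℝ (Fin n)) M] [IsManifold (𝓡 n) ∞ M]
  {E : Type*} [TopologicalSpace E] [T2Space E]
  [ChartedSpace (EuclideanSpace ℝ (Fin (n + 1))) E] [IsManifold (𝓡 (n + 1)) ∞ E]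
  [MulAction Circle E] {τ : E → M} {ι κ : Type*} [Fintype ι] [Fintype κ]
  {g : Metric n M} {θ : OneForm (n + 1) E} {k : ℝ} {γ : H1Loop (n + 1) E} {T : Ioi (0 : ℝ)} {φ : ℝ}

namespace IsPrincipalCircleBundle

/-- The projection has local sections through every point, given by the trivializations. -/
theorem mfderiv_proj_surjective (hτ : IsPrincipalCircleBundle n τ) (q : E) :
    Function.Surjective (mfderiv (𝓡 (n + 1)) (𝓡 n) τ q) := by
  obtain ⟨e, he, -, hs, -⟩ := hτ.exists_trivialization (τ q)
  set s : M → E := fun x => e.toOpenPartialHomeomorph.symm (x, (e q).2) with hsdef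
  have hq : q ∈ e.source := e.mem_source.2 he
  have hsq : s (τ q) = q := by
    have h1 : (τ q, (e q).2) = e q := Prod.ext (e.coe_fst hq).symm rfl
    rw [hsdef]
    simp only
    rw [h1]
    exact e.left_inv hq
  have ht : ∀ x ∈ e.baseSet, (x, (e q).2) ∈ e.target := fun x hx => by
    rw [e.target_eq]
    exact ⟨hx, mem_univ _⟩
  have hsm : MDifferentiableAt (𝓡 n) (𝓡 (n + 1)) s (τ q) := by
    have h1 := hs.contMDiffAt (e.open_target.mem_nhds (ht _ he))
    have h2 : ContMDiffAt (𝓡 n) ((𝓡 n).prod (𝓡 1)) ∞ (fun x => (x, (e q).2)) (τ q) :=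
      contMDiffAt_id.prodMk contMDiffAt_const
    exact (ContMDiffAt.comp (τ q) h1 h2).mdifferentiableAt (by simp)
  have h1 := (hτ.mdifferentiableAt_proj (s (τ q))).hasMFDerivAt.comp (τ q) hsm.hasMFDerivAt
  have h2 : (τ ∘ s) =ᶠ[𝓝 (τ q)] id := by
    filter_upwards [e.open_baseSet.mem_nhds he] with x hx
    exact e.proj_symm_apply (ht x hx)
  have h3 := h1.congr_of_eventuallyEq h2.symm
  have h4 := hasMFDerivAt_unique h3 (hasMFDerivAt_id (τ q))
  have h5 : Function.Surjective (mfderiv (𝓡 (n + 1)) (𝓡 n) τ (s (τ q))) := fun u =>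
    ⟨mfderiv (𝓡 n) (𝓡 (n + 1)) s (τ q) u, congrArg (fun L => L u) h4⟩
  have h6 : ∀ q' : E, q' = q → Function.Surjective (mfderiv (𝓡 (n + 1)) (𝓡 n) τ q') →
      Function.Surjective (mfderiv (𝓡 (n + 1)) (𝓡 n) τ q) := by
    rintro _ rfl h
    exact h
  exact h6 _ hsq h5

/-- A vector that is both vertical and horizontal vanishes. -/
theorem eq_zero_of_mfderiv_proj_eq_zero (hτ : IsPrincipalCircleBundle n τ)
    (hθ : IsConnectionForm θ) {q : E} {v : TangentSpace (𝓡 (n + 1)) q}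
    (hv : mfderiv (𝓡 (n + 1)) (𝓡 n) τ q v = 0) (hv' : θ.form q v = 0) : v = 0 := by
  set A₀ : EuclideanSpace ℝ (Fin (n + 1)) →L[ℝ] EuclideanSpace ℝ (Fin n) :=
    mfderiv (𝓡 (n + 1)) (𝓡 n) τ q with hA₀
  set A : EuclideanSpace ℝ (Fin (n + 1)) →ₗ[ℝ] EuclideanSpace ℝ (Fin n) :=
    A₀.toLinearMap with hA
  set Z : EuclideanSpace ℝ (Fin (n + 1)) := fundamentalField n q with hZ
  have h1 : LinearMap.range A = ⊤ := LinearMap.range_eq_top.2 (hτ.mfderiv_proj_surjective q)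
  have h2 := A.finrank_range_add_finrank_ker
  rw [h1, finrank_top, finrank_euclideanSpace_fin, finrank_euclideanSpace_fin] at h2
  have h3 : Module.finrank ℝ (LinearMap.ker A) = 1 := by omega
  have hZ0 : (⟨Z, hτ.mfderiv_proj_fundamentalField q⟩ : LinearMap.ker A) ≠ 0 := by
    intro h0
    have h4 : Z = 0 := congrArg Subtype.val h0
    have h5 : θ.form q (fundamentalField n q) = 0 :=
      (congrArg (θ.form q) h4).trans (map_zero (θ.form q))
    rw [hθ.normalized] at h5
    exact one_ne_zero h5
  obtain ⟨c, hc⟩ := (finrank_eq_one_iff_of_nonzero' _ hZ0).1 h3 ⟨v, hv⟩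
  have h6 : c • fundamentalField n q = v := congrArg Subtype.val hc
  rw [← h6, map_smul, hθ.normalized, smul_eq_mul, mul_one] at hv'
  rw [← h6, hv', zero_smul]

theorem liftedInner_self_nonneg (q : E) (v : TangentSpace (𝓡 (n + 1)) q) :
    0 ≤ liftedInner g τ θ q v v := by
  refine add_nonneg ?_ (mul_self_nonneg _)
  by_cases h : mfderiv (𝓡 (n + 1)) (𝓡 n) τ q v = 0
  · rw [h, map_zero]
  · exact (g.pos _ _ h).le

theorem eq_zero_of_liftedInner_self (hτ : IsPrincipalCircleBundle n τ) (hθ : IsConnectionForm θ)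
    {q : E} {v : TangentSpace (𝓡 (n + 1)) q} (h : liftedInner g τ θ q v v = 0) : v = 0 := by
  have h1 : 0 ≤ θ.form q v * θ.form q v := mul_self_nonneg _
  by_cases h2 : mfderiv (𝓡 (n + 1)) (𝓡 n) τ q v = 0
  · refine hτ.eq_zero_of_mfderiv_proj_eq_zero hθ h2 ?_
    rw [liftedInner, h2, map_zero, zero_add] at h
    exact mul_self_eq_zero.1 h
  · have := g.pos _ _ h2
    rw [liftedInner] at h
    linarith

theorem liftedInner_sum_smul_right (q : E) (u : TangentSpace (𝓡 (n + 1)) q) (x : κ → ℝ)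
    (X : κ → TangentSpace (𝓡 (n + 1)) q) :
    liftedInner g τ θ q u (∑ l, x l • X l) = ∑ l, x l * liftedInner g τ θ q u (X l) := by
  simp only [liftedInner, map_sum, map_smul, smul_eq_mul, mul_add, Finset.sum_add_distrib]
  congr 1
  rw [Finset.mul_sum]
  exact Finset.sum_congr rfl fun l _ => by ring

theorem liftedInner_comm (q : E) (u v : TangentSpace (𝓡 (n + 1)) q) :
    liftedInner g τ θ q u v = liftedInner g τ θ q v u := by
  rw [liftedInner, liftedInner, g.symm, mul_comm]

/-- The matrix `β + (1 - Π)ᵀ (1 - Π)`, with `β` the Gram matrix of a frame of the total space for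
the metric `g^θ`, and `Πᵢₖ = dfᵢ(Xₖ)`. The Gram matrix itself is singular, since the fields of a
frame are linearly dependent in general; the second summand is positive on the kernel of `Π` and
vanishes on the coordinate vectors `(dfᵢ(v))` of tangent vectors `v`. -/
noncomputable def frameMatrix [DecidableEq κ] (FE : SmoothFrame (n + 1) E κ) (g : Metric n M)
    (τ : E → M) (θ : OneForm (n + 1) E) (q : E) : Matrix κ κ ℝ := fun k l =>
  liftedInner g τ θ q (variationField (FE.flow k) q) (variationField (FE.flow l) q)
    + ∑ i, ((1 : Matrix κ κ ℝ) i k - FE.along k (FE.fn i) q)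
      * ((1 : Matrix κ κ ℝ) i l - FE.along l (FE.fn i) q)

theorem frameMatrix_mulVec [DecidableEq κ] (FE : SmoothFrame (n + 1) E κ) (q : E) (x : κ → ℝ)
    (k : κ) : (frameMatrix FE g τ θ q).mulVec x k
      = liftedInner g τ θ q (variationField (FE.flow k) q)
          (∑ l, x l • variationField (FE.flow l) q)
        + ∑ i, ((1 : Matrix κ κ ℝ) i k - FE.along k (FE.fn i) q)
          * (x i - differential (FE.fn i) q (∑ l, x l • variationField (FE.flow l) q)) := by
  rw [liftedInner_sum_smul_right, Matrix.mulVec, dotProduct]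
  simp only [frameMatrix, add_mul, Finset.sum_add_distrib]
  congr 1
  · exact Finset.sum_congr rfl fun l _ => mul_comm _ _
  · simp only [Finset.sum_mul]
    rw [Finset.sum_comm]
    refine Finset.sum_congr rfl fun i _ => ?_
    simp only [mul_assoc]
    rw [← Finset.mul_sum]
    congr 1
    simp only [sub_mul, Finset.sum_sub_distrib, map_sum, map_smul, smul_eq_mul, FE.along_apply]
    congr 1
    · simp [Matrix.one_apply]
    · exact Finset.sum_congr rfl fun l _ => mul_comm _ _

/-- The frame matrix is positive definite: on a vector `x`, with `w = ∑ xₗ Xₗ`, its quadratic form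
is `|w|² + ∑ (xᵢ - dfᵢ(w))²`. -/
theorem det_frameMatrix_ne_zero [DecidableEq κ] (hτ : IsPrincipalCircleBundle n τ)
    (hθ : IsConnectionForm θ) (FE : SmoothFrame (n + 1) E κ) (q : E) :
    (frameMatrix FE g τ θ q).det ≠ 0 := by
  intro hdet
  obtain ⟨x, hx0, hx⟩ := Matrix.exists_mulVec_eq_zero_iff.2 hdet
  set w : TangentSpace (𝓡 (n + 1)) q := ∑ l, x l • variationField (FE.flow l) q with hw
  have h1 : ∑ k, x k * (frameMatrix FE g τ θ q).mulVec x k = 0 := by simp [hx]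
  have h2 : ∑ k, x k * (frameMatrix FE g τ θ q).mulVec x k
      = liftedInner g τ θ q w w + ∑ i, (x i - differential (FE.fn i) q w) ^ 2 := by
    simp only [frameMatrix_mulVec, ← hw, mul_add, Finset.sum_add_distrib]
    congr 1
    · conv_rhs => rw [hw, liftedInner_sum_smul_right, ← hw]
      exact Finset.sum_congr rfl fun l _ => by rw [liftedInner_comm]
    · simp only [Finset.mul_sum]
      rw [Finset.sum_comm]
      refine Finset.sum_congr rfl fun i _ => ?_
      simp only [← mul_assoc]
      rw [← Finset.sum_mul, sq]
      congr 1
      simp only [mul_sub, Finset.sum_sub_distrib, hw, map_sum, map_smul, smul_eq_mul,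
        FE.along_apply]
      congr 1
      simp [Matrix.one_apply]
  rw [h2] at h1
  have h3 : 0 ≤ liftedInner g τ θ q w w := liftedInner_self_nonneg q w
  have h4 : 0 ≤ ∑ i, (x i - differential (FE.fn i) q w) ^ 2 :=
    Finset.sum_nonneg fun i _ => sq_nonneg _
  have h5 : w = 0 := hτ.eq_zero_of_liftedInner_self hθ (by linarith)
  have h6 : ∑ i, (x i - differential (FE.fn i) q w) ^ 2 = 0 := by linarith
  refine hx0 (funext fun i => ?_)
  have h7 := (Finset.sum_eq_zero_iff_of_nonneg fun i _ => sq_nonneg _).1 h6 i (Finset.mem_univ i)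
  rw [h5, map_zero, sub_zero] at h7
  exact pow_eq_zero_iff two_ne_zero |>.1 h7

/-- The velocity of a curve is recovered from its inner products with the fields of a frame, with
coefficients that depend smoothly on the position. -/
theorem deriv_fn_eq [DecidableEq κ] (hτ : IsPrincipalCircleBundle n τ) (hθ : IsConnectionForm θ)
    (FE : SmoothFrame (n + 1) E κ) {c : ℝ → E} {t : ℝ}
    (hc : MDifferentiableAt 𝓘(ℝ, ℝ) (𝓡 (n + 1)) c t) (l : κ) :
    deriv (fun s => FE.fn l (c s)) t = ∑ k, (frameMatrix FE g τ θ (c t))⁻¹ l k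
      * liftedInner g τ θ (c t) (variationField (FE.flow k) (c t)) (velocity c t) := by
  set x : κ → ℝ := fun l => deriv (fun s => FE.fn l (c s)) t with hx
  have h1 : ∑ l, x l • variationField (FE.flow l) (c t) = velocity (n := n + 1) c t := by
    conv_rhs => rw [← FE.sum_smul _ (velocity c t)]
    refine Finset.sum_congr rfl fun l _ => ?_
    rw [hx]
    simp only
    rw [(hasDerivAt_comp_velocity _ hc).deriv]
  have h2 : (frameMatrix FE g τ θ (c t)).mulVec x = fun k =>
      liftedInner g τ θ (c t) (variationField (FE.flow k) (c t)) (velocity c t) := by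
    ext1 k
    rw [frameMatrix_mulVec, h1]
    refine add_eq_left.2 (Finset.sum_eq_zero fun i _ => ?_)
    rw [hx]
    simp only
    rw [(hasDerivAt_comp_velocity _ hc).deriv, sub_self, mul_zero]
  have h3 : x = (frameMatrix FE g τ θ (c t))⁻¹.mulVec ((frameMatrix FE g τ θ (c t)).mulVec x) := by
    rw [Matrix.mulVec_mulVec, Matrix.nonsing_inv_mul _
      (isUnit_iff_ne_zero.2 (hτ.det_frameMatrix_ne_zero hθ FE (c t))), Matrix.one_mulVec]
  rw [h2] at h3
  exact congrFun h3 l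

end IsPrincipalCircleBundle

end Regularity

/-! ### Regularity of critical points -/

section Bootstrap

variable {n : ℕ} {M : Type*} [TopologicalSpace M] [T2Space M] [CompactSpace M]
  [ChartedSpace (EuclideanSpace ℝ (Fin n)) M] [IsManifold (𝓡 n) ∞ M]
  {E : Type*} [TopologicalSpace E] [T2Space E]
  [ChartedSpace (EuclideanSpace ℝ (Fin (n + 1))) E] [IsManifold (𝓡 (n + 1)) ∞ E]
  [MulAction Circle E] {τ : E → M} {ι κ : Type*} [Fintype ι] [Fintype κ]
  {g : Metric n M} {θ : OneForm (n + 1) E} {k : ℝ} {γ : H1Loop (n + 1) E} {T : Ioi (0 : ℝ)} {φ : ℝ}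

theorem SmoothFrame.contDiff_comp {m : ℕ} {N : Type*} [TopologicalSpace N]
    [ChartedSpace (EuclideanSpace ℝ (Fin m)) N] [IsManifold (𝓡 m) ∞ N] (Fr : SmoothFrame m N κ)
    {r : WithTop ℕ∞} (hr : r ≤ (∞ : WithTop ℕ∞)) {c : ℝ → N} (hc : Continuous c)
    (h : ∀ k, ContDiff ℝ r fun s => Fr.fn k (c s)) (F : C^∞⟮𝓡 m, N; 𝓘(ℝ, ℝ), ℝ⟯) :
    ContDiff ℝ r fun s => F (c s) := by
  have h1 : ContMDiff 𝓘(ℝ, ℝ) (𝓡 m) r c := fun t =>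
    Fr.contMDiffAt_curve hr hc.continuousAt fun k => (h k).contDiffAt
  exact ((F.contMDiff.of_le hr).comp h1).contDiff

namespace IsPrincipalCircleBundle

/-- The inner products of the velocity with the fields of a frame are the momenta of the horizontal
part plus a multiple of the vertical speed. -/
theorem liftedInner_eq_momentum (hτ : IsPrincipalCircleBundle n τ) (FM : SmoothFrame n M ι)
    (FE : SmoothFrame (n + 1) E κ) {c : ℝ → E} {t : ℝ}
    (hc : MDifferentiableAt 𝓘(ℝ, ℝ) (𝓡 (n + 1)) c t) (l : κ) :
    liftedInner g τ θ (c t) (variationField (FE.flow l) (c t)) (velocity c t)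
      = momentum (fun i j => hτ.pull (FM.gram g i j)) (fun i => hτ.pull (FM.fn i)) (FE.along l) c t
        + FE.coeff θ l (c t) * linDensity (FE.coeff θ) FE.fn c t := by
  rw [liftedInner, FM.inner_eq_sum]
  refine congrArg₂ (· + ·) ?_ (congrArg₂ (· * ·) rfl ?_)
  · refine Finset.sum_congr rfl fun j _ => ?_
    rw [Finset.sum_mul]
    refine Finset.sum_congr rfl fun i _ => ?_
    rw [(hasDerivAt_comp_velocity (hτ.pull (FM.fn j)) hc).deriv, hτ.differential_pull, FE.along_apply,
      hτ.differential_pull, hτ.pull_apply]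
  · rw [FE.form_eq_sum, linDensity]
    refine Finset.sum_congr rfl fun i _ => ?_
    rw [(hasDerivAt_comp_velocity (FE.fn i) hc).deriv]

theorem contDiff_frameMatrix [DecidableEq κ] (hτ : IsPrincipalCircleBundle n τ)
    (FE : SmoothFrame (n + 1) E κ) {r : WithTop ℕ∞} {c : ℝ → E}
    (h : ∀ F : C^∞⟮𝓡 (n + 1), E; 𝓘(ℝ, ℝ), ℝ⟯, ContDiff ℝ r fun s => F (c s)) (i j : κ) :
    ContDiff ℝ r fun t => frameMatrix FE g τ θ (c t) i j := by
  obtain ⟨S, ⟨FM⟩⟩ := exists_smoothFrame n M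
  have h1 : ∀ q, frameMatrix FE g τ θ q i j = (∑ b, (∑ a, hτ.pull (FM.gram g a b) q
      * FE.along i (hτ.pull (FM.fn a)) q) * FE.along j (hτ.pull (FM.fn b)) q)
      + FE.coeff θ i q * FE.coeff θ j q + ∑ a, ((1 : Matrix κ κ ℝ) a i - FE.along i (FE.fn a) q)
      * ((1 : Matrix κ κ ℝ) a j - FE.along j (FE.fn a) q) := by
    intro q
    simp only [FE.along_apply, hτ.differential_pull]
    rw [frameMatrix, liftedInner, FM.inner_eq_sum]
    simp only [FE.along_apply]
    rfl
  simp only [h1]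
  refine ContDiff.add (ContDiff.add (ContDiff.sum fun b _ => ContDiff.mul (ContDiff.sum fun a _ =>
    (h _).mul (h _)) (h _)) ((h _).mul (h _))) (ContDiff.sum fun a _ =>
    (contDiff_const.sub (h _)).mul (contDiff_const.sub (h _)))

/-- A critical point of the action functional is of class `C²`, and satisfies the Euler-Lagrange
equations in the directions of a frame. The velocity of the loop is recovered from its momenta;
by the integrated Euler-Lagrange equations these are one degree more regular than the velocity. -/
theorem regularity_of_critical [CompactSpace E] (hτ : IsPrincipalCircleBundle n τ)
    (FM : SmoothFrame n M ι) (FE : SmoothFrame (n + 1) E κ) (hθ : IsConnectionForm θ)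
    {σ : TwoForm n M} (hσ : HasCurvature τ θ σ)
    (hcrit : IsCriticalPoint (actionFunctional g τ θ k) (γ, T, φ)) :
    (∀ F : C^∞⟮𝓡 (n + 1), E; 𝓘(ℝ, ℝ), ℝ⟯, ContDiff ℝ 2 fun s => F (γ.toFun s)) ∧
    ∀ l t, HasDerivAt (momentum (fun i j => hτ.pull (FM.gram g i j)) (fun i => hτ.pull (FM.fn i))
        (FE.along l) γ.toFun)
      (kineticForce (fun i j => hτ.pull (FM.gram g i j)) (fun i => hτ.pull (FM.fn i))
        (FE.along l) γ.toFun t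
        + T * magneticForce (FE.coeff θ) FE.fn (FE.along l) γ.toFun t) t := by
  classical
  set P : κ → ℝ → ℝ := fun l => momentum (fun i j => hτ.pull (FM.gram g i j))
    (fun i => hτ.pull (FM.fn i)) (FE.along l) γ.toFun with hP
  set R : κ → ℝ → ℝ := fun l t => kineticForce (fun i j => hτ.pull (FM.gram g i j))
    (fun i => hτ.pull (FM.fn i)) (FE.along l) γ.toFun t
      + T * magneticForce (FE.coeff θ) FE.fn (FE.along l) γ.toFun t with hR
  -- the continuous representatives `Q l` of the momenta `P l` are primitives of the forces `R l`
  have hEL : ∀ l, (∫ t in (0 : ℝ)..1, R l t = 0) ∧ ∃ c, ∀ᵐ t ∂unitMeasure,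
      P l t = c + ∫ r in (0 : ℝ)..t, R l r := fun l =>
    hτ.momentum_eq_of_critical FM FE hθ hσ hcrit (FE.contMDiff_flow l) (FE.flow_zero l) rfl
  have hRi : ∀ l, IntervalIntegrable (R l) volume 0 1 := fun l =>
    γ.intervalIntegrable_kineticForce.add (γ.intervalIntegrable_magneticForce.const_mul _)
  have hRp : ∀ l, Function.Periodic (R l) 1 := fun l t => by
    simp only [hR, periodic_kineticForce γ.periodic t, periodic_magneticForce γ.periodic t]
  choose hR0 C hC using hEL
  set Q : κ → ℝ → ℝ := fun l t => C l + ∫ r in (0 : ℝ)..t, R l r with hQ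
  have hQc : ∀ l, Continuous (Q l) := fun l =>
    continuous_const.add (continuous_integral_of_periodic (hRi l) (hRp l))
  have hQp : ∀ l, Function.Periodic (Q l) 1 := fun l t => by
    simp only [hQ]
    have := periodic_integral (hRi l) (hRp l) (hR0 l) t
    simp only at this
    rw [this]
  -- the velocity, expressed through the momenta
  set v : κ → ℝ → ℝ := fun j t => ∑ l, (frameMatrix FE g τ θ (γ.toFun t))⁻¹ j l
    * (Q l t + FE.coeff θ l (γ.toFun t) * (T - φ)) with hv
  have hvp : ∀ j, Function.Periodic (v j) 1 := fun j t => by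
    simp only [hv, γ.periodic t, hQp _ t]
  have hvC : ∀ r : WithTop ℕ∞, (∀ F : C^∞⟮𝓡 (n + 1), E; 𝓘(ℝ, ℝ), ℝ⟯,
      ContDiff ℝ r fun s => F (γ.toFun s)) → (∀ l, ContDiff ℝ r (Q l)) →
      ∀ j, ContDiff ℝ r (v j) := fun r hF hQr j =>
    ContDiff.sum fun l _ => (contDiff_inv_matrix (fun i j => hτ.contDiff_frameMatrix FE hF i j)
      (fun t => hτ.det_frameMatrix_ne_zero hθ FE (γ.toFun t)) j l).mul
      ((hQr l).add ((hF _).mul contDiff_const))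
  have hv0 : ∀ j, Continuous (v j) := fun j => by
    have h0 := hvC 0 (fun F => contDiff_zero.2 (F.contMDiff.continuous.comp γ.continuous))
      (fun l => contDiff_zero.2 (hQc l)) j
    exact h0.continuous
  have hae : ∀ j, ∀ᵐ t ∂unitMeasure, deriv (fun s => FE.fn j (γ.toFun s)) t = v j t := by
    intro j
    filter_upwards [FE.ae_mdifferentiableAt γ, ae_all_iff.2 hC,
      hτ.linDensity_eq_of_critical FE hθ hσ hcrit] with t h1 h2 h3
    rw [hτ.deriv_fn_eq hθ FE h1 j (g := g)]
    refine Finset.sum_congr rfl fun l _ => ?_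
    rw [hτ.liftedInner_eq_momentum FM FE h1 l, ← eq_sub_iff_add_eq.2 h3]
    congr 2
    exact h2 l
  have hd : ∀ j t, HasDerivAt (fun s => FE.fn j (γ.toFun s)) (v j t) t := fun j =>
    (γ.periodicH1 (FE.fn j)).hasDerivAt_of_ae_eq (hv0 j) (hvp j) (hae j)
  have hderiv : ∀ j, deriv (fun s => FE.fn j (γ.toFun s)) = v j := fun j =>
    funext fun t => (hd j t).deriv
  -- the velocity is continuous, so the loop is of class `C¹`; then the forces are continuous, so
  -- the momenta and with them the velocity are of class `C¹`
  have hC1 : ∀ F : C^∞⟮𝓡 (n + 1), E; 𝓘(ℝ, ℝ), ℝ⟯, ContDiff ℝ 1 fun s => F (γ.toFun s) := by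
    refine FE.contDiff_comp (by simp) γ.continuous fun j => contDiff_one_iff_deriv.2 ⟨?_, ?_⟩
    · exact fun t => (hd j t).differentiableAt
    · rw [hderiv]
      exact hv0 j
  have hdc : ∀ F : C^∞⟮𝓡 (n + 1), E; 𝓘(ℝ, ℝ), ℝ⟯, Continuous (deriv fun s => F (γ.toFun s)) :=
    fun F => (hC1 F).continuous_deriv le_rfl
  have hFc : ∀ F : C^∞⟮𝓡 (n + 1), E; 𝓘(ℝ, ℝ), ℝ⟯, Continuous fun s => F (γ.toFun s) :=
    fun F => (hC1 F).continuous
  have hRc : ∀ l, Continuous (R l) := fun l => by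
    refine Continuous.add (continuous_finsetSum _ fun j _ => continuous_finsetSum _ fun i _ => ?_)
      (continuous_const.mul (continuous_finsetSum _ fun i _ => ?_))
    · exact (((continuous_const.mul (hFc _)).mul (hdc _)).mul (hdc _)).add
        (((hFc _).mul (hdc _)).mul (hdc _))
    · exact ((hFc _).mul (hdc _)).sub ((hdc _).mul (hFc _))
  have hPc : ∀ l, Continuous (P l) := fun l =>
    continuous_finsetSum _ fun j _ => continuous_finsetSum _ fun i _ =>
      ((hFc _).mul (hFc _)).mul (hdc _)
  have hQd : ∀ l t, HasDerivAt (Q l) (R l t) t := fun l t =>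
    ((hRc l).integral_hasStrictDerivAt 0 t).hasDerivAt.const_add _
  have hQ1 : ∀ l, ContDiff ℝ 1 (Q l) := fun l => contDiff_one_iff_deriv.2
    ⟨fun t => (hQd l t).differentiableAt, by
      rw [show deriv (Q l) = R l from funext fun t => (hQd l t).deriv]
      exact hRc l⟩
  refine ⟨FE.contDiff_comp two_le_infty γ.continuous fun j => ?_, fun l t => ?_⟩
  · refine (contDiff_succ_iff_deriv (n := 1)).2 ⟨fun t => (hd j t).differentiableAt, by simp, ?_⟩
    rw [hderiv]
    exact hvC 1 hC1 hQ1 j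
  · have hPQ : P l = Q l := funext fun t =>
      eq_of_ae_eq_of_periodic (hPc l) (hQc l) (periodic_momentum γ.periodic) (hQp l) (hC l) t
    exact (hQd l t).congr_of_eventuallyEq (.of_forall fun s => congrFun hPQ s)

end IsPrincipalCircleBundle

end Bootstrap

/-! ### Curves of class `C²` in the base -/

section BaseCurves

variable {n : ℕ} {M : Type*} [TopologicalSpace M]
  [ChartedSpace (EuclideanSpace ℝ (Fin n)) M] [IsManifold (𝓡 n) ∞ M] {ι : Type*} [Fintype ι]

theorem eq_of_inner_eq (g : Metric n M) {x : M} {v w : TangentSpace (𝓡 n) x}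
    (h : ∀ u, g.inner x u v = g.inner x u w) : v = w := by
  refine (flat_bijective g x).1 (LinearMap.ext fun u => ?_)
  refine (g.symm x v u).trans ((h u).trans (g.symm x u w))

theorem contDiff_comp_curve {r : WithTop ℕ∞} (hr : r ≤ (∞ : WithTop ℕ∞)) {c : ℝ → M}
    (hc : ContMDiff 𝓘(ℝ, ℝ) (𝓡 n) r c) (F : C^∞⟮𝓡 n, M; 𝓘(ℝ, ℝ), ℝ⟯) :
    ContDiff ℝ r fun s => F (c s) :=
  ((F.contMDiff.of_le hr).comp hc).contDiff

theorem contDiff_deriv_comp_curve {c : ℝ → M} (hc : ContMDiff 𝓘(ℝ, ℝ) (𝓡 n) 2 c)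
    (F : C^∞⟮𝓡 n, M; 𝓘(ℝ, ℝ), ℝ⟯) : ContDiff ℝ 1 (deriv fun s => F (c s)) :=
  ((contDiff_succ_iff_deriv (n := 1)).1 (contDiff_comp_curve two_le_infty hc F)).2.2

theorem contDiff_momentum {c : ℝ → M} (hc : ContMDiff 𝓘(ℝ, ℝ) (𝓡 n) 2 c)
    (a : ι → ι → C^∞⟮𝓡 n, M; 𝓘(ℝ, ℝ), ℝ⟯) (p : ι → C^∞⟮𝓡 n, M; 𝓘(ℝ, ℝ), ℝ⟯) (j : ι) :
    ContDiff ℝ 1 fun s => ∑ i, a i j (c s) * deriv (fun r => p i (c r)) s :=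
  ContDiff.sum fun i _ => ((contDiff_comp_curve two_le_infty hc (a i j)).of_le one_le_two).mul
    (contDiff_deriv_comp_curve hc (p i))

theorem velocity_comp_mul {c : ℝ → M} (hc : ContMDiff 𝓘(ℝ, ℝ) (𝓡 n) 2 c) (a t : ℝ) :
    velocity (fun s => c (a * s)) t = a • velocity (n := n) c (a * t) := by
  have h1 : HasMFDerivAt 𝓘(ℝ, ℝ) 𝓘(ℝ, ℝ) (fun s : ℝ => a * s) t
      (ContinuousLinearMap.toSpanSingleton ℝ a) := by
    have : HasDerivAt (fun s : ℝ => a * s) a t := by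
      simpa using (hasDerivAt_id t).const_mul a
    exact this.hasFDerivAt.hasMFDerivAt
  have h2 := (hc.mdifferentiableAt (x := a * t) (by simp)).hasMFDerivAt.comp t h1
  have h3 := congrArg (fun L => L (1 : ℝ)) h2.mfderiv
  refine h3.trans ?_
  have h4 : ContinuousLinearMap.toSpanSingleton ℝ a (1 : ℝ) = a • (1 : ℝ) := by simp
  refine (congrArg (mfderiv 𝓘(ℝ, ℝ) (𝓡 n) c (a * t)) h4).trans ?_
  exact map_smul (mfderiv 𝓘(ℝ, ℝ) (𝓡 n) c (a * t)) a (1 : ℝ)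

/-- The covariant acceleration is homogeneous of degree two in the speed of the parametrization. -/
theorem covariantAcceleration_comp_mul [T2Space M] [CompactSpace M] (g : Metric n M) {c : ℝ → M}
    (hc : ContMDiff 𝓘(ℝ, ℝ) (𝓡 n) 2 c) (a t : ℝ) :
    covariantAcceleration g (fun s => c (a * s)) t = (a ^ 2) • covariantAcceleration g c (a * t) := by
  obtain ⟨S, ⟨Fr⟩⟩ := exists_smoothFrame n M
  have hc' : ContMDiff 𝓘(ℝ, ℝ) (𝓡 n) 2 (fun s => c (a * s)) :=
    hc.comp (contDiff_const.mul contDiff_id).contMDiff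
  refine eq_of_inner_eq g fun u => ?_
  rw [map_smul, Fr.inner_covariantAcceleration g (hc' t) u,
    Fr.inner_covariantAcceleration g (hc (a * t)) u, smul_eq_mul, Finset.mul_sum]
  have h1 : ∀ F : C^∞⟮𝓡 n, M; 𝓘(ℝ, ℝ), ℝ⟯, ∀ s, deriv (fun r => F (c (a * r))) s
      = a * deriv (fun r => F (c r)) (a * s) := fun F s =>
    deriv_comp_mul_left a (fun r => F (c r)) s
  refine Finset.sum_congr rfl fun j _ => ?_
  have h2 : deriv (fun s => ∑ i, Fr.gram g i j (c (a * s))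
      * (a * deriv (fun r => Fr.fn i (c r)) (a * s))) t
      = a * (a * deriv (fun s => ∑ i, Fr.gram g i j (c s) * deriv (fun r => Fr.fn i (c r)) s)
        (a * t)) := by
    have h3 := deriv_comp_mul_left a
      (fun s => ∑ i, Fr.gram g i j (c s) * deriv (fun r => Fr.fn i (c r)) s) t
    rw [smul_eq_mul] at h3
    rw [← h3, ← deriv_const_mul_field]
    congr 1
    ext1 s
    rw [Finset.mul_sum]
    exact Finset.sum_congr rfl fun i _ => by ring
  simp only [h1, h2]
  rw [mul_sub, Finset.mul_sum, Finset.mul_sum, Finset.mul_sum]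
  refine congrArg₂ (· - ·) (by ring) (Finset.sum_congr rfl fun i _ => by ring)

/-- The derivative of the kinetic energy. -/
theorem SmoothFrame.hasDerivAt_quadDensity (Fr : SmoothFrame n M ι) (g : Metric n M) {c : ℝ → M}
    (hc : ContMDiff 𝓘(ℝ, ℝ) (𝓡 n) 2 c) (t : ℝ) :
    HasDerivAt (quadDensity (Fr.gram g) Fr.fn c)
      (2 * g.inner (c t) (velocity c t) (covariantAcceleration g c t)) t := by
  have hmd : MDifferentiableAt 𝓘(ℝ, ℝ) (𝓡 n) c t := hc.mdifferentiableAt (by simp)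
  have h1 : ∀ F : C^∞⟮𝓡 n, M; 𝓘(ℝ, ℝ), ℝ⟯,
      HasDerivAt (fun r => F (c r)) (deriv (fun r => F (c r)) t) t := fun F =>
    ((contDiff_comp_curve two_le_infty hc F).differentiable (by simp) t).hasDerivAt
  have h2 : ∀ F : C^∞⟮𝓡 n, M; 𝓘(ℝ, ℝ), ℝ⟯,
      HasDerivAt (deriv fun r => F (c r)) (deriv (deriv fun r => F (c r)) t) t := fun F =>
    ((contDiff_deriv_comp_curve hc F).differentiable (by simp) t).hasDerivAt
  have h3 : ∀ j, HasDerivAt (fun s => ∑ i, Fr.gram g i j (c s) * deriv (fun r => Fr.fn i (c r)) s)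
      (∑ i, (deriv (fun r => Fr.gram g i j (c r)) t * deriv (fun r => Fr.fn i (c r)) t
        + Fr.gram g i j (c t) * deriv (deriv fun r => Fr.fn i (c r)) t)) t := fun j =>
    HasDerivAt.fun_sum fun i _ => (h1 _).mul (h2 _)
  have h4 : HasDerivAt (quadDensity (Fr.gram g) Fr.fn c) _ t :=
    HasDerivAt.fun_sum (u := Finset.univ) fun j _ => (h3 j).mul (h2 (Fr.fn j))
  refine h4.congr_deriv ?_
  rw [Fr.inner_covariantAcceleration g (hc t)]
  simp only [(h3 _).deriv, ← (hasDerivAt_comp_velocity _ hmd).deriv]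
  have h5 := sum_bilinear_comm (fun i j => congrArg (fun F => F (c t)) (Fr.gram_symm g i j))
    (fun i => deriv (fun r => Fr.fn i (c r)) t) (fun i => deriv (deriv fun r => Fr.fn i (c r)) t)
  rw [Finset.sum_add_distrib, h5, Finset.sum_sub_distrib, mul_sub, ← Finset.mul_sum]
  simp only [Finset.sum_add_distrib, add_mul, mul_add, Finset.sum_mul, Finset.mul_sum]
  have h6 : ∀ i j, deriv (fun r => Fr.fn j (c r)) t * (Fr.gram g i j (c t)
      * deriv (deriv fun r => Fr.fn i (c r)) t) = Fr.gram g i j (c t)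
      * deriv (deriv fun r => Fr.fn i (c r)) t * deriv (fun r => Fr.fn j (c r)) t := fun i j => by
    ring
  have h7 : ∀ i j, deriv (fun r => Fr.fn j (c r)) t * (deriv (fun r => Fr.gram g i j (c r)) t
      * deriv (fun r => Fr.fn i (c r)) t) = deriv (fun r => Fr.gram g i j (c r)) t
      * deriv (fun r => Fr.fn i (c r)) t * deriv (fun r => Fr.fn j (c r)) t := fun i j => by
    ring
  simp only [h6, h7, ← Finset.mul_sum]
  ring

end BaseCurves

/-! ### Critical points project to closed magnetic geodesics -/

section CriticalToGeodesic

variable {n : ℕ} {M : Type*} [TopologicalSpace M] [T2Space M] [CompactSpace M]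
  [ChartedSpace (EuclideanSpace ℝ (Fin n)) M] [IsManifold (𝓡 n) ∞ M]
  {E : Type*} [TopologicalSpace E] [T2Space E]
  [ChartedSpace (EuclideanSpace ℝ (Fin (n + 1))) E] [IsManifold (𝓡 (n + 1)) ∞ E]
  [MulAction Circle E] {τ : E → M} {ι κ : Type*} [Fintype ι] [Fintype κ]
  {g : Metric n M} {θ : OneForm (n + 1) E} {k : ℝ} {γ : H1Loop (n + 1) E} {T : Ioi (0 : ℝ)} {φ : ℝ}

namespace IsPrincipalCircleBundle

/-- The exterior derivative of the connection form, evaluated on the velocity of a curve, is the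
curvature on the velocity of the projection. -/
theorem magneticForce_eq (hτ : IsPrincipalCircleBundle n τ) (FE : SmoothFrame (n + 1) E κ)
    {σ : TwoForm n M} (hσ : HasCurvature τ θ σ) {c : ℝ → E} {t : ℝ}
    (hc : MDifferentiableAt 𝓘(ℝ, ℝ) (𝓡 (n + 1)) c t) (l : κ) :
    magneticForce (FE.coeff θ) FE.fn (FE.along l) c t
      = σ.form (τ (c t)) (mfderiv (𝓡 (n + 1)) (𝓡 n) τ (c t) (variationField (FE.flow l) (c t)))
        (velocity (fun s => τ (c s)) t) := by
  have h1 : θ.d (c t) (variationField (FE.flow l) (c t)) (velocity c t)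
      = σ.form (τ (c t)) (mfderiv (𝓡 (n + 1)) (𝓡 n) τ (c t) (variationField (FE.flow l) (c t)))
        (velocity (fun s => τ (c s)) t) := by
    rw [hσ, ← hτ.velocity_proj hc]
  rw [← h1, θ.d_eq_sum (FE.coeff θ) FE.fn (FE.form_eq_sum θ)]
  refine Finset.sum_congr rfl fun i _ => ?_
  rw [(hasDerivAt_comp_velocity _ hc).deriv, (hasDerivAt_comp_velocity _ hc).deriv, FE.along_apply,
    FE.along_apply]

/-- The first variation of the kinetic energy along a variation whose projection has velocity `u`:
up to a total derivative it is `-g(u, ∇ₜν')`. -/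
theorem quadVariation_eq (hτ : IsPrincipalCircleBundle n τ) (FM : SmoothFrame n M ι) {c : ℝ → E}
    (hν : ContMDiff 𝓘(ℝ, ℝ) (𝓡 n) 2 fun s => τ (c s)) {t : ℝ}
    {D : C^∞⟮𝓡 (n + 1), E; 𝓘(ℝ, ℝ), ℝ⟯ → ℝ → ℝ}
    (hD : ∀ i, DifferentiableAt ℝ (D (hτ.pull (FM.fn i))) t) {u : TangentSpace (𝓡 n) (τ (c t))}
    (hu : ∀ F : C^∞⟮𝓡 n, M; 𝓘(ℝ, ℝ), ℝ⟯, D (hτ.pull F) t = differential F (τ (c t)) u) :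
    quadVariation (fun i j => hτ.pull (FM.gram g i j)) (fun i => hτ.pull (FM.fn i)) c D t
      = deriv (fun s => ∑ j, (∑ i, FM.gram g i j (τ (c s))
          * deriv (fun r => FM.fn i (τ (c r))) s) * D (hτ.pull (FM.fn j)) s) t
        - g.inner (τ (c t)) u (covariantAcceleration g (fun s => τ (c s)) t) := by
  set ν : ℝ → M := fun s => τ (c s) with hνdef
  have hsymm : ∀ i j s, FM.gram g i j (ν s) = FM.gram g j i (ν s) := fun i j s => by
    rw [FM.gram_symm]
  set A : ι → ℝ → ℝ := fun j s => ∑ i, FM.gram g i j (ν s) * deriv (fun r => FM.fn i (ν r)) s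
    with hA
  have hA1 : ∀ j, HasDerivAt (A j) (deriv (A j) t) t := fun j =>
    ((contDiff_momentum hν (FM.gram g) FM.fn j).differentiable one_ne_zero t).hasDerivAt
  set x : ι → ℝ → ℝ := fun j => D (hτ.pull (FM.fn j)) with hx
  have h3 : HasDerivAt (fun s => ∑ j, A j s * x j s)
      (∑ j, (deriv (A j) t * x j t + A j t * deriv (x j) t)) t :=
    HasDerivAt.fun_sum fun j _ => (hA1 j).mul (hD j).hasDerivAt
  have h5 : ∑ j, A j t * deriv (x j) t = ∑ j, ∑ i, FM.gram g i j (ν t) * deriv (x i) t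
      * deriv (fun r => FM.fn j (ν r)) t := by
    have h6 := sum_bilinear_comm (hsymm · · t) (fun i => deriv (fun r => FM.fn i (ν r)) t)
      (fun i => deriv (x i) t)
    rw [hA]
    simp only
    rw [h6]
    exact Finset.sum_congr rfl fun j _ => Finset.sum_mul ..
  have h7 : quadVariation (fun i j => hτ.pull (FM.gram g i j)) (fun i => hτ.pull (FM.fn i)) c D t
      = 1 / 2 * ∑ j, ∑ i, D (hτ.pull (FM.gram g i j)) t
          * deriv (fun r => FM.fn i (ν r)) t * deriv (fun r => FM.fn j (ν r)) t
        + ∑ j, A j t * deriv (x j) t := by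
    rw [h5, Finset.mul_sum, ← Finset.sum_add_distrib]
    refine Finset.sum_congr rfl fun j _ => ?_
    rw [Finset.mul_sum, ← Finset.sum_add_distrib]
    refine Finset.sum_congr rfl fun i _ => ?_
    rw [← mul_assoc, ← mul_assoc]
    rfl
  have h8 := FM.inner_covariantAcceleration g (hν t) u
  have hu' : ∀ F, differential F (ν t) u = D (hτ.pull F) t := fun F => (hu F).symm
  simp only [hu'] at h8
  have h9 : g.inner (ν t) u (covariantAcceleration g ν t) = ∑ j, x j t * deriv (A j) t
      - 1 / 2 * ∑ j, ∑ i, D (hτ.pull (FM.gram g i j)) t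
          * deriv (fun r => FM.fn i (ν r)) t * deriv (fun r => FM.fn j (ν r)) t := by
    refine h8.trans ?_
    rw [Finset.sum_sub_distrib, ← Finset.mul_sum]
  rw [h7, h3.deriv, Finset.sum_add_distrib]
  refine Eq.trans ?_ (congrArg₂ (· - ·) rfl h9.symm)
  have h10 : ∑ j, x j t * deriv (A j) t = ∑ j, deriv (A j) t * x j t :=
    Finset.sum_congr rfl fun j _ => mul_comm _ _
  rw [h10]
  ring

/-- The Euler-Lagrange equation of the kinetic energy, for the projection of a curve. -/
theorem inner_covariantAcceleration_eq (hτ : IsPrincipalCircleBundle n τ) (FM : SmoothFrame n M ι)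
    (FE : SmoothFrame (n + 1) E κ) {c : ℝ → E}
    (hc : ContMDiff 𝓘(ℝ, ℝ) (𝓡 (n + 1)) 2 c) (l : κ) {t r : ℝ}
    (h : HasDerivAt (momentum (fun i j => hτ.pull (FM.gram g i j)) (fun i => hτ.pull (FM.fn i))
        (FE.along l) c)
      (kineticForce (fun i j => hτ.pull (FM.gram g i j)) (fun i => hτ.pull (FM.fn i))
        (FE.along l) c t + r) t) :
    g.inner (τ (c t)) (mfderiv (𝓡 (n + 1)) (𝓡 n) τ (c t) (variationField (FE.flow l) (c t)))
      (covariantAcceleration g (fun s => τ (c s)) t) = r := by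
  have hν2 : ContMDiff 𝓘(ℝ, ℝ) (𝓡 n) 2 fun s => τ (c s) :=
    (hτ.contMDiff_proj.of_le two_le_infty).comp hc
  have h1 : ∀ s, momentum (fun i j => hτ.pull (FM.gram g i j)) (fun i => hτ.pull (FM.fn i))
      (FE.along l) c s = ∑ j, (∑ i, FM.gram g i j (τ (c s))
          * deriv (fun r => FM.fn i (τ (c r))) s) * FE.along l (hτ.pull (FM.fn j)) (c s) := by
    intro s
    rw [sum_bilinear_comm (fun i j => by rw [FM.gram_symm])]
    refine Finset.sum_congr rfl fun j _ => ?_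
    rw [Finset.sum_mul]
    rfl
  have h2 := (h.congr_of_eventuallyEq (.of_forall fun s => (h1 s).symm)).deriv
  have h3 := hτ.quadVariation_eq (g := g) FM hν2 (t := t) (D := fun F s => FE.along l F (c s))
    (u := mfderiv (𝓡 (n + 1)) (𝓡 n) τ (c t) (variationField (FE.flow l) (c t)))
    (fun i => (contDiff_comp_curve two_le_infty hc _).differentiable (by simp) t)
    (fun F => by rw [FE.along_apply, hτ.differential_pull])
  rw [h2] at h3
  have h4 : kineticForce (fun i j => hτ.pull (FM.gram g i j)) (fun i => hτ.pull (FM.fn i))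
        (FE.along l) c t = _ := h3
  linarith

/-- The projection of a critical point is a closed magnetic geodesic. The energy is constant by
skew-symmetry of the Lorentz force; its value is found by varying the period. -/
theorem isClosedMagneticGeodesic_of_critical (hτ : IsPrincipalCircleBundle n τ)
    (hθ : IsConnectionForm θ) {σ : TwoForm n M} (hσ : HasCurvature τ θ σ)
    (hcrit : IsCriticalPoint (actionFunctional g τ θ k) (γ, T, φ)) :
    IsClosedMagneticGeodesic g σ T (k - 1 / 2) (fun t : ℝ => τ (γ.toFun (t / (T : ℝ)))) := by
  have hE : CompactSpace E := hτ.compactSpace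
  obtain ⟨S, ⟨FM⟩⟩ := exists_smoothFrame n M
  obtain ⟨S', ⟨FE⟩⟩ := exists_smoothFrame (n + 1) E
  have hT : (0 : ℝ) < T := T.2
  obtain ⟨hC2, hEL⟩ := hτ.regularity_of_critical FM FE hθ hσ hcrit
  have hc2 : ContMDiff 𝓘(ℝ, ℝ) (𝓡 (n + 1)) 2 γ.toFun := fun t =>
    FE.contMDiffAt_curve two_le_infty γ.continuous.continuousAt fun l => (hC2 _).contDiffAt
  set ν : ℝ → M := fun s => τ (γ.toFun s) with hν
  have hν2 : ContMDiff 𝓘(ℝ, ℝ) (𝓡 n) 2 ν := (hτ.contMDiff_proj.of_le two_le_infty).comp hc2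
  have hacc : ∀ t, covariantAcceleration g ν t
      = (T : ℝ) • lorentzForce g σ (ν t) (velocity ν t) := by
    intro t
    have hmd : MDifferentiableAt 𝓘(ℝ, ℝ) (𝓡 (n + 1)) γ.toFun t := hc2.mdifferentiableAt (by simp)
    refine eq_of_inner_eq g fun u => ?_
    obtain ⟨w, rfl⟩ := hτ.mfderiv_proj_surjective (γ.toFun t) u
    rw [map_smul, inner_lorentzForce, ← FE.sum_smul _ w, smul_eq_mul]
    simp only [map_sum, map_smul, FunLike.coe_sum, Finset.sum_apply, smul_apply, smul_eq_mul,
      Finset.mul_sum]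
    refine Finset.sum_congr rfl fun l _ => ?_
    rw [hτ.inner_covariantAcceleration_eq FM FE hc2 l (hEL l t), hτ.magneticForce_eq FE hσ hmd]
    ring
  have hen : ∀ t, quadDensity (FM.gram g) FM.fn ν t = quadDensity (FM.gram g) FM.fn ν 0 := by
    have h1 : ∀ t, HasDerivAt (quadDensity (FM.gram g) FM.fn ν) 0 t := fun t => by
      refine (FM.hasDerivAt_quadDensity g hν2 t).congr_deriv ?_
      rw [hacc, map_smul, inner_lorentzForce, σ.alternating, smul_zero, mul_zero]
    exact fun t => is_const_of_deriv_eq_zero (fun s => (h1 s).differentiableAt)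
      (fun s => (h1 s).deriv) t 0
  have hinner : ∀ t, g.inner (ν t) (velocity ν t) (velocity ν t)
      = quadDensity (FM.gram g) FM.fn ν t := fun t => by
    have hmd : MDifferentiableAt 𝓘(ℝ, ℝ) (𝓡 n) ν t := hν2.mdifferentiableAt (by simp)
    rw [FM.inner_eq_sum, quadDensity]
    simp only [(hasDerivAt_comp_velocity _ hmd).deriv]
  have hk : quadDensity (FM.gram g) FM.fn ν 0 = 2 * T ^ 2 * (k - 1 / 2) := by
    have h1 := hτ.integral_eq_of_critical FM FE hθ hcrit
    have h2 : ∫ t in (0 : ℝ)..1, quadDensity (fun i j => hτ.pull (FM.gram g i j))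
        (fun i => hτ.pull (FM.fn i)) γ.toFun t = quadDensity (FM.gram g) FM.fn ν 0 := by
      refine (intervalIntegral.integral_congr (g := fun _ => quadDensity (FM.gram g) FM.fn ν 0)
        fun t _ => hen t).trans ?_
      simp
    have h3 : ∫ t in (0 : ℝ)..1, (linDensity (FE.coeff θ) FE.fn γ.toFun t + φ) ^ 2
        = (T : ℝ) ^ 2 := by
      rw [intervalIntegral.integral_congr_ae_restrict (g := fun _ => (T : ℝ) ^ 2) (by
        rw [uIoc_of_le zero_le_one]
        filter_upwards [hτ.linDensity_eq_of_critical FE hθ hσ hcrit] with t ht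
        rw [ht])]
      simp
    rw [h2, h3] at h1
    field_simp at h1
    linarith
  have hμ : (fun t : ℝ => τ (γ.toFun (t / (T : ℝ)))) = fun t => ν ((T : ℝ)⁻¹ * t) := by
    ext1 t
    rw [hν, div_eq_inv_mul]
  rw [hμ]
  refine ⟨hν2.comp (contDiff_const.mul contDiff_id).contMDiff, fun t => ?_, fun t => ?_,
    fun t => ?_⟩
  · have h1 : (T : ℝ)⁻¹ * (t + T) = (T : ℝ)⁻¹ * t + 1 := by field_simp
    simp only [hν, h1, γ.periodic _]
  · rw [covariantAcceleration_comp_mul g hν2, velocity_comp_mul hν2, hacc]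
    refine eq_of_inner_eq g fun u => ?_
    rw [map_smul, map_smul, inner_lorentzForce, inner_lorentzForce, map_smul, smul_eq_mul,
      smul_eq_mul, smul_eq_mul]
    field_simp
  · rw [velocity_comp_mul hν2, map_smul, map_smul, smul_apply, hinner, hen, hk, smul_eq_mul,
      smul_eq_mul]
    field_simp

end IsPrincipalCircleBundle

end CriticalToGeodesic

/-! ### Lifts of curves to the total space -/

section Lift

variable {n : ℕ} {M : Type*} [TopologicalSpace M] [T2Space M] [CompactSpace M]
  [ChartedSpace (EuclideanSpace ℝ (Fin n)) M] [IsManifold (𝓡 n) ∞ M]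
  {E : Type*} [TopologicalSpace E] [T2Space E]
  [ChartedSpace (EuclideanSpace ℝ (Fin (n + 1))) E] [IsManifold (𝓡 (n + 1)) ∞ E]
  [MulAction Circle E] {τ : E → M} {ι κ : Type*} [Fintype ι] [Fintype κ]
  {g : Metric n M} {θ : OneForm (n + 1) E}

/-- `c` is, near every point of `s`, a differentiable lift of `ν`, and the connection form takes
the value `β` on its velocity. -/
structure IsLiftOn (τ : E → M) (θ : OneForm (n + 1) E) (ν : ℝ → M) (β : ℝ) (s : Set ℝ)
    (c : ℝ → E) : Prop where
  mdifferentiableAt : ∀ t ∈ s, MDifferentiableAt 𝓘(ℝ, ℝ) (𝓡 (n + 1)) c t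
  proj : ∀ t ∈ s, ∀ᶠ r in 𝓝 t, τ (c r) = ν r
  form : ∀ t ∈ s, θ.form (c t) (velocity c t) = β

namespace IsPrincipalCircleBundle

/-- The circle acts transitively on the fibres. -/
theorem exists_smul_eq (hτ : IsPrincipalCircleBundle n τ) {q q' : E} (h : τ q = τ q') :
    ∃ α : ℝ, q' = rotate (α, q) := by
  obtain ⟨e, he, -, -, hs⟩ := hτ.exists_trivialization (τ q)
  have hq : q ∈ e.source := e.mem_source.2 he
  have hq' : q' ∈ e.source := e.mem_source.2 (h ▸ he)
  obtain ⟨α, hα⟩ := Circle.exp_surjective ((e q').2 * (e q).2⁻¹)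
  refine ⟨α, e.injOn hq' (e.mem_source.2 ?_) ?_⟩
  · rw [rotate, hτ.proj_smul]
    exact he
  · refine Eq.trans ?_ (hs _ q hq).symm
    refine Prod.ext ((e.coe_fst hq').trans h.symm) ?_
    simp only
    rw [hα, inv_mul_cancel_right]
    rfl

/-- The orbits of the circle action are integral curves of the fundamental field. -/
theorem mfderiv_rotate_fst (hτ : IsPrincipalCircleBundle n τ) (a : ℝ) (q : E) :
    (mfderiv 𝓘(ℝ, ℝ) (𝓡 (n + 1)) (fun s => rotate (s, q)) a :
      ℝ →L[ℝ] EuclideanSpace ℝ (Fin (n + 1))) (1 : ℝ) = fundamentalField n (rotate (a, q)) := by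
  set q₁ := rotate (a, q) with hq₁
  have h1 : (fun s => rotate (s, q)) = (fun s => rotate (s, q₁)) ∘ fun s : ℝ => s - a := by
    ext1 s
    simp only [Function.comp, hq₁, rotate, smul_smul, ← Circle.exp_add, sub_add_cancel]
  have h2 : MDifferentiableAt 𝓘(ℝ, ℝ) (𝓡 (n + 1)) (fun s : ℝ => rotate (s, q₁)) 0 :=
    (hτ.contMDiff_rotate.comp (contMDiff_id.prodMk contMDiff_const)).mdifferentiableAt (by simp)
  have h3 : HasMFDerivAt 𝓘(ℝ, ℝ) 𝓘(ℝ, ℝ) (fun s : ℝ => s - a) a (ContinuousLinearMap.id ℝ ℝ) :=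
    ((hasFDerivAt_id a).sub_const a).hasMFDerivAt
  have key : ∀ (f : ℝ → E) (b : ℝ) (hb : b = 0), MDifferentiableAt 𝓘(ℝ, ℝ) (𝓡 (n + 1)) f 0 →
      HasMFDerivAt 𝓘(ℝ, ℝ) (𝓡 (n + 1)) f b
        (mfderiv 𝓘(ℝ, ℝ) (𝓡 (n + 1)) f 0 : ℝ →L[ℝ] EuclideanSpace ℝ (Fin (n + 1))) := by
    rintro f _ rfl h
    exact h.hasMFDerivAt
  have h4' := (key (fun s => rotate (s, q₁)) (a - a) (sub_self a) h2)
  have h4 := HasMFDerivAt.comp (f := fun s : ℝ => s - a) a h4' h3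
  rw [← h1] at h4
  exact congrArg (fun L : ℝ →L[ℝ] EuclideanSpace ℝ (Fin (n + 1)) => L (1 : ℝ)) h4.mfderiv

/-- Rotation of a curve by a time-dependent angle `α` adds `α'` to its vertical speed. -/
theorem form_velocity_rotate (hτ : IsPrincipalCircleBundle n τ) (hθ : IsConnectionForm θ)
    {c : ℝ → E} {α : ℝ → ℝ} {α' t : ℝ} (hα : HasDerivAt α α' t)
    (hc : MDifferentiableAt 𝓘(ℝ, ℝ) (𝓡 (n + 1)) c t) :
    MDifferentiableAt 𝓘(ℝ, ℝ) (𝓡 (n + 1)) (fun s => rotate (α s, c s)) t ∧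
    θ.form (rotate (α t, c t)) (velocity (fun s => rotate (α s, c s)) t)
      = θ.form (c t) (velocity c t) + α' := by
  have hG : MDifferentiableAt (𝓘(ℝ, ℝ).prod (𝓡 (n + 1))) (𝓡 (n + 1)) (rotate (E := E))
      (α t, c t) := hτ.contMDiff_rotate.mdifferentiableAt (by simp)
  have h1 := hα.hasFDerivAt.hasMFDerivAt.prodMk hc.hasMFDerivAt
  have h2 := hG.hasMFDerivAt.comp t h1
  refine ⟨h2.mdifferentiableAt, ?_⟩
  set z := rotate (α t, c t) with hz
  set V : EuclideanSpace ℝ (Fin (n + 1)) := velocity c t with hV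
  set A : ℝ →L[ℝ] EuclideanSpace ℝ (Fin (n + 1)) :=
    mfderiv 𝓘(ℝ, ℝ) (𝓡 (n + 1)) (fun s => rotate (s, c t)) (α t) with hA
  set B : EuclideanSpace ℝ (Fin (n + 1)) →L[ℝ] EuclideanSpace ℝ (Fin (n + 1)) :=
    mfderiv (𝓡 (n + 1)) (𝓡 (n + 1)) (fun q : E => Circle.exp (α t) • q) (c t) with hB
  have h4 : ContinuousLinearMap.toSpanSingleton ℝ α' (1 : ℝ) = α' := by simp
  have h3 : velocity (fun s => rotate (α s, c s)) t = A α' + B V := by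
    have e1 := congrArg (fun L => L (1 : ℝ)) h2.mfderiv
    refine e1.trans ?_
    refine Eq.trans ?_ (mfderiv_prod_eq_add_apply (p := (α t, c t))
      (v := ((α', V) : TangentSpace (𝓘(ℝ, ℝ).prod (𝓡 (n + 1))) (α t, c t))) hG)
    conv_rhs => rw [← h4]
    rfl
  have h5 : A α' = α' • fundamentalField n z := by
    have e1 : A α' = α' • A 1 := by
      rw [← map_smul, smul_eq_mul, mul_one]
    rw [e1]
    exact congrArg (α' • ·) (hτ.mfderiv_rotate_fst (α t) (c t))
  have h6 : θ.form z (B V) = θ.form (c t) (velocity c t) := hθ.invariant _ _ _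
  rw [← h6]
  refine (congrArg (θ.form z) h3).trans ?_
  refine ((θ.form z).map_add _ _).trans ?_
  rw [add_comm]
  refine congrArg₂ (· + ·) rfl ?_
  refine (congrArg (θ.form z) h5).trans ?_
  refine ((θ.form z).map_smul α' (fundamentalField n z)).trans ?_
  rw [hθ.normalized, smul_eq_mul, mul_one]

end IsPrincipalCircleBundle

end Lift

/-! ### Horizontal lifts over an interval -/

section HorizontalLift

variable {n : ℕ} {M : Type*} [TopologicalSpace M] [T2Space M] [CompactSpace M]
  [ChartedSpace (EuclideanSpace ℝ (Fin n)) M] [IsManifold (𝓡 n) ∞ M]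
  {E : Type*} [TopologicalSpace E] [T2Space E]
  [ChartedSpace (EuclideanSpace ℝ (Fin (n + 1))) E] [IsManifold (𝓡 (n + 1)) ∞ E]
  [MulAction Circle E] {τ : E → M} {θ : OneForm (n + 1) E} {ν : ℝ → M}

namespace IsLiftOn

open IsPrincipalCircleBundle

theorem rotate_const (hτ : IsPrincipalCircleBundle n τ) (hθ : IsConnectionForm θ) {β : ℝ}
    {s : Set ℝ} {c : ℝ → E} (h : IsLiftOn τ θ ν β s c) (a : ℝ) :
    IsLiftOn τ θ ν β s fun t => rotate (a, c t) where
  mdifferentiableAt t ht :=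
    (hτ.form_velocity_rotate hθ (hasDerivAt_const t a) (h.mdifferentiableAt t ht)).1
  proj t ht := by
    filter_upwards [h.proj t ht] with r hr
    rw [rotate, hτ.proj_smul, hr]
  form t ht := by
    rw [(hτ.form_velocity_rotate hθ (hasDerivAt_const t a) (h.mdifferentiableAt t ht)).2,
      h.form t ht, add_zero]

theorem rotate_mul (hτ : IsPrincipalCircleBundle n τ) (hθ : IsConnectionForm θ) {β : ℝ}
    {s : Set ℝ} {c : ℝ → E} (h : IsLiftOn τ θ ν β s c) (a : ℝ) :
    IsLiftOn τ θ ν (β + a) s fun t => rotate (a * t, c t) where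
  mdifferentiableAt t ht := by
    have h1 : HasDerivAt (fun t : ℝ => a * t) a t := by
      simpa using (hasDerivAt_id t).const_mul a
    exact (hτ.form_velocity_rotate hθ h1 (h.mdifferentiableAt t ht)).1
  proj t ht := by
    filter_upwards [h.proj t ht] with r hr
    rw [rotate, hτ.proj_smul, hr]
  form t ht := by
    have h1 : HasDerivAt (fun t : ℝ => a * t) a t := by
      simpa using (hasDerivAt_id t).const_mul a
    rw [(hτ.form_velocity_rotate hθ h1 (h.mdifferentiableAt t ht)).2, h.form t ht]

theorem mono {β : ℝ} {s s' : Set ℝ} {c : ℝ → E} (h : IsLiftOn τ θ ν β s c) (hs : s' ⊆ s) :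
    IsLiftOn τ θ ν β s' c :=
  ⟨fun t ht => h.mdifferentiableAt t (hs ht), fun t ht => h.proj t (hs ht),
    fun t ht => h.form t (hs ht)⟩

theorem union {β : ℝ} {s s' : Set ℝ} {c : ℝ → E} (h : IsLiftOn τ θ ν β s c)
    (h' : IsLiftOn τ θ ν β s' c) : IsLiftOn τ θ ν β (s ∪ s') c :=
  ⟨fun t ht => ht.elim (h.mdifferentiableAt t) (h'.mdifferentiableAt t),
    fun t ht => ht.elim (h.proj t) (h'.proj t), fun t ht => ht.elim (h.form t) (h'.form t)⟩

theorem congr [CompactSpace E] {β : ℝ} {s : Set ℝ} {c c' : ℝ → E} (h : IsLiftOn τ θ ν β s c)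
    (hc : ∀ t ∈ s, c' =ᶠ[𝓝 t] c) : IsLiftOn τ θ ν β s c' where
  mdifferentiableAt t ht := (h.mdifferentiableAt t ht).congr_of_eventuallyEq (hc t ht)
  proj t ht := by
    filter_upwards [h.proj t ht, hc t ht] with r hr hr'
    rw [hr', hr]
  form t ht := by
    obtain ⟨S, ⟨Fr⟩⟩ := exists_smoothFrame (n + 1) E
    have h1 := h.mdifferentiableAt t ht
    have h2 := h1.congr_of_eventuallyEq (hc t ht)
    rw [← h.form t ht, Fr.form_eq_sum, Fr.form_eq_sum]
    refine Finset.sum_congr rfl fun k _ => ?_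
    rw [← (hasDerivAt_comp_velocity (Fr.fn k) h1).deriv, ← (hasDerivAt_comp_velocity (Fr.fn k) h2).deriv,
      (hc t ht).self_of_nhds]
    refine congrArg₂ (· * ·) rfl (EventuallyEq.deriv_eq ?_)
    filter_upwards [hc t ht] with r hr
    rw [hr]

/-- The velocities of two lifts agree where the lifts meet: they have the same projection and the
same vertical part. -/
theorem deriv_eq (hτ : IsPrincipalCircleBundle n τ) (hθ : IsConnectionForm θ) {β : ℝ}
    {s s' : Set ℝ} {c c' : ℝ → E} (h : IsLiftOn τ θ ν β s c) (h' : IsLiftOn τ θ ν β s' c') {t : ℝ}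
    (ht : t ∈ s) (ht' : t ∈ s') (hc : c t = c' t) (F : C^∞⟮𝓡 (n + 1), E; 𝓘(ℝ, ℝ), ℝ⟯) :
    deriv (fun r => F (c r)) t = deriv (fun r => F (c' r)) t := by
  have key : ∀ {d : ℝ → E}, MDifferentiableAt 𝓘(ℝ, ℝ) (𝓡 (n + 1)) d t → (∀ᶠ r in 𝓝 t, τ (d r) = ν r) →
      ∀ q (hq : q = d t), ∃ V : TangentSpace (𝓡 (n + 1)) q,
        (∀ F : C^∞⟮𝓡 (n + 1), E; 𝓘(ℝ, ℝ), ℝ⟯, deriv (fun r => F (d r)) t = differential F q V) ∧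
        θ.form q V = θ.form (d t) (velocity d t) := by
    rintro d hd - _ rfl
    exact ⟨velocity d t, fun F => (hasDerivAt_comp_velocity F hd).deriv, rfl⟩
  obtain ⟨V, hV, hVθ⟩ := key (h.mdifferentiableAt t ht) (h.proj t ht) _ rfl
  obtain ⟨V', hV', hVθ'⟩ := key (h'.mdifferentiableAt t ht') (h'.proj t ht') _ hc
  have h1 : V - V' = 0 := by
    refine hτ.eq_zero_of_mfderiv_proj_eq_zero hθ ?_ ?_
    · obtain ⟨S, ⟨Fr⟩⟩ := exists_smoothFrame n M
      rw [← Fr.sum_smul _ (mfderiv (𝓡 (n + 1)) (𝓡 n) τ (c t) (V - V'))]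
      refine Finset.sum_eq_zero fun k _ => ?_
      rw [← hτ.differential_pull, map_sub, ← hV, ← hV']
      have e1 : deriv (fun r => hτ.pull (Fr.fn k) (c r)) t = deriv (fun r => Fr.fn k (ν r)) t := by
        refine EventuallyEq.deriv_eq ?_
        filter_upwards [h.proj t ht] with r hr
        rw [hτ.pull_apply, hr]
      have e2 : deriv (fun r => hτ.pull (Fr.fn k) (c' r)) t = deriv (fun r => Fr.fn k (ν r)) t := by
        refine EventuallyEq.deriv_eq ?_
        filter_upwards [h'.proj t ht'] with r hr
        rw [hτ.pull_apply, hr]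
      rw [e1, e2, sub_self, zero_smul]
    · rw [map_sub, hVθ, hVθ', h.form t ht, h'.form t ht', sub_self]
  rw [hV, hV', sub_eq_zero.1 h1]

/-- Two lifts over adjacent intervals give one lift over their union: after a constant rotation of
the second one they meet, and where they meet their velocities agree. -/
theorem exists_join (hτ : IsPrincipalCircleBundle n τ) (hθ : IsConnectionForm θ) {β x y z : ℝ}
    (hxy : x ≤ y) (hyz : y ≤ z) {c c' : ℝ → E} (h : IsLiftOn τ θ ν β (Icc x y) c)
    (h' : IsLiftOn τ θ ν β (Icc y z) c') : ∃ d, IsLiftOn τ θ ν β (Icc x z) d := by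
  have hE : CompactSpace E := hτ.compactSpace
  have hy : y ∈ Icc x y := ⟨hxy, le_rfl⟩
  have hy' : y ∈ Icc y z := ⟨le_rfl, hyz⟩
  obtain ⟨a, ha⟩ := hτ.exists_smul_eq (q := c' y) (q' := c y)
    ((h'.proj y hy').self_of_nhds.trans (h.proj y hy).self_of_nhds.symm)
  obtain ⟨c', h', hcc⟩ : ∃ c', IsLiftOn τ θ ν β (Icc y z) c' ∧ c y = c' y :=
    ⟨_, h'.rotate_const hτ hθ a, ha⟩
  set d : ℝ → E := fun t => if t ≤ y then c t else c' t with hd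
  have hdy : d y = c y := by simp [hd]
  have h1 : ∀ t, t < y → d =ᶠ[𝓝 t] c := fun t ht => by
    filter_upwards [Iio_mem_nhds ht] with r hr
    exact if_pos (le_of_lt (mem_Iio.1 hr))
  have h2 : ∀ t, y < t → d =ᶠ[𝓝 t] c' := fun t ht => by
    filter_upwards [Ioi_mem_nhds ht] with r hr
    exact if_neg (not_le.2 (mem_Ioi.1 hr))
  have hL : ∀ r ∈ Iic y, d r = c r := fun r hr => if_pos hr
  have hR : ∀ r ∈ Ici y, d r = c' r := fun r hr => by
    rcases eq_or_lt_of_le (mem_Ici.1 hr) with rfl | hr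
    · rw [hdy, hcc]
    · exact if_neg (not_le.2 hr)
  have h3 : ∀ F : C^∞⟮𝓡 (n + 1), E; 𝓘(ℝ, ℝ), ℝ⟯,
      HasDerivAt (fun r => F (d r)) (deriv (fun r => F (c r)) y) y := by
    intro F
    have e1 : HasDerivWithinAt (fun r => F (d r)) (deriv (fun r => F (c r)) y) (Iic y) y :=
      ((hasDerivAt_comp_velocity F (h.mdifferentiableAt y hy)).differentiableAt.hasDerivAt
        |>.hasDerivWithinAt).congr (fun r hr => by rw [hL r hr]) (by rw [hdy])
    have e2 : HasDerivWithinAt (fun r => F (d r)) (deriv (fun r => F (c r)) y) (Ici y) y := by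
      rw [h.deriv_eq hτ hθ h' hy hy' hcc F]
      exact ((hasDerivAt_comp_velocity F (h'.mdifferentiableAt y hy')).differentiableAt.hasDerivAt
        |>.hasDerivWithinAt).congr (fun r hr => by rw [hR r hr]) (by rw [hdy, hcc])
    have e3 := e1.union e2
    rwa [Iic_union_Ici, hasDerivWithinAt_univ] at e3
  obtain ⟨S, ⟨Fr⟩⟩ := exists_smoothFrame (n + 1) E
  have h4 : MDifferentiableAt 𝓘(ℝ, ℝ) (𝓡 (n + 1)) d y :=
    Fr.mdifferentiableAt_curve (Fr.continuousAt_curve fun k => (h3 _).continuousAt)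
      fun k => (h3 _).differentiableAt
  have h5 : IsLiftOn τ θ ν β {y} d := by
    refine ⟨fun t ht => by rwa [mem_singleton_iff.1 ht], fun t ht => ?_, fun t ht => ?_⟩
    · rw [mem_singleton_iff.1 ht]
      filter_upwards [h.proj y hy, h'.proj y hy'] with r hr hr'
      rcases le_total r y with hle | hle
      · rw [hL r hle, hr]
      · rw [hR r hle, hr']
    · rw [mem_singleton_iff.1 ht, Fr.form_eq_sum, ← h.form y hy, Fr.form_eq_sum]
      refine Finset.sum_congr rfl fun k _ => ?_
      rw [← (hasDerivAt_comp_velocity (Fr.fn k) h4).deriv,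
        ← (hasDerivAt_comp_velocity (Fr.fn k) (h.mdifferentiableAt y hy)).deriv, (h3 _).deriv, hdy]
  have h6 : IsLiftOn τ θ ν β (Ico x y) d := (h.mono Ico_subset_Icc_self).congr fun t ht => h1 t ht.2
  have h7 : IsLiftOn τ θ ν β (Ioc y z) d := (h'.mono Ioc_subset_Icc_self).congr fun t ht => h2 t ht.1
  refine ⟨d, ((h6.union h5).union h7).mono fun t ht => ?_⟩
  rcases lt_trichotomy t y with h | h | h
  · exact Or.inl (Or.inl ⟨ht.1, h⟩)
  · exact Or.inl (Or.inr h)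
  · exact Or.inr ⟨h, ht.2⟩

end IsLiftOn

namespace IsPrincipalCircleBundle

/-- A lift over a trivialized piece: the constant section is made horizontal by a rotation. -/
theorem exists_lift_of_subset (hτ : IsPrincipalCircleBundle n τ) (hθ : IsConnectionForm θ)
    (hν : ContMDiff 𝓘(ℝ, ℝ) (𝓡 n) 2 ν) {x y : ℝ} (hxy : x ≤ y) {e : Trivialization Circle τ}
    (he : ContMDiffOn ((𝓡 n).prod (𝓡 1)) (𝓡 (n + 1)) ∞ e.toOpenPartialHomeomorph.symm e.target)
    (hsub : ∀ t ∈ Icc x y, ν t ∈ e.baseSet) : ∃ c, IsLiftOn τ θ ν 0 (Icc x y) c := by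
  have hE : CompactSpace E := hτ.compactSpace
  obtain ⟨S, ⟨Fr⟩⟩ := exists_smoothFrame (n + 1) E
  set U : Set ℝ := ν ⁻¹' e.baseSet with hU
  have hUo : IsOpen U := e.open_baseSet.preimage hν.continuous
  set c₀ : ℝ → E := fun t => e.toOpenPartialHomeomorph.symm (ν t, 1) with hc₀
  have h1 : ContMDiffOn 𝓘(ℝ, ℝ) (𝓡 (n + 1)) 2 c₀ U := by
    refine (he.of_le two_le_infty).comp (t := e.target)
      (hν.prodMk (contMDiff_const (c := (1 : Circle)))).contMDiffOn ?_
    intro t ht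
    exact e.mem_target.2 ht
  have h2 : ∀ t ∈ U, MDifferentiableAt 𝓘(ℝ, ℝ) (𝓡 (n + 1)) c₀ t := fun t ht =>
    ((h1 t ht).contMDiffAt (hUo.mem_nhds ht)).mdifferentiableAt (by simp)
  set w : ℝ → ℝ := fun t => ∑ k, Fr.coeff θ k (c₀ t) * deriv (fun r => Fr.fn k (c₀ r)) t with hw
  have hF : ∀ F : C^∞⟮𝓡 (n + 1), E; 𝓘(ℝ, ℝ), ℝ⟯, ContDiffOn ℝ 2 (fun r => F (c₀ r)) U := fun F =>
    contMDiffOn_iff_contDiffOn.1 ((F.contMDiff.of_le two_le_infty).comp_contMDiffOn h1)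
  have hwc : ContinuousOn w U := continuousOn_finsetSum _ fun k _ =>
    (hF _).continuousOn.mul ((hF _).continuousOn_deriv_of_isOpen hUo (by simp))
  -- `w` is the vertical speed of the constant section; it is extended continuously to the line
  set w' : ℝ → ℝ := fun t => w (projIcc x y hxy t) with hw'
  have hw'c : Continuous w' := hwc.comp_continuous
    (continuous_subtype_val.comp continuous_projIcc) fun t => hsub _ (projIcc x y hxy t).2
  set α : ℝ → ℝ := fun t => -∫ r in x..t, w' r with hα
  have hα' : ∀ t, HasDerivAt α (-w' t) t := fun t =>
    (intervalIntegral.integral_hasDerivAt_right (hw'c.intervalIntegrable _ _)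
      (hw'c.stronglyMeasurableAtFilter _ _) hw'c.continuousAt).neg
  refine ⟨fun t => rotate (α t, c₀ t), fun t ht => ?_, fun t ht => ?_, fun t ht => ?_⟩
  · exact (hτ.form_velocity_rotate hθ (hα' t) (h2 t (hsub t ht))).1
  · filter_upwards [hUo.mem_nhds (hsub t ht)] with r hr
    rw [rotate, hτ.proj_smul]
    exact e.proj_symm_apply (e.mem_target.2 hr)
  · have hwt : w' t = w t := by simp only [hw', projIcc_of_mem hxy ht]
    rw [(hτ.form_velocity_rotate hθ (hα' t) (h2 t (hsub t ht))).2, Fr.form_eq_sum, hwt,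
      ← sub_eq_add_neg, sub_eq_zero]
    refine Finset.sum_congr rfl fun k _ => ?_
    rw [(hasDerivAt_comp_velocity (Fr.fn k) (h2 t (hsub t ht))).deriv]

/-- Horizontal lifts of curves exist over compact intervals. -/
theorem exists_lift (hτ : IsPrincipalCircleBundle n τ) (hθ : IsConnectionForm θ)
    (hν : ContMDiff 𝓘(ℝ, ℝ) (𝓡 n) 2 ν) : ∃ c, IsLiftOn τ θ ν 0 (Icc 0 1) c := by
  choose e he _ hes _ using hτ.exists_trivialization
  -- a subdivision whose pieces are mapped into trivialized open sets
  obtain ⟨t, ht0, htm, ⟨N, hN⟩, ht⟩ := exists_monotone_Icc_subset_open_cover_Icc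
    (zero_le_one (α := ℝ)) (c := fun p : M => (Subtype.val ⁻¹' (ν ⁻¹' (e p).baseSet) : Set (Icc (0 : ℝ) 1)))
    (fun p => ((e p).open_baseSet.preimage hν.continuous).preimage continuous_subtype_val)
    (fun r _ => mem_iUnion.2 ⟨ν r, he (ν r)⟩)
  have hmono : ∀ i, (t i : ℝ) ≤ t (i + 1) := fun i => htm (Nat.le_succ i)
  have h0 : ∀ i, (t 0 : ℝ) ≤ t i := fun i => htm (Nat.zero_le i)
  have h1 : ∀ i, ∃ c, IsLiftOn τ θ ν 0 (Icc (t i) (t (i + 1))) c := fun i => by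
    obtain ⟨p, hp⟩ := ht i
    refine hτ.exists_lift_of_subset hθ hν (hmono i) (hes p) fun r hr => ?_
    exact hp (show (⟨r, (t i).2.1.trans hr.1, hr.2.trans (t (i + 1)).2.2⟩ : Icc (0 : ℝ) 1) ∈ _
      from ⟨hr.1, hr.2⟩)
  have h2 : ∀ i, ∃ c, IsLiftOn τ θ ν 0 (Icc (t 0) (t (i + 1))) c := fun i => by
    induction i with
    | zero => exact h1 0
    | succ i ih =>
      obtain ⟨c, hc⟩ := ih
      obtain ⟨c', hc'⟩ := h1 (i + 1)
      exact hc.exists_join hτ hθ (h0 _) (hmono _) hc'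
  have h3 := h2 N
  rwa [hN (N + 1) (Nat.le_succ N), ht0] at h3

end IsPrincipalCircleBundle

end HorizontalLift

/-! ### Closed lifts of constant vertical speed -/

section ClosedLift

variable {n : ℕ} {M : Type*} [TopologicalSpace M] [T2Space M] [CompactSpace M]
  [ChartedSpace (EuclideanSpace ℝ (Fin n)) M] [IsManifold (𝓡 n) ∞ M]
  {E : Type*} [TopologicalSpace E] [T2Space E]
  [ChartedSpace (EuclideanSpace ℝ (Fin (n + 1))) E] [IsManifold (𝓡 (n + 1)) ∞ E]
  [MulAction Circle E] {τ : E → M} {θ : OneForm (n + 1) E} {ν : ℝ → M}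

namespace IsPrincipalCircleBundle

/-- The derivatives of functions along a lift of constant vertical speed are continuous, since its
velocity is determined by its position and by the velocity of its projection. -/
theorem exists_continuous_deriv (hτ : IsPrincipalCircleBundle n τ) (hθ : IsConnectionForm θ)
    (g : Metric n M) (hν : ContMDiff 𝓘(ℝ, ℝ) (𝓡 n) 2 ν) {β : ℝ} {c : ℝ → E} (hc : Continuous c)
    (hcν : ∀ t, τ (c t) = ν t) {s : Set ℝ} (h : IsLiftOn τ θ ν β s c)
    (F : C^∞⟮𝓡 (n + 1), E; 𝓘(ℝ, ℝ), ℝ⟯) :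
    ∃ v : ℝ → ℝ, Continuous v ∧ ∀ t ∈ s, HasDerivAt (fun r => F (c r)) (v t) t := by
  classical
  have hE : CompactSpace E := hτ.compactSpace
  obtain ⟨S, ⟨FM⟩⟩ := exists_smoothFrame n M
  obtain ⟨S', ⟨FE⟩⟩ := exists_smoothFrame (n + 1) E
  have hF : ∀ F : C^∞⟮𝓡 (n + 1), E; 𝓘(ℝ, ℝ), ℝ⟯, Continuous fun r => F (c r) := fun F =>
    F.contMDiff.continuous.comp hc
  have hinv : ∀ i j, Continuous fun t => (frameMatrix FE g τ θ (c t))⁻¹ i j := fun i j =>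
    contDiff_zero.1 (contDiff_inv_matrix (fun k l => hτ.contDiff_frameMatrix FE
      (fun F => contDiff_zero.2 (hF F)) k l) (fun t => det_frameMatrix_ne_zero hτ hθ FE (c t)) i j)
  have hmom : ∀ l, Continuous (momentum (fun i j => hτ.pull (FM.gram g i j))
      (fun i => hτ.pull (FM.fn i)) (FE.along l) c) := fun l => by
    refine continuous_finsetSum _ fun j _ => continuous_finsetSum _ fun i _ =>
      ((hF _).mul (hF _)).mul ?_
    simp only [hτ.pull_apply, hcν]
    exact (contDiff_deriv_comp_curve hν (FM.fn j)).continuous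
  refine ⟨fun t => ∑ k, FE.along k F (c t) * ∑ l, (frameMatrix FE g τ θ (c t))⁻¹ k l
    * (momentum (fun i j => hτ.pull (FM.gram g i j)) (fun i => hτ.pull (FM.fn i)) (FE.along l) c t
      + FE.coeff θ l (c t) * β), ?_, fun t ht => ?_⟩
  · exact continuous_finsetSum _ fun k _ => (hF _).mul (continuous_finsetSum _ fun l _ =>
      (hinv k l).mul ((hmom l).add ((hF _).mul continuous_const)))
  · have hct := h.mdifferentiableAt t ht
    have hlin : linDensity (FE.coeff θ) FE.fn c t = β := by
      rw [← h.form t ht, FE.form_eq_sum]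
      exact Finset.sum_congr rfl fun k _ => by
        rw [(hasDerivAt_comp_velocity (FE.fn k) hct).deriv]
    convert! FE.hasDerivAt_comp F hct using 1
    refine Finset.sum_congr rfl fun k _ => congrArg₂ (· * ·) rfl ?_
    rw [deriv_fn_eq (g := g) hτ hθ FE hct]
    refine Finset.sum_congr rfl fun l _ => ?_
    rw [hτ.liftedInner_eq_momentum FM FE hct, hlin]

/-- A closed curve in the base is the projection of a loop of constant vertical speed: a horizontal
lift over a period ends at a rotation of its initial point, and this rotation is undone
at constant speed. -/
theorem exists_closed_lift (hτ : IsPrincipalCircleBundle n τ) (hθ : IsConnectionForm θ)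
    (g : Metric n M) (hν : ContMDiff 𝓘(ℝ, ℝ) (𝓡 n) 2 ν) (hp : Function.Periodic ν 1) :
    ∃ (γ : H1Loop (n + 1) E) (β : ℝ), (∀ t, τ (γ.toFun t) = ν t) ∧
      IsLiftOn τ θ ν β (Ioo 0 1) γ.toFun := by
  have hE : CompactSpace E := hτ.compactSpace
  obtain ⟨c₀, hc₀⟩ := hτ.exists_lift hθ hν
  obtain ⟨α, hα⟩ := hτ.exists_smul_eq (q := c₀ 0) (q' := c₀ 1) (by
    have e1 := (hc₀.proj 0 (by simp)).self_of_nhds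
    have e2 := (hc₀.proj 1 (by simp)).self_of_nhds
    have e3 := hp 0
    rw [zero_add] at e3
    rw [e1, e2, e3])
  obtain ⟨β, c, hc, hc1⟩ : ∃ (β : ℝ) (c : ℝ → E), IsLiftOn τ θ ν β (Icc 0 1) c ∧ c 0 = c 1 := by
    refine ⟨_, _, hc₀.rotate_mul hτ hθ (-α), ?_⟩
    rw [hα, mul_zero, rotate_zero]
    simp only [rotate, smul_smul, ← Circle.exp_add]
    simp
  set d : ℝ → E := fun t => c (Int.fract t) with hd
  have hdper : Function.Periodic d 1 := fun t => by simp only [hd, Int.fract_add_one]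
  have hdc : Continuous d := ContinuousOn.comp_fract''
    (fun t ht => (hc.mdifferentiableAt t ht).continuousAt.continuousWithinAt) hc1
  have hdν : ∀ t, τ (d t) = ν t := fun t => by
    rw [hd]
    simp only
    rw [(hc.proj _ ⟨Int.fract_nonneg t, (Int.fract_lt_one t).le⟩).self_of_nhds, Int.fract]
    have := hp.sub_zsmul_eq (x := t) ⌊t⌋
    simpa using this
  have hdl : IsLiftOn τ θ ν β (Ioo 0 1) d := (hc.mono Ioo_subset_Icc_self).congr fun t ht => by
    filter_upwards [isOpen_Ioo.mem_nhds ht] with r hr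
    rw [hd]
    simp only
    rw [Int.fract_eq_self.2 ⟨hr.1.le, hr.2⟩]
  have hH : ∀ F : C^∞⟮𝓡 (n + 1), E; 𝓘(ℝ, ℝ), ℝ⟯, PeriodicH1 fun t => F (d t) := fun F => by
    obtain ⟨v, hv, hv'⟩ := hτ.exists_continuous_deriv hθ g hν hdc hdν hdl F
    refine PeriodicH1.of_eq_integral (v := v) (fun t => by simp only [hdper t])
      (memLp_two_of_continuousOn hv.continuousOn) fun t ht => ?_
    rw [intervalIntegral.integral_eq_sub_of_hasDerivAt_of_le ht.1
      (F.contMDiff.continuous.comp hdc).continuousOn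
      (fun r hr => hv' r ⟨hr.1, hr.2.trans_le ht.2⟩) (hv.intervalIntegrable _ _)]
    simp only [Function.comp]
    ring
  exact ⟨⟨d, hdper, hdc, fun F => (hH F).absolutelyContinuous, fun F => (hH F).memLp_deriv⟩, β,
    hdν, hdl⟩

end IsPrincipalCircleBundle

end ClosedLift

/-! ### Closed magnetic geodesics are projections of critical points -/

section GeodesicToCritical

variable {n : ℕ} {M : Type*} [TopologicalSpace M] [T2Space M] [CompactSpace M]
  [ChartedSpace (EuclideanSpace ℝ (Fin n)) M] [IsManifold (𝓡 n) ∞ M]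
  {E : Type*} [TopologicalSpace E] [T2Space E]
  [ChartedSpace (EuclideanSpace ℝ (Fin (n + 1))) E] [IsManifold (𝓡 (n + 1)) ∞ E]
  [MulAction Circle E] {τ : E → M} {ι κ : Type*} [Fintype ι] [Fintype κ]
  {g : Metric n M} {θ : OneForm (n + 1) E} {σ : TwoForm n M} {γ : H1Loop (n + 1) E}

namespace IsPrincipalCircleBundle

/-- If the projection of a loop solves the equation `∇ₜν' = T Y(ν')`, then the first variation of
kinetic energy plus `T` times the circulation of the connection form vanishes, since its integrand
is a total derivative. -/
theorem integral_quadVariation_eq [CompactSpace E] (hτ : IsPrincipalCircleBundle n τ)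
    (hσ : HasCurvature τ θ σ) (FM : SmoothFrame n M ι) (FE : SmoothFrame (n + 1) E κ)
    (hν : ContMDiff 𝓘(ℝ, ℝ) (𝓡 n) 2 fun s => τ (γ.toFun s))
    (hγ : ∀ t ∈ Ioo (0 : ℝ) 1, MDifferentiableAt 𝓘(ℝ, ℝ) (𝓡 (n + 1)) γ.toFun t) {T : ℝ}
    (hacc : ∀ t, covariantAcceleration g (fun s => τ (γ.toFun s)) t
      = T • lorentzForce g σ (τ (γ.toFun t)) (velocity (fun s => τ (γ.toFun s)) t))
    {c : ℝ → LoopSpace (n + 1) E} (hc : IsC1Curve c) (h0 : (c 0).1 = γ) :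
    ∫ t in (0 : ℝ)..1, quadVariation (fun i j => hτ.pull (FM.gram g i j))
        (fun i => hτ.pull (FM.fn i)) γ.toFun (variation c) t
      = -(T * ∫ t in (0 : ℝ)..1, linVariation (FE.coeff θ) FE.fn γ.toFun (variation c) t) := by
  subst h0
  set γ := (c 0).1
  -- the integrand is the derivative of `∑ Aⱼ Dⱼ + T ∑ bᵢ D(fᵢ)`, of class `H¹` on the circle
  set A : ι → ℝ → ℝ := fun j s => ∑ i, FM.gram g i j (τ (γ.toFun s))
    * deriv (fun r => FM.fn i (τ (γ.toFun r))) s with hA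
  have hA1 : ∀ j, PeriodicH1 (A j) := fun j => by
    have h1 : ContDiff ℝ 1 (A j) := contDiff_momentum hν (FM.gram g) FM.fn j
    have h2 : Function.Periodic (A j) 1 := fun t => by
      have h3 : ∀ F : C^∞⟮𝓡 n, M; 𝓘(ℝ, ℝ), ℝ⟯,
          Function.Periodic (deriv fun r => F (τ (γ.toFun r))) 1 := fun F =>
        periodic_deriv_comp γ.periodic (hτ.pull F)
      simp only [hA, γ.periodic t, h3 _ t]
    refine PeriodicH1.of_eq_integral (v := deriv (A j)) h2
      (memLp_two_of_continuousOn (h1.continuous_deriv le_rfl).continuousOn) fun t _ => ?_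
    rw [intervalIntegral.integral_deriv_eq_sub (fun s _ => h1.differentiable one_ne_zero s)
      ((h1.continuous_deriv le_rfl).intervalIntegrable _ _)]
    ring
  have hW1 : PeriodicH1 fun s => ∑ j, A j s * variation c (hτ.pull (FM.fn j)) s :=
    PeriodicH1.sum _ fun j => (hA1 j).mul (hc.variation_periodicH1 _)
  have hW2 : PeriodicH1 fun s => ∑ i, FE.coeff θ i (γ.toFun s) * variation c (FE.fn i) s :=
    PeriodicH1.sum _ fun i => (γ.periodicH1 _).mul (hc.variation_periodicH1 _)
  have hW := hW1.add ((PeriodicH1.const T).mul hW2)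
  have hL : IntervalIntegrable (linVariation (FE.coeff θ) FE.fn γ.toFun (variation c)) volume 0 1 :=
    MemLp.intervalIntegrable_unit (hc.memLp_linVariation (FE.coeff θ) FE.fn)
  have hWL := intervalIntegral.integral_sub (MemLp.intervalIntegrable_unit hW.memLp_deriv)
    (hL.const_mul T)
  rw [hW.integral_deriv, zero_sub, intervalIntegral.integral_const_mul] at hWL
  rw [← hWL]
  refine intervalIntegral.integral_congr_ae_restrict ?_
  rw [uIoc_of_le zero_le_one]
  filter_upwards [ae_unitMeasure_mem_Ioo, hW1.ae_hasDerivAt, hW2.ae_hasDerivAt,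
    ae_all_iff.2 fun i => (hc.variation_periodicH1 (hτ.pull (FM.fn i))).ae_hasDerivAt,
    ae_all_iff.2 fun i => (hc.variation_periodicH1 (FE.fn i)).ae_hasDerivAt]
    with t ht h1 h2 h3 h4
  obtain ⟨V, hV⟩ := hc.exists_vector (Ioo_subset_Icc_self ht)
  rw [hτ.quadVariation_eq (g := g) FM hν (fun i => (h3 i).differentiableAt)
      (u := mfderiv (𝓡 (n + 1)) (𝓡 n) τ (γ.toFun t) V)
      (fun F => by rw [hV, hτ.differential_pull]),
    linVariation_eq θ _ _ (FE.form_eq_sum θ) (hγ t ht) (fun i => (h4 i).differentiableAt) hV,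
    (h1.fun_add (h2.const_mul T)).deriv, hσ, ← hτ.velocity_proj (hγ t ht)]
  have h5 : g.inner (τ (γ.toFun t)) (mfderiv (𝓡 (n + 1)) (𝓡 n) τ (γ.toFun t) V)
      (covariantAcceleration g (fun s => τ (γ.toFun s)) t)
      = T * σ.form (τ (γ.toFun t)) (mfderiv (𝓡 (n + 1)) (𝓡 n) τ (γ.toFun t) V)
        (velocity (fun s => τ (γ.toFun s)) t) := by
    rw [hacc, map_smul, inner_lorentzForce, smul_eq_mul]
  rw [h5]
  ring

/-- A loop of vertical speed `β` whose projection is, up to the period, a magnetic geodesic of the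
right energy is critical, with the phase `φ` such that `β + φ` is the period. -/
theorem isCriticalPoint_of_lift (hτ : IsPrincipalCircleBundle n τ) (hθ : IsConnectionForm θ)
    (hσ : HasCurvature τ θ σ) (hν : ContMDiff 𝓘(ℝ, ℝ) (𝓡 n) 2 fun s => τ (γ.toFun s)) {β k : ℝ}
    (hγ : IsLiftOn τ θ (fun s => τ (γ.toFun s)) β (Ioo 0 1) γ.toFun) {T : Ioi (0 : ℝ)}
    (hacc : ∀ t, covariantAcceleration g (fun s => τ (γ.toFun s)) t
      = (T : ℝ) • lorentzForce g σ (τ (γ.toFun t)) (velocity (fun s => τ (γ.toFun s)) t))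
    (hen : ∀ t, g.inner (τ (γ.toFun t)) (velocity (fun s => τ (γ.toFun s)) t)
      (velocity (fun s => τ (γ.toFun s)) t) = 2 * (T : ℝ) ^ 2 * (k - 1 / 2)) :
    IsCriticalPoint (actionFunctional g τ θ k) (γ, T, T - β) := by
  intro c hc h0
  have hE : CompactSpace E := hτ.compactSpace
  obtain ⟨S, ⟨FM⟩⟩ := exists_smoothFrame n M
  obtain ⟨S', ⟨FE⟩⟩ := exists_smoothFrame (n + 1) E
  have hT : (0 : ℝ) < T := T.2
  have hc0 : (c 0).1 = γ := by rw [h0]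
  have hquad : ∫ t in (0 : ℝ)..1, quadDensity (fun i j => hτ.pull (FM.gram g i j))
      (fun i => hτ.pull (FM.fn i)) γ.toFun t = 2 * (T : ℝ) ^ 2 * (k - 1 / 2) := by
    refine (intervalIntegral.integral_congr (g := fun _ => 2 * (T : ℝ) ^ 2 * (k - 1 / 2))
      fun t _ => ?_).trans (by simp)
    have hmd : MDifferentiableAt 𝓘(ℝ, ℝ) (𝓡 n) (fun s => τ (γ.toFun s)) t :=
      hν.mdifferentiableAt (by simp)
    simp only
    rw [← hen t, FM.inner_eq_sum, quadDensity]
    simp only [← (hasDerivAt_comp_velocity _ hmd).deriv]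
    rfl
  have hlin : ∀ᵐ t ∂unitMeasure, linDensity (FE.coeff θ) FE.fn γ.toFun t + (T - β) = T := by
    filter_upwards [ae_unitMeasure_mem_Ioo] with t ht
    have h1 : linDensity (FE.coeff θ) FE.fn γ.toFun t = β := by
      rw [← hγ.form t ht, FE.form_eq_sum]
      exact Finset.sum_congr rfl fun k _ => by
        rw [(hasDerivAt_comp_velocity (FE.fn k) (hγ.mdifferentiableAt t ht)).deriv]
    rw [h1]
    ring
  have hlin2 : ∫ t in (0 : ℝ)..1, (linDensity (FE.coeff θ) FE.fn γ.toFun t + (T - β)) ^ 2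
      = (T : ℝ) ^ 2 := by
    rw [intervalIntegral.integral_congr_ae_restrict (g := fun _ => (T : ℝ) ^ 2) (by
      rw [uIoc_of_le zero_le_one]
      filter_upwards [hlin] with t ht
      rw [ht])]
    simp
  have hI : IntervalIntegrable (linVariation (FE.coeff θ) FE.fn γ.toFun (variation c)) volume 0 1 := by
    have := MemLp.intervalIntegrable_unit (hc.memLp_linVariation (FE.coeff θ) FE.fn)
    rwa [hc0] at this
  set φ' := deriv (fun s => (c s).2.2) 0
  have hcross : ∫ t in (0 : ℝ)..1, (linDensity (FE.coeff θ) FE.fn γ.toFun t + (T - β))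
      * (linVariation (FE.coeff θ) FE.fn γ.toFun (variation c) t + φ')
      = T * (∫ t in (0 : ℝ)..1, linVariation (FE.coeff θ) FE.fn γ.toFun (variation c) t)
        + T * φ' := by
    rw [intervalIntegral.integral_congr_ae_restrict (g := fun t =>
        (T : ℝ) * (linVariation (FE.coeff θ) FE.fn γ.toFun (variation c) t + φ')) (by
      rw [uIoc_of_le zero_le_one]
      filter_upwards [hlin] with t ht
      rw [ht])]
    rw [intervalIntegral.integral_const_mul, intervalIntegral.integral_add hI
      (intervalIntegrable_const), mul_add]
    simp
  refine (hτ.hasDerivAt_actionFunctional FM FE g θ hθ k hc h0).congr_deriv ?_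
  rw [hquad, hlin2, hcross,
    hτ.integral_quadVariation_eq hσ FM FE hν (fun t ht => hγ.mdifferentiableAt t ht) hacc hc hc0]
  field_simp
  ring

/-- Every closed magnetic geodesic is the projection of a critical point. -/
theorem exists_isCriticalPoint_of_isClosedMagneticGeodesic (hτ : IsPrincipalCircleBundle n τ)
    (hθ : IsConnectionForm θ) (hσ : HasCurvature τ θ σ) {k : ℝ} {T : Ioi (0 : ℝ)} {μ : ℝ → M}
    (hμ : IsClosedMagneticGeodesic g σ T (k - 1 / 2) μ) :
    ∃ (γ : H1Loop (n + 1) E) (φ : ℝ), (∀ t : ℝ, μ t = τ (γ.toFun (t / (T : ℝ)))) ∧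
      IsCriticalPoint (actionFunctional g τ θ k) (γ, T, φ) := by
  have hT : (0 : ℝ) < T := T.2
  have hν : ContMDiff 𝓘(ℝ, ℝ) (𝓡 n) 2 fun s => μ ((T : ℝ) * s) :=
    hμ.contMDiff.comp (contDiff_const.mul contDiff_id).contMDiff
  obtain ⟨γ, β, hγν, hγ⟩ := hτ.exists_closed_lift hθ g hν fun t => by
    simp only [mul_add, mul_one, hμ.periodic _]
  have hfun : (fun s => μ ((T : ℝ) * s)) = fun s => τ (γ.toFun s) := funext fun s => (hγν s).symm
  have hacc : ∀ t, covariantAcceleration g (fun s => μ ((T : ℝ) * s)) t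
      = (T : ℝ) • lorentzForce g σ (μ (T * t)) (velocity (fun s => μ ((T : ℝ) * s)) t) := fun t => by
    rw [covariantAcceleration_comp_mul g hμ.contMDiff, velocity_comp_mul hμ.contMDiff, hμ.equation]
    refine eq_of_inner_eq g fun u => ?_
    rw [map_smul, map_smul, inner_lorentzForce, inner_lorentzForce, map_smul, smul_eq_mul,
      smul_eq_mul, smul_eq_mul]
    ring
  have hen : ∀ t, g.inner (μ (T * t)) (velocity (fun s => μ ((T : ℝ) * s)) t)
      (velocity (fun s => μ ((T : ℝ) * s)) t) = 2 * (T : ℝ) ^ 2 * (k - 1 / 2) := fun t => by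
    rw [velocity_comp_mul hμ.contMDiff, map_smul, map_smul, smul_apply, smul_eq_mul, smul_eq_mul,
      ← hμ.energy (T * t)]
    ring
  have key : ∀ ν : ℝ → M, (fun s => μ ((T : ℝ) * s)) = ν → ContMDiff 𝓘(ℝ, ℝ) (𝓡 n) 2 ν ∧
      (∀ t, covariantAcceleration g ν t = (T : ℝ) • lorentzForce g σ (ν t) (velocity ν t)) ∧
      ∀ t, g.inner (ν t) (velocity ν t) (velocity ν t) = 2 * (T : ℝ) ^ 2 * (k - 1 / 2) := by
    rintro _ rfl
    exact ⟨hν, hacc, hen⟩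
  obtain ⟨hν', hacc', hen'⟩ := key _ hfun
  rw [hfun] at hγ
  refine ⟨γ, T - β, fun t => ?_, hτ.isCriticalPoint_of_lift hθ hσ hν' hγ hacc' hen'⟩
  rw [hγν, mul_div_cancel₀ _ hT.ne']

end IsPrincipalCircleBundle

end GeodesicToCritical

end Magnetic

theorem mainTheorem3 (n : ℕ)
    {M : Type*} [TopologicalSpace M] [T2Space M] [CompactSpace M]
    [ChartedSpace (EuclideanSpace ℝ (Fin n)) M] [IsManifold (𝓡 n) ∞ M]
    {E : Type*} [TopologicalSpace E] [T2Space E]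
    [ChartedSpace (EuclideanSpace ℝ (Fin (n + 1))) E] [IsManifold (𝓡 (n + 1)) ∞ E]
    [MulAction Circle E]
    (g : Magnetic.Metric n M) (σ : Magnetic.TwoForm n M)
    (τ : E → M) (hτ : Magnetic.IsPrincipalCircleBundle n τ)
    (θ : Magnetic.OneForm (n + 1) E) (hθ : Magnetic.IsConnectionForm θ)
    (hσ : Magnetic.HasCurvature τ θ σ) (k : ℝ) :
    (∀ (γ : Magnetic.H1Loop (n + 1) E) (T : Set.Ioi (0 : ℝ)) (φ : ℝ),
      Magnetic.IsCriticalPoint (Magnetic.actionFunctional g τ θ k) (γ, T, φ) →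
      Magnetic.IsClosedMagneticGeodesic g σ T (k - 1 / 2)
        (fun t : ℝ => τ (γ.toFun (t / (T : ℝ))))) ∧
    (∀ (T : Set.Ioi (0 : ℝ)) (μ : ℝ → M),
      Magnetic.IsClosedMagneticGeodesic g σ T (k - 1 / 2) μ →
      ∃ (γ : Magnetic.H1Loop (n + 1) E) (φ : ℝ),
        (∀ t : ℝ, μ t = τ (γ.toFun (t / (T : ℝ)))) ∧
        Magnetic.IsCriticalPoint (Magnetic.actionFunctional g τ θ k) (γ, T, φ)) := by
  exact ⟨fun _ _ _ h => hτ.isClosedMagneticGeodesic_of_critical hθ hσ h,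
    fun _ _ h => hτ.exists_isCriticalPoint_of_isClosedMagneticGeodesic hθ hσ h⟩
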